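/- **Conventions.** A *collection of disjoint simple closed curves with corners* in $S^2$ is a finite set $\mathscr C$ of pairwise disjoint smoothly embedded circles in $S^2$, together with finitely many marked points on them (the *corners*) and, for each corner $x$, the choice of which of the two components of $S^2\setminus\mathscr C$ adjacent to $x$ has a $\frac{\pi}{2}$ corner at $x$; the other one has the complementary $\frac{3\pi}{2}$ corner. The external angle $\angle_K(x)$ is $\frac{\pi}{2}$ if $K$ is the first of these components and $-\frac{3\pi}{2}$ if it is the second. A *Gauss–Bonnet weighting* of $\mathscr C$ assigns to each pair $(\gamma,K)$, with $\gamma\in\mathscr C$ and $K$ a component of $S^2\setminus\mathscr C$ with $\gamma\subset\partial K$, an integer $w_K(\gamma)$ (so each $\gamma$ gets two weights, one for each side), such that * $w_K(\gamma)=\tau(\gamma)+\sum_{x}\frac{\angle_K(x)}{2\pi}$, the sum being over the corners $x$ of $\gamma$, for some real number $\tau(\gamma)$ independent of the side $K$; and * $\sum_{\gamma\subset\partial K}w_K(\gamma)=\chi(\overline K)$ for every component $K$ of $S^2\setminus\mathscr C$. Let $\pi:\mathbb R^2\times\mathbb R\to\mathbb R^2$ be the projection. The *crease set* of a smooth embedding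 $\varepsilon:S^2\to\mathbb R^2\times\mathbb R$ is the set of critical points of $\pi\circ\varepsilon$. The embedding is *regular* if its Gauss map is transverse to the equator of the unit sphere (so that the crease set is a smooth closed $1$-manifold), the restriction of $\pi\circ\varepsilon$ to the crease set has rank one except at finitely many points, all of which are *corners* (points where the sign of the fold along the crease changes), and the image of the crease set intersects itself only in transverse double points. At a corner $x$, $\pi\circ\varepsilon$ is injective near $x$ on exactly one of the two adjacent components of the complement of the crease set; $x$ counts as a $\frac{\pi}{2}$ corner of that component and a $\frac{3\pi}{2}$ corner of the other. The embedding *realizes* $\mathscr C$ if its crease set, its corners and the kinds of its corners are those of $\mathscr C$. Its *turning number function* $\mathbf T$ assigns to each pair $(\gamma,K)$ as above the turning number of $\pi\circ\varepsilon(\hat\gamma)$, where $\hat\gamma$ is a smooth push-off of $\gamma$ into $K$, oriented like the boundary of $K$ for the orientation pulled back from $\mathbb R^2$; thus $\mathbf T$ assigns to every $\gamma\in\mathscr C$ a pair of integers, one for each side. **Theorem 1.1.** Let $\mathscr C$ be a collection of disjoint simple closed curves with corners in $S^2$. Then $\mathscr C$ has at most one Gauss–Bonnet weighting. Moreover, any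 two regular embeddings $S^2\to\mathbb R^2\times\mathbb R$ that realize $\mathscr C$ have the same turning number function $\mathbf T:\mathscr C\to\mathbb Z^2$. -/

import Mathlib

open Set Metric Topology
open scoped Manifold ContDiff

noncomputable section

namespace CreaseSurface

/-- Euclidean space `ℝ³ = ℝ² × ℝ`; the last coordinate is the vertical one. -/
abbrev E3 : Type := EuclideanSpace ℝ (Fin 3)

/-- The unit sphere `S²`, with Mathlib's smooth structure. -/
abbrev S2 : Type := sphere (0 : E3) 1

/-- The projection `π : ℝ² × ℝ → ℝ²`; the target plane is written as `ℂ`, with its usual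
orientation. -/
def proj (x : E3) : ℂ := ⟨x 0, x 1⟩

/-- The upward vertical unit vector. -/
def vert : E3 := EuclideanSpace.single 2 1

/-! ### Curves on the sphere, and collections of curves with corners -/

/-- The velocity of a curve in `S²`, as a vector of the ambient `ℝ³`. -/
def velocity (c : ℝ → S2) (t : ℝ) : E3 := deriv (fun s => (c s : E3)) t

/-- A smooth regular (nowhere stationary) parametrized curve in `S²`. -/
def IsRegularCurve (c : ℝ → S2) : Prop :=
  ContMDiff 𝓘(ℝ, ℝ) (𝓡 2) ∞ c ∧ ∀ t, velocity c t ≠ 0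

/-- `γ ⊆ S²` is a smooth simple closed curve: the image of a smooth regular `1`-periodic
parametrization that is injective modulo the period. -/
def IsSmoothSimpleClosedCurve (γ : Set S2) : Prop :=
  ∃ c : ℝ → S2, IsRegularCurve c ∧ (∀ s, c (s + 1) = c s) ∧
    (∀ s t, c s = c t → ∃ k : ℤ, t = s + k) ∧ range c = γ

/-- The connected components of an open subset `V` of `S²`. -/
def components (V : Set S2) : Set (Set S2) :=
  {K | ∃ p ∈ V, K = connectedComponentIn V p}

/-- A finite collection of pairwise disjoint simple closed curves with corners in `S²`.
The curves are smooth circles with finitely many marked points, the corners. At a corner one of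
the two adjacent complementary components has a `π/2` corner and the other one the complementary
`3π/2` corner (external angles `π/2` and `-3π/2`); `convexRegion x` is the
component in which the corner `x` has external angle `π/2`
(it is irrelevant when `x` is not a corner). -/
structure CurvesWithCorners where
  /-- the curves -/
  curves : Set (Set S2)
  finite_curves : curves.Finite
  isCurve : ∀ γ ∈ curves, IsSmoothSimpleClosedCurve γ
  pairwise_disjoint : curves.Pairwise Disjoint
  /-- the corners -/
  corners : Set S2
  finite_corners : corners.Finite
  corners_subset : corners ⊆ ⋃₀ curves
  /-- the side of a corner on which the external angle is `π/2` -/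
  convexRegion : S2 → Set S2
  convexRegion_mem : ∀ x ∈ corners, convexRegion x ∈ components (⋃₀ curves)ᶜ
  mem_closure_convexRegion : ∀ x ∈ corners, x ∈ closure (convexRegion x)

namespace CurvesWithCorners

/-- The components `K` of the complement of the curves. -/
def regions (C : CurvesWithCorners) : Set (Set S2) := components (⋃₀ C.curves)ᶜ

/-- A side: a curve `γ` together with a complementary component `K` such that `γ ⊆ ∂K`. A curve
has two sides, so a function on the sides assigns to each curve a pair of values, labelled by the
two components which the curve borders. -/
structure Side (C : CurvesWithCorners) where
  curve : Set S2
  region : Set S2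
  curve_mem : curve ∈ C.curves
  region_mem : region ∈ C.regions
  subset_frontier : curve ⊆ frontier region

open Classical in
/-- The external angle of a corner `x` with respect to an adjacent component `K`. -/
def externalAngle (C : CurvesWithCorners) (x : S2) (K : Set S2) : ℝ :=
  if K = C.convexRegion x then Real.pi / 2 else -(3 * Real.pi / 2)

end CurvesWithCorners

/-! ### Gauss–Bonnet weightings -/

/-- The Euler characteristic of a space with finitely generated singular homology:
the alternating sum of its rational Betti numbers. -/
def eulerChar (X : Type) [TopologicalSpace X] : ℤ :=
  ∑ᶠ n : ℕ, (-1 : ℤ) ^ n * (Module.finrank ℚ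
    (((AlgebraicTopology.singularHomologyFunctor (ModuleCat.{0} ℚ) n).obj
      (ModuleCat.of ℚ ℚ)).obj (TopCat.of X)) : ℤ)

/-- A Gauss–Bonnet weighting: integers `w (γ, K)` for the two sides of every curve such that
* `w (γ, K) = τ γ + ∑ ∠_K(x) / 2π`, summed over the corners `x` of `γ`, where `τ γ` (the total
  partial turning number of the smooth arcs of `γ`) does not depend on the side of `γ`;
* for every complementary component `K` the weights `w (γ, K)` of its boundary curves add up to
  the Euler characteristic of the closure of `K`. -/
def CurvesWithCorners.IsGaussBonnetWeighting (C : CurvesWithCorners) (w : C.Side → ℤ) : Prop :=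
  (∃ τ : Set S2 → ℝ, ∀ s : C.Side, (w s : ℝ) =
    τ s.curve + ∑ᶠ x ∈ C.corners ∩ s.curve, C.externalAngle x s.region / (2 * Real.pi)) ∧
  ∀ K ∈ C.regions, ∑ᶠ s ∈ {s : C.Side | s.region = K}, w s = eulerChar (closure K)

/-! ### Regular embeddings of the sphere and their crease sets -/

/-- A smooth embedding of (the compact surface) `S²` into `ℝ² × ℝ`. -/
def IsSmoothEmbedding (ε : S2 → E3) : Prop :=
  ContMDiff (𝓡 2) 𝓘(ℝ, E3) ∞ ε ∧ Function.Injective ε ∧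
    ∀ p, Function.Injective (mfderiv (𝓡 2) 𝓘(ℝ, E3) ε p)

/-- The crease set: the critical points of `π ∘ ε`. -/
def creaseSet (ε : S2 → E3) : Set S2 :=
  {p | ¬ Function.Surjective (mfderiv (𝓡 2) 𝓘(ℝ, ℂ) (proj ∘ ε) p)}

/-- `N` is a Gauss map of `ε`: a smooth unit normal field. (It is unique up to a global sign;
nothing below depends on this sign.) -/
def IsGaussMap (ε N : S2 → E3) : Prop :=
  ContMDiff (𝓡 2) 𝓘(ℝ, E3) ∞ N ∧ (∀ p, ‖N p‖ = 1) ∧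
    ∀ p, ∀ v : TangentSpace (𝓡 2) p,
      inner ℝ (E := E3) (mfderiv (𝓡 2) 𝓘(ℝ, E3) ε p v) (N p) = 0

/-- The derivative at `p` in the direction `v` of the vertical component of the normal field. -/
def dVertNormal (N : S2 → E3) (p : S2) (v : TangentSpace (𝓡 2) p) : ℝ :=
  mfderiv (𝓡 2) 𝓘(ℝ, ℝ) (fun q => N q 2) p v

/-- The Gauss map is transverse to the equator of the unit sphere. -/
def IsTransverseToEquator (N : S2 → E3) : Prop :=
  ∀ p, N p 2 = 0 → ∃ v : TangentSpace (𝓡 2) p, dVertNormal N p v ≠ 0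

/-- At a crease point `p`, let `v` be the tangent vector that `ε` maps to the upward vertical
vector. The surface folds positively at `p` if the normals turn up in the direction `v`, that is
if they point away from each other on the two sides of the crease. -/
def FoldsPositively (ε N : S2 → E3) (p : S2) : Prop :=
  ∃ v : TangentSpace (𝓡 2) p, mfderiv (𝓡 2) 𝓘(ℝ, E3) ε p v = vert ∧ 0 < dVertNormal N p v

/-- The surface folds negatively at `p`: the normals on the two sides of the crease point towards
each other. -/
def FoldsNegatively (ε N : S2 → E3) (p : S2) : Prop :=
  ∃ v : TangentSpace (𝓡 2) p, mfderiv (𝓡 2) 𝓘(ℝ, E3) ε p v = vert ∧ dVertNormal N p v < 0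

/-- A smooth regular parametrized curve running in the crease set. -/
def IsCreaseCurve (ε : S2 → E3) (c : ℝ → S2) : Prop :=
  IsRegularCurve c ∧ ∀ t, c t ∈ creaseSet ε

/-- The velocity of the projection of a curve to the plane. -/
def projVelocity (ε : S2 → E3) (c : ℝ → S2) (t : ℝ) : ℂ := deriv (fun s => proj (ε (c s))) t

/-- `x` is a point of the crease set at which the differential of the restriction of `π ∘ ε` to
the crease set has rank `0`, i.e. the crease is vertical at `x`. -/
def IsRankZeroPoint (ε : S2 → E3) (x : S2) : Prop :=
  ∃ c, IsCreaseCurve ε c ∧ c 0 = x ∧ projVelocity ε c 0 = 0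

/-- `x` is a corner of the crease set: a point at which the folding sign of the crease changes. -/
def IsCorner (ε : S2 → E3) (x : S2) : Prop :=
  ∃ N c, IsGaussMap ε N ∧ IsCreaseCurve ε c ∧ c 0 = x ∧ ∃ δ > 0,
    (∀ t ∈ Ioo (-δ) 0, FoldsNegatively ε N (c t)) ∧ ∀ t ∈ Ioo 0 δ, FoldsPositively ε N (c t)

/-- Regular embeddings: the Gauss map is transverse to the equator; `d(π ∘ ε|_𝒞)` has rank one
except at finitely many points, all of which are corners; the projection of the crease set
intersects itself only in transverse double points. -/
structure IsRegularEmbedding (ε : S2 → E3) : Prop where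
  embedding : IsSmoothEmbedding ε
  transverse : ∃ N, IsGaussMap ε N ∧ IsTransverseToEquator N
  finite_rankZero : {x | IsRankZeroPoint ε x}.Finite
  corner_of_rankZero : ∀ x, IsRankZeroPoint ε x → IsCorner ε x
  transverse_double : ∀ c₁ c₂, IsCreaseCurve ε c₁ → IsCreaseCurve ε c₂ → c₁ 0 ≠ c₂ 0 →
    proj (ε (c₁ 0)) = proj (ε (c₂ 0)) →
    LinearIndependent ℝ ![projVelocity ε c₁ 0, projVelocity ε c₂ 0]
  no_triple : ∀ x ∈ creaseSet ε, ∀ y ∈ creaseSet ε, ∀ z ∈ creaseSet ε,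
    proj (ε x) = proj (ε y) → proj (ε y) = proj (ε z) → x = y ∨ y = z ∨ x = z

/-- At the corner `x` the component `K` projects injectively near `x`, so that its image is a
sector of small interior angle: the external angle of `x` with respect to `K` is positive. On the
other side of the crease the projection of the surface turns around the image of `x` by more than
a full turn and overlaps itself, and the external angle is negative. -/
def IsConvexAt (ε : S2 → E3) (x : S2) (K : Set S2) : Prop :=
  ∃ U ∈ 𝓝 x, InjOn (proj ∘ ε) (U ∩ K)

/-- The regular embedding `ε` realizes the collection `C` as its crease set: the curves, the
corners, and the kind of each corner (which side has external angle `π/2` and which one has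
`-3π/2`) are those of `C`. -/
structure CurvesWithCorners.IsRealizedBy (C : CurvesWithCorners) (ε : S2 → E3) : Prop where
  regular : IsRegularEmbedding ε
  creaseSet_eq : creaseSet ε = ⋃₀ C.curves
  mem_corners_iff : ∀ x, x ∈ C.corners ↔ IsCorner ε x
  convex : ∀ x ∈ C.corners, IsConvexAt ε x (C.convexRegion x)

/-! ### Turning numbers -/

/-- The `1`-periodic plane curve `f` with nowhere vanishing velocity has turning number `n`: a
continuous angle function `θ` of its velocity satisfies `θ 1 - θ 0 = 2πn`. -/
def HasTurningNumber (f : ℝ → ℂ) (n : ℤ) : Prop :=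
  ∃ θ : ℝ → ℝ, Continuous θ ∧
    (∀ s, deriv f s ≠ 0 ∧ deriv f s = ‖deriv f s‖ * Complex.exp (θ s * Complex.I)) ∧
    θ 1 - θ 0 = 2 * Real.pi * n

/-- The oriented area spanned by two vectors of the plane. -/
def area (a b : ℂ) : ℝ := a.re * b.im - a.im * b.re

/-- `H` describes a smooth push-off of the crease curve `γ` into the component `K`: on
`ℝ/ℤ × [0,1]` it is an embedded annulus which starts at `γ` and is otherwise contained in `K`; the
push-off is the closed curve `s ↦ H s 1`. The curves `H · t` are oriented as boundary curves of
`K`, for the orientation of `K` pulled back from the plane by `π ∘ ε`: tangent vector and inward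
vector form a positive basis. -/
structure IsPushOff (ε : S2 → E3) (γ K : Set S2) (H : ℝ → ℝ → S2) : Prop where
  smooth : ContMDiff 𝓘(ℝ, ℝ × ℝ) (𝓡 2) ∞ (fun z : ℝ × ℝ => H z.1 z.2)
  periodic : ∀ s t, H (s + 1) t = H s t
  injective : ∀ s s', ∀ t ∈ Icc (0 : ℝ) 1, ∀ t' ∈ Icc (0 : ℝ) 1,
    H s t = H s' t' → t = t' ∧ ∃ k : ℤ, s' = s + k
  immersion : ∀ s, ∀ t ∈ Icc (0 : ℝ) 1,
    LinearIndependent ℝ ![velocity (fun s' => H s' t) s, velocity (fun t' => H s t') t]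
  start : range (fun s => H s 0) = γ
  mem_region : ∀ s, ∀ t ∈ Ioc (0 : ℝ) 1, H s t ∈ K
  oriented : ∀ s, ∀ t ∈ Ioc (0 : ℝ) 1,
    0 < area (projVelocity ε (fun s' => H s' t) s) (projVelocity ε (fun t' => H s t') t)

/-- `T` is the turning number function of `ε`: `T (γ, K)` is the Gauss–Bonnet weight `t_K(γ)` of
`γ` with respect to `K`, the turning number of the projection of a push-off of `γ` into `K`. -/
def CurvesWithCorners.IsTurningNumberFunction (C : CurvesWithCorners) (ε : S2 → E3)
    (T : C.Side → ℤ) : Prop :=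
  ∀ s : C.Side, ∃ H, IsPushOff ε s.curve s.region H ∧
    HasTurningNumber (fun r => proj (ε (H r 1))) (T s)

end CreaseSurface

end

/-!
Both halves of the theorem say that data attached to the two sides of the curves of a collection in
the sphere are determined by the curves and their corners.

**Gauss–Bonnet weightings.** The difference of two weightings takes the same value on both sides of
a curve and has sum zero over the boundary of each complementary region. Every curve separates the
sphere (`exists_isSeparation`): otherwise a function jumping by `2πi` across the curve would
contradict the gluing of logarithms on the sphere (`exists_log_of_cover`, that is,
`H¹(S²; ℤ) = 0`). So the dual graph of the collection is a tree, and the difference vanishes by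
induction on the number of curves on one side of a given curve (`eq_zero_of_sum_eq_zero`).

**Turning numbers.** Let `f = π ∘ ε` be the projection of an embedding realizing the collection.
It is a local diffeomorphism off the curves, with a Jacobian that changes its sign across them, and
on the curves `df` takes values in the line spanned by a direction `u`, the quarter turn of the
horizontal normal (`IsRealizedBy.isFoldMap`). At a corner the image of the curve turns back, and the
convex side of the corner decides in which of the two directions: the map is never injective on the
side whose image protrudes beyond the tip of the cusp (`not_injOn_of_cusp`, `pos_of_injOn`). Hence,
for two embeddings with projections `f₀`, `f₁`, each curve `γ` has a sign `σ` such that at every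
point of `γ` the real numbers `df₀(v) / u₀` and `σ df₁(v) / u₁` are nonzero and have the same sign
for some vector `v` (`exists_common_sign`).

After a reflection of one of the planes if necessary, the Jacobians of `f₀` and `f₁` have the
same sign everywhere (`exists_jac_mul_sign`). Then, off the curves, twice the complex linear part of
`df₁ ∘ df₀⁻¹` is a nowhere vanishing function `G` for which `G · df₀(v)` and `df₁(v)` never point in
opposite directions (`dirQuotient_re_pos`). By the agreement along the curves, `G` is
homotopic near `γ` to `σ u₁ / u₀`, which extends over `γ` (`eventually_mem_slitPlane`). Since every
nowhere vanishing function on the sphere has a logarithm, so does `G` (`exists_log_dirQuotient`).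

Finally, in a collar of `γ`, the turning number of a push-off is, up to a sign depending only on
the orientation induced by `f` near the curve, the degree of the velocity of the images of the
parallels of `γ` (`turning_formula`). For `f₀` and `f₁` these degrees differ by the degree of `G`
along a parallel, and this is zero because `G` has a logarithm (`HasDegree.of_jac_mul_pos`).
-/

noncomputable section

namespace CreaseSurface

/-! ### Logarithms of complex functions on the sphere -/

/-- A continuous logarithm of `1` is constant on preconnected sets, as its values are discrete. -/
theorem eq_of_exp_eq_one_of_isPreconnected {X : Type*} [TopologicalSpace X] {S : Set X}
    (hS : IsPreconnected S) {h : X → ℂ} (hc : ContinuousOn h S)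
    (h1 : ∀ x ∈ S, Complex.exp (h x) = 1) {x y : X} (hx : x ∈ S) (hy : y ∈ S) : h x = h y := by
  have hT : DiscreteTopology (range ((↑) : ℤ → ℝ)) :=
    Int.isClosedEmbedding_coe_real.isEmbedding.toHomeomorph.discreteTopology
  have key : ∀ z ∈ S, ∃ n : ℤ, h z = n * (2 * Real.pi * Complex.I) := fun z hz =>
    Complex.exp_eq_one_iff.1 (h1 z hz)
  have h2 : (h x).im / (2 * Real.pi) = (h y).im / (2 * Real.pi) := by
    refine hS.constant_of_mapsTo (isDiscrete_iff_discreteTopology.2 hT)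
      (T := range ((↑) : ℤ → ℝ)) (f := fun z => (h z).im / (2 * Real.pi)) ?_ ?_ hx hy
    · exact (Complex.continuous_im.comp_continuousOn hc).div_const _
    · intro z hz
      obtain ⟨n, hn⟩ := key z hz
      refine ⟨n, ?_⟩
      have : (h z).im = n * (2 * Real.pi) := by rw [hn]; simp
      simp only [this]
      field_simp
  obtain ⟨n, hn⟩ := key x hx
  obtain ⟨m, hm⟩ := key y hy
  have e1 : (h x).im = n * (2 * Real.pi) := by rw [hn]; simp
  have e2 : (h y).im = m * (2 * Real.pi) := by rw [hm]; simp
  rw [e1, e2, mul_div_cancel_right₀ _ Real.two_pi_pos.ne',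
    mul_div_cancel_right₀ _ Real.two_pi_pos.ne'] at h2
  rw [hn, hm]
  have : n = m := by exact_mod_cast h2
  rw [this]

/-- A lift along the covering map `exp`. -/
theorem exists_log_of_simplyConnected {X : Type*} [TopologicalSpace X] [SimplyConnectedSpace X]
    [LocallyPathConnectedSpace X] {f : X → ℂ} (hf : Continuous f) (h0 : ∀ x, f x ≠ 0) :
    ∃ L : X → ℂ, Continuous L ∧ ∀ x, Complex.exp (L x) = f x := by
  obtain ⟨a⟩ : Nonempty X := inferInstance
  obtain ⟨F, ⟨-, hF⟩, -⟩ := Complex.isCoveringMap_exp.existsUnique_continuousMap_lifts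
    (⟨fun x => ⟨f x, h0 x⟩, by fun_prop⟩ : C(X, {z : ℂ // z ≠ 0})) a (Complex.log (f a))
    (Subtype.ext (Complex.exp_log (h0 a)))
  exact ⟨F, F.continuous, fun x => congrArg Subtype.val (congrFun hF x)⟩

/-- The complement of a point of the sphere is simply connected, by stereographic projection. The
value of the logarithm at the point itself is arbitrary. -/
theorem exists_log_punctured_sphere {f : S2 → ℂ} (hf : Continuous f) (h0 : ∀ x, f x ≠ 0) (v : S2) :
    ∃ L : S2 → ℂ, ContinuousOn L {v}ᶜ ∧ ∀ x, Complex.exp (L x) = f x := by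
  have hv : ‖(v : E3)‖ = 1 := by simp
  let e := stereographic hv
  have hsymm : Continuous e.symm := by
    have := e.continuousOn_symm
    rw [stereographic_target hv] at this
    exact continuousOn_univ.1 this
  obtain ⟨L, hL, hexp⟩ := exists_log_of_simplyConnected (f := fun w => f (e.symm w))
    (hf.comp hsymm) (fun w => h0 _)
  classical
  refine ⟨fun x => if x = v then Complex.log (f x) else L (e x), ?_, ?_⟩
  · have : ContinuousOn (fun x => L (e x)) {v}ᶜ := by
      have h1 := e.continuousOn
      rw [stereographic_source hv] at h1
      exact hL.comp_continuousOn h1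
    exact this.congr fun x hx => if_neg hx
  · intro x
    by_cases hx : x = v
    · simp only [hx, if_true]; exact Complex.exp_log (h0 v)
    · simp only [hx, if_false]
      rw [hexp, e.left_inv]
      rw [stereographic_source hv]; exact hx

/-- By stereographic projection, the complement of two antipodal points is a punctured plane. -/
theorem isPreconnected_compl_pair (v : S2) : IsPreconnected ({v}ᶜ ∩ {-v}ᶜ : Set S2) := by
  have hv : ‖(v : E3)‖ = 1 := by simp
  let e := stereographic hv
  have hsymm : Continuous e.symm := by
    have := e.continuousOn_symm
    rw [stereographic_target hv] at this
    exact continuousOn_univ.1 this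
  have hfin : Module.finrank ℝ (ℝ ∙ (v : E3))ᗮ = 2 := by
    have : Fact (Module.finrank ℝ E3 = 2 + 1) := ⟨by simp⟩
    exact Submodule.finrank_orthogonal_span_singleton
      (ne_zero_of_norm_ne_zero (by rw [hv]; norm_num))
  have hrank : 1 < Module.rank ℝ (ℝ ∙ (v : E3))ᗮ := by
    rw [← Module.finrank_eq_rank, hfin]; norm_num
  have h1 := (isConnected_compl_singleton_of_one_lt_rank hrank 0).isPreconnected.image e.symm
    hsymm.continuousOn
  convert h1 using 1
  ext x
  constructor
  · rintro ⟨hx, hx'⟩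
    have hs : x ∈ e.source := by rw [stereographic_source hv]; exact hx
    refine ⟨e x, ?_, e.left_inv hs⟩
    intro h
    apply hx'
    have h2 : e.symm (e x) = e.symm 0 := by rw [h]
    rw [e.left_inv hs] at h2
    rw [mem_singleton_iff, h2]
    have h3 : e (-v) = 0 := stereographic_apply_neg v
    have h4 : -v ∈ e.source := by
      rw [stereographic_source hv]
      intro h; exact (ne_neg_of_mem_unit_sphere ℝ v) (by simpa using h.symm)
    rw [← h3, e.left_inv h4]
  · rintro ⟨w, hw, rfl⟩
    have ht : w ∈ e.target := by rw [stereographic_target hv]; trivial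
    have hs := e.map_target ht
    constructor
    · rw [stereographic_source hv] at hs; exact hs
    · intro h
      apply hw
      have h3 : e (-v) = 0 := stereographic_apply_neg v
      rw [mem_singleton_iff] at h
      rw [mem_singleton_iff, ← h3, ← h, e.right_inv ht]

/-- Every nowhere vanishing continuous function on the sphere has a continuous logarithm. -/
theorem exists_log_sphere {f : S2 → ℂ} (hf : Continuous f) (h0 : ∀ x, f x ≠ 0) :
    ∃ L : S2 → ℂ, Continuous L ∧ ∀ x, Complex.exp (L x) = f x := by
  classical
  let v : S2 := ⟨EuclideanSpace.single 0 1, by simp⟩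
  obtain ⟨L₁, hc₁, he₁⟩ := exists_log_punctured_sphere hf h0 v
  obtain ⟨L₂, hc₂, he₂⟩ := exists_log_punctured_sphere hf h0 (-v)
  have hvne : v ≠ -v := ne_neg_of_mem_unit_sphere ℝ v
  -- on the overlap, which is connected, the two logarithms differ by a constant
  obtain ⟨k, hk⟩ : ∃ k : ℂ, ∀ x ∈ ({v}ᶜ ∩ {-v}ᶜ : Set S2), L₁ x - L₂ x = k := by
    by_cases hne : ({v}ᶜ ∩ {-v}ᶜ : Set S2).Nonempty
    · obtain ⟨y, hy⟩ := hne
      refine ⟨L₁ y - L₂ y, fun x hx => ?_⟩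
      refine eq_of_exp_eq_one_of_isPreconnected (isPreconnected_compl_pair v)
        (h := fun x => L₁ x - L₂ x)
        ((hc₁.mono inter_subset_left).sub (hc₂.mono inter_subset_right)) ?_ hx hy
      intro z _
      rw [Complex.exp_sub, he₁, he₂, div_self (h0 z)]
    · exact ⟨0, fun x hx => (hne ⟨x, hx⟩).elim⟩
  have hexpk : Complex.exp k = 1 := by
    obtain ⟨y, hy⟩ : ({v}ᶜ ∩ {-v}ᶜ : Set S2).Nonempty := by
      refine ⟨⟨EuclideanSpace.single 1 1, by simp⟩, ?_, ?_⟩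
      · intro h
        have := congrArg (fun x : S2 => (x : E3) 0) h
        simp [v] at this
      · intro h
        have := congrArg (fun x : S2 => (x : E3) 0) h
        simp [v] at this
    rw [← hk y hy, Complex.exp_sub, he₁, he₂, div_self (h0 y)]
  refine ⟨fun x => if x = v then L₂ x + k else L₁ x, ?_, ?_⟩
  · rw [continuous_iff_continuousAt]
    intro x
    by_cases hx : x = v
    · have h1 : ContinuousAt (fun x => L₂ x + k) x := by
        refine (hc₂.continuousAt ?_).add_const k
        exact isOpen_compl_singleton.mem_nhds (by rw [hx]; exact hvne)
      refine h1.congr ?_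
      have : ∀ᶠ y in 𝓝 x, y ∈ ({-v}ᶜ : Set S2) :=
        isOpen_compl_singleton.mem_nhds (by rw [hx]; exact hvne)
      filter_upwards [this] with y hy
      by_cases hyv : y = v
      · simp [hyv]
      · simp only [hyv, if_false]; rw [← hk y ⟨hyv, hy⟩]; ring
    · refine (hc₁.continuousAt (isOpen_compl_singleton.mem_nhds hx)).congr ?_
      filter_upwards [isOpen_compl_singleton.mem_nhds hx] with y hy
      exact (if_neg hy).symm
  · intro x
    by_cases hx : x = v
    · simp only [hx, if_true]; rw [Complex.exp_add, he₂, hexpk, mul_one]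
    · simp only [hx, if_false]; exact he₁ x

/-- Gluing logarithms on the sphere (the vanishing of `H¹(S²; ℤ)`, in Mayer–Vietoris form). If two
nowhere vanishing functions on open sets covering the sphere differ on the overlap by the
exponential of `ℓ`, then both have logarithms, and these can be chosen to differ by `ℓ`. -/
theorem exists_log_of_cover {U V : Set S2} (hU : IsOpen U) (hV : IsOpen V) (hUV : U ∪ V = univ)
    {G Q ℓ : S2 → ℂ} (hG : ContinuousOn G U) (hG0 : ∀ x ∈ U, G x ≠ 0) (hQ : ContinuousOn Q V)
    (hQ0 : ∀ x ∈ V, Q x ≠ 0) (hℓ : ContinuousOn ℓ (U ∩ V))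
    (hGQ : ∀ x ∈ U ∩ V, G x = Q x * Complex.exp (ℓ x)) :
    ∃ g q : S2 → ℂ, ContinuousOn g U ∧ ContinuousOn q V ∧ (∀ x ∈ U, Complex.exp (g x) = G x) ∧
      (∀ x ∈ V, Complex.exp (q x) = Q x) ∧ ∀ x ∈ U ∩ V, g x - q x = ℓ x := by
  classical
  have hdisj : Disjoint Vᶜ Uᶜ := by
    rw [disjoint_left]
    intro x hx hx'
    have : x ∈ U ∪ V := hUV ▸ mem_univ x
    exact this.elim hx' hx
  obtain ⟨ρ₀, hρ0, hρ1, -⟩ := exists_continuous_zero_one_of_isClosed hV.isClosed_compl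
    hU.isClosed_compl hdisj
  -- a cutoff that vanishes near the complement of `V` and equals one near the complement of `U`
  let ρ : S2 → ℝ := fun x => max 0 (min 1 (3 * ρ₀ x - 1))
  have hρc : Continuous ρ := by fun_prop
  have hρV : ∀ x ∉ V, ∀ᶠ y in 𝓝 x, ρ y = 0 := by
    intro x hx
    have h1 : ρ₀ x < 1 / 3 := by rw [hρ0 hx]; norm_num
    filter_upwards [ρ₀.continuous.continuousAt.eventually_lt continuousAt_const h1] with y hy
    have : 3 * ρ₀ y - 1 ≤ 0 := by linarith
    simp [ρ, this]
  have hρU : ∀ x ∉ U, ∀ᶠ y in 𝓝 x, ρ y = 1 := by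
    intro x hx
    have h1 : 2 / 3 < ρ₀ x := by rw [hρ1 hx]; norm_num
    filter_upwards [continuousAt_const.eventually_lt ρ₀.continuous.continuousAt h1] with y hy
    have : 1 ≤ 3 * ρ₀ y - 1 := by linarith
    simp [ρ, this]
  -- `ℓ = a - b`, where `a` is continuous on `U` and `b` on `V`; so `G e⁻ᵃ` and `Q e⁻ᵇ` fit together
  let a : S2 → ℂ := fun x => ρ x * ℓ x
  let b : S2 → ℂ := fun x => (ρ x - 1) * ℓ x
  have hρc' : Continuous fun x => (ρ x : ℂ) := Complex.continuous_ofReal.comp hρc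
  have ha : ContinuousOn a U := by
    intro x hx
    by_cases hxV : x ∈ V
    · refine ContinuousAt.continuousWithinAt ?_
      exact hρc'.continuousAt.mul (hℓ.continuousAt ((hU.inter hV).mem_nhds ⟨hx, hxV⟩))
    · refine ContinuousAt.continuousWithinAt ?_
      refine (continuousAt_const (y := (0 : ℂ))).congr ?_
      filter_upwards [hρV x hxV] with y hy
      simp [a, hy]
  have hb : ContinuousOn b V := by
    intro x hx
    by_cases hxU : x ∈ U
    · refine ContinuousAt.continuousWithinAt ?_
      exact (hρc'.sub continuous_const).continuousAt.mul
        (hℓ.continuousAt ((hU.inter hV).mem_nhds ⟨hxU, hx⟩))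
    · refine ContinuousAt.continuousWithinAt ?_
      refine (continuousAt_const (y := (0 : ℂ))).congr ?_
      filter_upwards [hρU x hxU] with y hy
      simp [b, hy]
  have hab : ∀ x, a x - b x = ℓ x := fun x => by simp only [a, b]; ring
  let E : S2 → ℂ := fun x => if x ∈ U then G x * Complex.exp (-a x) else Q x * Complex.exp (-b x)
  have hEU : ∀ x ∈ U, E x = G x * Complex.exp (-a x) := fun x hx => if_pos hx
  have hEV : ∀ x ∈ V, E x = Q x * Complex.exp (-b x) := by
    intro x hx
    by_cases hxU : x ∈ U
    · rw [hEU x hxU, hGQ x ⟨hxU, hx⟩, mul_assoc, ← Complex.exp_add, ← hab x]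
      congr 2; ring
    · exact if_neg hxU
  have hEc : Continuous E := by
    rw [continuous_iff_continuousAt]
    intro x
    rcases (hUV ▸ mem_univ x : x ∈ U ∪ V) with hx | hx
    · have h1 : ContinuousOn E U :=
        (hG.mul (Complex.continuous_exp.comp_continuousOn ha.neg)).congr hEU
      exact h1.continuousAt (hU.mem_nhds hx)
    · have h1 : ContinuousOn E V :=
        (hQ.mul (Complex.continuous_exp.comp_continuousOn hb.neg)).congr hEV
      exact h1.continuousAt (hV.mem_nhds hx)
  have hE0 : ∀ x, E x ≠ 0 := by
    intro x
    rcases (hUV ▸ mem_univ x : x ∈ U ∪ V) with hx | hx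
    · rw [hEU x hx]; exact mul_ne_zero (hG0 x hx) (Complex.exp_ne_zero _)
    · rw [hEV x hx]; exact mul_ne_zero (hQ0 x hx) (Complex.exp_ne_zero _)
  obtain ⟨L, hLc, hL⟩ := exists_log_sphere hEc hE0
  refine ⟨fun x => L x + a x, fun x => L x + b x, hLc.continuousOn.add ha, hLc.continuousOn.add hb,
    ?_, ?_, ?_⟩
  · intro x hx
    rw [Complex.exp_add, hL, hEU x hx, mul_assoc, ← Complex.exp_add]; simp
  · intro x hx
    rw [Complex.exp_add, hL, hEV x hx, mul_assoc, ← Complex.exp_add]; simp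
  · intro x _
    rw [← hab x]; ring

/-! ### Calculus on the sphere by radial extension -/

instance fact_finrank_E3 : Fact (Module.finrank ℝ E3 = 2 + 1) := ⟨by simp⟩

/-- The radial projection `x ↦ x / ‖x‖` to the sphere (with an arbitrary value at `0`). -/
def radialProj (x : E3) : S2 :=
  if h : x = 0 then ⟨vert, by simp [vert]⟩
  else ⟨‖x‖⁻¹ • x, by simp [norm_smul, inv_mul_cancel₀ (norm_ne_zero_iff.2 h)]⟩

theorem coe_radialProj {x : E3} (h : x ≠ 0) : (radialProj x : E3) = ‖x‖⁻¹ • x := by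
  simp [radialProj, h]

theorem norm_coe_S2 (p : S2) : ‖(p : E3)‖ = 1 := by simp

theorem coe_S2_ne_zero (p : S2) : (p : E3) ≠ 0 := by
  intro h; have := norm_coe_S2 p; rw [h] at this; simp at this

theorem radialProj_smul (p : S2) {r : ℝ} (hr : 0 < r) : radialProj (r • (p : E3)) = p := by
  apply Subtype.ext
  rw [coe_radialProj (smul_ne_zero hr.ne' (coe_S2_ne_zero p)), norm_smul, norm_coe_S2, smul_smul,
    Real.norm_of_nonneg hr.le, mul_one, inv_mul_cancel₀ hr.ne', one_smul]

theorem radialProj_coe (p : S2) : radialProj (p : E3) = p := by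
  simpa using radialProj_smul p one_pos

/-- The extension of a function on the sphere to a function which is constant on rays. -/
def radialExt {F : Type*} (g : S2 → F) (x : E3) : F := g (radialProj x)

theorem radialExt_coe {F : Type*} (g : S2 → F) (p : S2) : radialExt g p = g p := by
  rw [radialExt, radialProj_coe]

variable {F : Type*} [NormedAddCommGroup F] [NormedSpace ℝ F]

theorem exists_contMDiff_eventuallyEq_radialProj {x : E3} (hx : x ≠ 0) :
    ∃ h : E3 → S2, ContMDiff 𝓘(ℝ, E3) (𝓡 2) ∞ h ∧ radialProj =ᶠ[𝓝 x] h := by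
  have hpos : 0 < ‖x‖ := norm_pos_iff.2 hx
  let b : ContDiffBump x := ⟨‖x‖ / 4, ‖x‖ / 2, by positivity, by linarith⟩
  -- a smooth map to the punctured space which is the identity near `x`
  let y : E3 → E3 := fun z => x + b z • (z - x)
  have hy : ContDiff ℝ ∞ y := contDiff_const.add (b.contDiff.smul (contDiff_id.sub contDiff_const))
  have hy0 : ∀ z, y z ≠ 0 := by
    intro z hz
    by_cases hzb : z ∈ ball x (‖x‖ / 2)
    · have h1 : ‖x‖ = ‖b z • (z - x)‖ := by
        rw [← norm_neg (b z • (z - x)), ← eq_neg_of_add_eq_zero_left hz]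
      rw [norm_smul, Real.norm_of_nonneg b.nonneg] at h1
      have h2 : ‖z - x‖ < ‖x‖ / 2 := mem_ball_iff_norm.1 hzb
      nlinarith [b.le_one (x := z), b.nonneg (x := z), norm_nonneg (z - x)]
    · have : b z = 0 := b.zero_of_le_dist (not_lt.1 hzb)
      simp only [y, this, zero_smul, add_zero] at hz
      exact hx hz
  have hn : ContDiff ℝ ∞ fun z => ‖y z‖⁻¹ • y z :=
    ((hy.norm ℝ hy0).inv fun z => norm_ne_zero_iff.2 (hy0 z)).smul hy
  have hmem : ∀ z, ‖y z‖⁻¹ • y z ∈ sphere (0 : E3) 1 := by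
    intro z
    simp [norm_smul, inv_mul_cancel₀ (norm_ne_zero_iff.2 (hy0 z))]
  refine ⟨_, ContMDiff.codRestrict_sphere (n := 2) hn.contMDiff hmem, ?_⟩
  filter_upwards [b.eventuallyEq_one, isOpen_ne.mem_nhds hx] with z hz hz0
  apply Subtype.ext
  have : y z = z := by simp [y, hz]
  rw [coe_radialProj hz0]
  simp [Set.codRestrict, this]

theorem contDiffAt_radialExt {g : S2 → F} (hg : ContMDiff (𝓡 2) 𝓘(ℝ, F) ∞ g) {x : E3}
    (hx : x ≠ 0) : ContDiffAt ℝ ∞ (radialExt g) x := by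
  obtain ⟨h, hh, heq⟩ := exists_contMDiff_eventuallyEq_radialProj hx
  have h1 : ContDiff ℝ ∞ (g ∘ h) := (hg.comp hh).contDiff
  refine h1.contDiffAt.congr_of_eventuallyEq ?_
  filter_upwards [heq] with z hz
  simp [radialExt, hz]

/-- The differential of a function on the sphere at `p`, as a linear map on the ambient space: the
derivative of the radial extension. It vanishes on `p` and agrees with the manifold derivative on
tangent vectors. -/
def sphereDeriv (g : S2 → F) (p : S2) : E3 →L[ℝ] F := fderiv ℝ (radialExt g) p

theorem hasFDerivAt_radialExt {g : S2 → F} (hg : ContMDiff (𝓡 2) 𝓘(ℝ, F) ∞ g) (p : S2) :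
    HasFDerivAt (radialExt g) (sphereDeriv g p) (p : E3) :=
  ((contDiffAt_radialExt hg (coe_S2_ne_zero p)).differentiableAt (by simp)).hasFDerivAt

theorem sphereDeriv_self {g : S2 → F} (hg : ContMDiff (𝓡 2) 𝓘(ℝ, F) ∞ g) (p : S2) :
    sphereDeriv g p p = 0 := by
  have h1 : HasDerivAt (fun t : ℝ => (1 + t) • (p : E3)) (p : E3) 0 := by
    simpa using ((hasDerivAt_id (0 : ℝ)).const_add 1).smul_const (p : E3)
  have h2 : HasDerivAt (fun t : ℝ => radialExt g ((1 + t) • (p : E3))) (sphereDeriv g p p) 0 := by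
    have h0 : HasFDerivAt (radialExt g) (sphereDeriv g p)
        ((fun t : ℝ => (1 + t) • (p : E3)) 0) := by
      simpa using hasFDerivAt_radialExt hg p
    exact h0.comp_hasDerivAt (0 : ℝ) h1
  have h3 : HasDerivAt (fun t : ℝ => radialExt g ((1 + t) • (p : E3))) 0 0 := by
    refine (hasDerivAt_const (0 : ℝ) (g p)).congr_of_eventuallyEq ?_
    filter_upwards [lt_mem_nhds (show (-1 : ℝ) < 0 by norm_num)] with t ht
    rw [radialExt, radialProj_smul p (by linarith)]
  exact h2.unique h3

theorem continuous_sphereDeriv {g : S2 → F} (hg : ContMDiff (𝓡 2) 𝓘(ℝ, F) ∞ g) :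
    Continuous (sphereDeriv g) := by
  rw [continuous_iff_continuousAt]
  intro p
  have h1 : ContDiffAt ℝ 0 (fderiv ℝ (radialExt g)) (p : E3) :=
    (contDiffAt_radialExt hg (coe_S2_ne_zero p)).fderiv_right (by simp)
  exact h1.continuousAt.comp continuous_subtype_val.continuousAt

theorem sphereDeriv_comp_clm {G : Type*} [NormedAddCommGroup G] [NormedSpace ℝ G] (L : F →L[ℝ] G)
    {g : S2 → F} (hg : ContMDiff (𝓡 2) 𝓘(ℝ, F) ∞ g) (p : S2) :
    sphereDeriv (fun q => L (g q)) p = L.comp (sphereDeriv g p) :=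
  (L.hasFDerivAt.comp (p : E3) (hasFDerivAt_radialExt hg p)).fderiv

/-- The chain rule along a curve in the sphere. -/
theorem hasDerivAt_comp_curve {g : S2 → F} (hg : ContMDiff (𝓡 2) 𝓘(ℝ, F) ∞ g) {c : ℝ → S2} {t : ℝ}
    {v : E3} (hc : HasDerivAt (fun s => (c s : E3)) v t) :
    HasDerivAt (fun s => g (c s)) (sphereDeriv g (c t) v) t := by
  have := (hasFDerivAt_radialExt hg (c t)).comp_hasDerivAt t hc
  simpa [Function.comp_def, radialExt_coe] using this

theorem inner_velocity {c : ℝ → S2} {t : ℝ} {v : E3} (hc : HasDerivAt (fun s => (c s : E3)) v t) :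
    inner ℝ (c t : E3) v = 0 := by
  have h1 := hc.norm_sq
  have h2 : HasDerivAt (fun s => ‖(c s : E3)‖ ^ 2) 0 t := by
    simpa using hasDerivAt_const t (1 : ℝ)
  have := h1.unique h2
  linarith

/-- The inclusion of a tangent space of the sphere into the ambient space. -/
def tangentIncl (p : S2) : TangentSpace (𝓡 2) p →L[ℝ] E3 :=
  mfderiv (𝓡 2) 𝓘(ℝ, E3) ((↑) : S2 → E3) p

theorem mfderiv_eq_sphereDeriv {g : S2 → F} (hg : ContMDiff (𝓡 2) 𝓘(ℝ, F) ∞ g) (p : S2)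
    (v : TangentSpace (𝓡 2) p) :
    mfderiv (𝓡 2) 𝓘(ℝ, F) g p v = sphereDeriv g p (tangentIncl p v) := by
  have h1 : g = radialExt g ∘ ((↑) : S2 → E3) := by
    funext q; simp [radialExt_coe]
  have hd : MDifferentiableAt 𝓘(ℝ, E3) 𝓘(ℝ, F) (radialExt g) (p : E3) :=
    (hasFDerivAt_radialExt hg p).differentiableAt.mdifferentiableAt
  have h2 : mfderiv (𝓡 2) 𝓘(ℝ, F) (radialExt g ∘ ((↑) : S2 → E3)) p =
      (mfderiv 𝓘(ℝ, E3) 𝓘(ℝ, F) (radialExt g) (p : E3)).comp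
        (mfderiv (𝓡 2) 𝓘(ℝ, E3) ((↑) : S2 → E3) p) :=
    mfderiv_comp p hd ((contMDiff_coe_sphere (n := 2) (m := ∞) p).mdifferentiableAt (by simp))
  rw [mfderiv_eq_fderiv] at h2
  rw [← h1] at h2
  rw [h2]
  rfl

theorem exists_tangentIncl_eq {p : S2} {v : E3} (hv : inner ℝ (p : E3) v = 0) :
    ∃ w, tangentIncl p w = v := by
  have h1 := range_mvfderiv_subtypeVal (n := 2) (E := E3) p
  have h2 : v ∈ (ℝ ∙ (p : E3))ᗮ := Submodule.mem_orthogonal_singleton_iff_inner_right.2 hv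
  rw [← h1] at h2
  obtain ⟨w, hw⟩ := h2
  exact ⟨w, hw⟩

theorem inner_tangentIncl (p : S2) (w : TangentSpace (𝓡 2) p) :
    inner ℝ (p : E3) (tangentIncl p w) = 0 := by
  have h1 := range_mvfderiv_subtypeVal (n := 2) (E := E3) p
  refine Submodule.mem_orthogonal_singleton_iff_inner_right.1 ?_
  rw [← h1]
  exact ⟨w, rfl⟩

/-! ### Vector algebra in space -/

/-- The cross product of two vectors of `ℝ³`. -/
def cross (a b : E3) : E3 :=
  !₂[a 1 * b 2 - a 2 * b 1, a 2 * b 0 - a 0 * b 2, a 0 * b 1 - a 1 * b 0]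

theorem cross_zero (a b : E3) : cross a b 0 = a 1 * b 2 - a 2 * b 1 := rfl
theorem cross_one (a b : E3) : cross a b 1 = a 2 * b 0 - a 0 * b 2 := rfl
theorem cross_two (a b : E3) : cross a b 2 = a 0 * b 1 - a 1 * b 0 := rfl

theorem inner_eq_sum (a b : E3) : inner ℝ a b = a 0 * b 0 + a 1 * b 1 + a 2 * b 2 := by
  simp [PiLp.inner_apply, Fin.sum_univ_three, mul_comm]

/-- The determinant of three vectors of `ℝ³`. -/
def det3 (a b c : E3) : ℝ :=
  a 0 * (b 1 * c 2 - b 2 * c 1) + a 1 * (b 2 * c 0 - b 0 * c 2) + a 2 * (b 0 * c 1 - b 1 * c 0)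

theorem ext_E3 {a b : E3} (h0 : a 0 = b 0) (h1 : a 1 = b 1) (h2 : a 2 = b 2) : a = b := by
  ext i; fin_cases i <;> assumption

/-- Cramer's rule. -/
theorem det3_smul_eq (a b c v : E3) :
    det3 a b c • v = det3 v b c • a + det3 a v c • b + det3 a b v • c := by
  apply ext_E3 <;> simp [det3] <;> ring

theorem det3_pos_cross {a b : E3} (h : inner ℝ a b = 0) (ha : a ≠ 0) (hb : b ≠ 0) :
    0 < det3 a b (cross a b) := by
  have h1 : det3 a b (cross a b) = inner ℝ a a * inner ℝ b b - (inner ℝ a b) ^ 2 := by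
    simp only [det3, cross_zero, cross_one, cross_two, inner_eq_sum]; ring
  rw [h1, h]
  have := real_inner_self_pos.2 ha
  have := real_inner_self_pos.2 hb
  nlinarith

theorem contDiff_coord (i : Fin 3) {n : ℕ∞ω} : ContDiff ℝ n fun x : E3 => x i :=
  contDiff_euclidean.1 contDiff_id i

theorem contDiff_cross {X : Type*} [NormedAddCommGroup X] [NormedSpace ℝ X] {n : ℕ∞ω}
    {f g : X → E3} (hf : ContDiff ℝ n f) (hg : ContDiff ℝ n g) :
    ContDiff ℝ n fun x => cross (f x) (g x) := by
  have hf' := contDiff_euclidean.1 hf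
  have hg' := contDiff_euclidean.1 hg
  rw [contDiff_euclidean]
  intro i
  fin_cases i
  · exact ((hf' 1).mul (hg' 2)).sub ((hf' 2).mul (hg' 1))
  · exact ((hf' 2).mul (hg' 0)).sub ((hf' 0).mul (hg' 2))
  · exact ((hf' 0).mul (hg' 1)).sub ((hf' 1).mul (hg' 0))

theorem continuous_coord (i : Fin 3) : Continuous fun x : E3 => x i :=
  (contDiff_coord i (n := 0)).continuous

theorem continuous_det3 {X : Type*} [TopologicalSpace X] {f g h : X → E3} (hf : Continuous f)
    (hg : Continuous g) (hh : Continuous h) : Continuous fun x => det3 (f x) (g x) (h x) := by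
  have h1 := fun i => (continuous_coord i).comp hf
  have h2 := fun i => (continuous_coord i).comp hg
  have h3 := fun i => (continuous_coord i).comp hh
  simp only [Function.comp_def] at h1 h2 h3
  unfold det3
  fun_prop

/-! ### Strips in the sphere -/

/-- A smooth two-parameter family of points of the sphere. -/
def IsSmoothStrip (Φ : ℝ → ℝ → S2) : Prop := ContDiff ℝ ∞ fun z : ℝ × ℝ => (Φ z.1 z.2 : E3)

/-- The partial derivative of a strip in the first variable. -/
def dFst (Φ : ℝ → ℝ → S2) (s t : ℝ) : E3 := velocity (fun s' => Φ s' t) s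

/-- The partial derivative of a strip in the second variable. -/
def dSnd (Φ : ℝ → ℝ → S2) (s t : ℝ) : E3 := velocity (fun t' => Φ s t') t

/-- The area density of a strip; positive where `(∂₁Φ, ∂₂Φ)` is an oriented basis for the
orientation of the sphere by the outward normal. -/
def stripDet (Φ : ℝ → ℝ → S2) (s t : ℝ) : ℝ := det3 (Φ s t) (dFst Φ s t) (dSnd Φ s t)

namespace IsSmoothStrip

variable {Φ : ℝ → ℝ → S2} (h : IsSmoothStrip Φ)
include h

theorem hasFDerivAt (z : ℝ × ℝ) : HasFDerivAt (fun z : ℝ × ℝ => (Φ z.1 z.2 : E3))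
    (fderiv ℝ (fun z : ℝ × ℝ => (Φ z.1 z.2 : E3)) z) z :=
  (h.differentiable (by simp) z).hasFDerivAt

theorem hasDerivAt_fst' (s t : ℝ) : HasDerivAt (fun s' => (Φ s' t : E3))
    (fderiv ℝ (fun z : ℝ × ℝ => (Φ z.1 z.2 : E3)) (s, t) (1, 0)) s := by
  have h1 : HasDerivAt (fun s' : ℝ => (s', t)) ((1 : ℝ), (0 : ℝ)) s :=
    (hasDerivAt_id s).prodMk (hasDerivAt_const s t)
  exact (h.hasFDerivAt (s, t)).comp_hasDerivAt s h1

theorem hasDerivAt_snd' (s t : ℝ) : HasDerivAt (fun t' => (Φ s t' : E3))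
    (fderiv ℝ (fun z : ℝ × ℝ => (Φ z.1 z.2 : E3)) (s, t) (0, 1)) t := by
  have h1 : HasDerivAt (fun t' : ℝ => (s, t')) ((0 : ℝ), (1 : ℝ)) t :=
    (hasDerivAt_const t s).prodMk (hasDerivAt_id t)
  exact (h.hasFDerivAt (s, t)).comp_hasDerivAt t h1

theorem dFst_eq (s t : ℝ) :
    dFst Φ s t = fderiv ℝ (fun z : ℝ × ℝ => (Φ z.1 z.2 : E3)) (s, t) (1, 0) :=
  (h.hasDerivAt_fst' s t).deriv

theorem dSnd_eq (s t : ℝ) :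
    dSnd Φ s t = fderiv ℝ (fun z : ℝ × ℝ => (Φ z.1 z.2 : E3)) (s, t) (0, 1) :=
  (h.hasDerivAt_snd' s t).deriv

theorem hasDerivAt_fst (s t : ℝ) : HasDerivAt (fun s' => (Φ s' t : E3)) (dFst Φ s t) s := by
  rw [h.dFst_eq]; exact h.hasDerivAt_fst' s t

theorem hasDerivAt_snd (s t : ℝ) : HasDerivAt (fun t' => (Φ s t' : E3)) (dSnd Φ s t) t := by
  rw [h.dSnd_eq]; exact h.hasDerivAt_snd' s t

theorem fderiv_apply (s t : ℝ) (v : ℝ × ℝ) :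
    fderiv ℝ (fun z : ℝ × ℝ => (Φ z.1 z.2 : E3)) (s, t) v =
      v.1 • dFst Φ s t + v.2 • dSnd Φ s t := by
  rw [h.dFst_eq, h.dSnd_eq, ← map_smul, ← map_smul, ← map_add]
  congr 1
  ext <;> simp

theorem continuous : Continuous fun z : ℝ × ℝ => Φ z.1 z.2 :=
  continuous_induced_rng.2 (ContDiff.continuous h)

theorem continuous_fderiv : Continuous (fderiv ℝ fun z : ℝ × ℝ => (Φ z.1 z.2 : E3)) :=
  ContDiff.continuous_fderiv h (by simp)

theorem continuous_dFst : Continuous fun z : ℝ × ℝ => dFst Φ z.1 z.2 := by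
  simp only [h.dFst_eq]
  exact h.continuous_fderiv.clm_apply continuous_const

theorem continuous_dSnd : Continuous fun z : ℝ × ℝ => dSnd Φ z.1 z.2 := by
  simp only [h.dSnd_eq]
  exact h.continuous_fderiv.clm_apply continuous_const

theorem continuous_stripDet : Continuous fun z : ℝ × ℝ => stripDet Φ z.1 z.2 :=
  continuous_det3 (continuous_subtype_val.comp h.continuous) h.continuous_dFst h.continuous_dSnd

theorem inner_dFst (s t : ℝ) : inner ℝ (Φ s t : E3) (dFst Φ s t) = 0 :=
  inner_velocity (c := fun s' => Φ s' t) (h.hasDerivAt_fst s t)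

theorem inner_dSnd (s t : ℝ) : inner ℝ (Φ s t : E3) (dSnd Φ s t) = 0 :=
  inner_velocity (c := fun t' => Φ s t') (h.hasDerivAt_snd s t)

/-- The cone over an immersed strip is a local diffeomorphism of space. -/
theorem exists_cone_equiv {s t : ℝ} (hdet : stripDet Φ s t ≠ 0) :
    ∃ L : ((ℝ × ℝ) × ℝ) ≃L[ℝ] E3, HasStrictFDerivAt
      (fun w : (ℝ × ℝ) × ℝ => w.2 • (Φ w.1.1 w.1.2 : E3)) (L : ((ℝ × ℝ) × ℝ) →L[ℝ] E3)
      ((s, t), (1 : ℝ)) := by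
  have hM : ContDiff ℝ ∞ (fun w : (ℝ × ℝ) × ℝ => w.2 • (Φ w.1.1 w.1.2 : E3)) :=
    contDiff_snd.smul (ContDiff.comp (g := fun z : ℝ × ℝ => (Φ z.1 z.2 : E3)) h contDiff_fst)
  have h1 := hM.contDiffAt.hasStrictFDerivAt (x := ((s, t), (1 : ℝ))) (by simp)
  set D := fderiv ℝ (fun w : (ℝ × ℝ) × ℝ => w.2 • (Φ w.1.1 w.1.2 : E3)) ((s, t), (1 : ℝ)) with hD
  have hDv : ∀ x y r : ℝ, D ((x, y), r) = x • dFst Φ s t + y • dSnd Φ s t + r • (Φ s t : E3) := by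
    intro x y r
    have h2 : HasFDerivAt (fun w : (ℝ × ℝ) × ℝ => (Φ w.1.1 w.1.2 : E3))
        ((fderiv ℝ (fun z : ℝ × ℝ => (Φ z.1 z.2 : E3)) (s, t)).comp
          (ContinuousLinearMap.fst ℝ (ℝ × ℝ) ℝ)) ((s, t), (1 : ℝ)) :=
      HasFDerivAt.comp (g := fun z : ℝ × ℝ => (Φ z.1 z.2 : E3)) ((s, t), (1 : ℝ))
        (h.hasFDerivAt (s, t)) hasFDerivAt_fst
    have h3 := (hasFDerivAt_snd (𝕜 := ℝ) (p := (((s, t), (1 : ℝ)) : (ℝ × ℝ) × ℝ))).smul h2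
    have h4 := h3.unique h1.hasFDerivAt
    rw [← h4]
    simp [h.fderiv_apply]
  have hinj : Function.Injective D := by
    rw [injective_iff_map_eq_zero]
    rintro ⟨⟨x, y⟩, r⟩ hv
    rw [hDv] at hv
    have e : ∀ i : Fin 3, x * dFst Φ s t i + y * dSnd Φ s t i + r * (Φ s t : E3) i = 0 := by
      intro i
      have := congrArg (fun v : E3 => v i) hv
      simpa using this
    have e0 := e 0
    have e1 := e 1
    have e2 := e 2
    have hx : x * stripDet Φ s t = 0 := by
      simp only [stripDet, det3]
      set a := (Φ s t : E3)
      set b := dFst Φ s t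
      set c := dSnd Φ s t
      linear_combination (-(a 1 * c 2) + a 2 * c 1) * e0 + (-(a 2 * c 0) + a 0 * c 2) * e1 +
        (-(a 0 * c 1) + a 1 * c 0) * e2
    have hy : y * stripDet Φ s t = 0 := by
      simp only [stripDet, det3]
      set a := (Φ s t : E3)
      set b := dFst Φ s t
      set c := dSnd Φ s t
      linear_combination (a 1 * b 2 - a 2 * b 1) * e0 + (a 2 * b 0 - a 0 * b 2) * e1 +
        (a 0 * b 1 - a 1 * b 0) * e2
    have hr : r * stripDet Φ s t = 0 := by
      simp only [stripDet, det3]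
      set a := (Φ s t : E3)
      set b := dFst Φ s t
      set c := dSnd Φ s t
      linear_combination (b 1 * c 2 - b 2 * c 1) * e0 + (b 2 * c 0 - b 0 * c 2) * e1 +
        (b 0 * c 1 - b 1 * c 0) * e2
    have hx' := (mul_eq_zero.1 hx).resolve_right hdet
    have hy' := (mul_eq_zero.1 hy).resolve_right hdet
    have hr' := (mul_eq_zero.1 hr).resolve_right hdet
    rw [hx', hy', hr']; rfl
  have hfr : Module.finrank ℝ ((ℝ × ℝ) × ℝ) = Module.finrank ℝ E3 := by simp
  let L := (LinearEquiv.ofInjectiveOfFinrankEq (D : ((ℝ × ℝ) × ℝ) →ₗ[ℝ] E3) hinj hfr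
    ).toContinuousLinearEquiv
  refine ⟨L, ?_⟩
  have : (L : ((ℝ × ℝ) × ℝ) →L[ℝ] E3) = D := by ext <;> rfl
  rw [this]
  exact h1

/-- A strip is an open map near the points where it is immersed. -/
theorem map_nhds {s t : ℝ} (hdet : stripDet Φ s t ≠ 0) :
    Filter.map (fun z : ℝ × ℝ => Φ z.1 z.2) (𝓝 (s, t)) = 𝓝 (Φ s t) := by
  apply le_antisymm
  · exact h.continuous.continuousAt (x := (s, t))
  · intro W hW
    obtain ⟨L, hL⟩ := h.exists_cone_equiv hdet
    have h1 := hL.map_nhds_eq_of_equiv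
    simp only [one_smul] at h1
    have hW' : {w : (ℝ × ℝ) × ℝ | Φ w.1.1 w.1.2 ∈ W ∧ 0 < w.2} ∈ 𝓝 ((s, t), (1 : ℝ)) := by
      rw [nhds_prod_eq]
      exact Filter.prod_mem_prod (Filter.mem_map.1 hW) (lt_mem_nhds (one_pos : (0 : ℝ) < 1))
    have h2 := Filter.image_mem_map (m := fun w : (ℝ × ℝ) × ℝ => w.2 • (Φ w.1.1 w.1.2 : E3)) hW'
    rw [h1] at h2
    have h3 := continuous_subtype_val.continuousAt (x := Φ s t) h2
    refine Filter.mem_of_superset h3 ?_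
    rintro x ⟨w, ⟨hw, hw0⟩, hwx⟩
    have : radialProj (w.2 • (Φ w.1.1 w.1.2 : E3)) = radialProj (x : E3) := by
      rw [← hwx]
    rw [radialProj_smul _ hw0, radialProj_coe] at this
    rw [← this]; exact hw

theorem locally_injective {s t : ℝ} (hdet : stripDet Φ s t ≠ 0) :
    ∃ W ∈ 𝓝 (s, t), InjOn (fun z : ℝ × ℝ => Φ z.1 z.2) W := by
  obtain ⟨L, hL⟩ := h.exists_cone_equiv hdet
  let e := hL.toOpenPartialHomeomorph
  have h1 : e.source ∈ 𝓝 ((s, t), (1 : ℝ)) :=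
    e.open_source.mem_nhds hL.mem_toOpenPartialHomeomorph_source
  have h2 : ∀ᶠ z in 𝓝 (s, t), (z, (1 : ℝ)) ∈ e.source :=
    (Continuous.prodMk_left (1 : ℝ)).continuousAt (x := (s, t)) h1
  refine ⟨_, h2, ?_⟩
  intro z hz z' hz' hzz
  have : (z, (1 : ℝ)) = (z', (1 : ℝ)) := by
    apply e.injOn hz hz'
    show (1 : ℝ) • (Φ z.1 z.2 : E3) = (1 : ℝ) • (Φ z'.1 z'.2 : E3)
    simp only at hzz
    rw [hzz]
  exact congrArg Prod.fst this

end IsSmoothStrip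

/-- An open condition along the closed curve `t = 0` holds on a strip of uniform width. -/
theorem exists_strip_of_eventually {P : ℝ → ℝ → Prop} (hper : ∀ t s, P (s + 1) t ↔ P s t)
    (h : ∀ s, ∀ᶠ z : ℝ × ℝ in 𝓝 (s, 0), P z.1 z.2) :
    ∃ δ > 0, ∀ s t, |t| < δ → P s t := by
  have h1 : ∀ᶠ t in 𝓝 (0 : ℝ), ∀ s ∈ Icc (0 : ℝ) 1, P s t := by
    refine isCompact_Icc.eventually_forall_of_forall_eventually fun s _ => ?_
    exact (continuous_swap.tendsto ((0 : ℝ), s)).eventually (h s)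
  obtain ⟨δ, hδ, h2⟩ := Metric.eventually_nhds_iff.1 h1
  refine ⟨δ, hδ, fun s t ht => ?_⟩
  have h3 : Function.Periodic (fun s => P s t) 1 := fun s => propext (hper t s)
  have h4 : P (Int.fract s) t := h2 (by simpa using ht) _
    ⟨Int.fract_nonneg s, (Int.fract_lt_one s).le⟩
  have h5 := h3.int_mul ⌊s⌋ (Int.fract s)
  simp only [mul_one, Int.fract_add_floor] at h5
  rw [h5]; exact h4

/-! ### Collars of curves -/

theorem IsRegularCurve.contDiff {c : ℝ → S2} (hc : IsRegularCurve c) :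
    ContDiff ℝ ∞ fun t => (c t : E3) :=
  ((contMDiff_coe_sphere (n := 2) (E := E3)).comp hc.1).contDiff

theorem IsRegularCurve.continuous {c : ℝ → S2} (hc : IsRegularCurve c) : Continuous c :=
  hc.1.continuous

theorem IsRegularCurve.hasDerivAt {c : ℝ → S2} (hc : IsRegularCurve c) (t : ℝ) :
    HasDerivAt (fun t => (c t : E3)) (velocity c t) t :=
  (hc.contDiff.differentiable (by simp) t).hasDerivAt

theorem IsRegularCurve.contDiff_velocity {c : ℝ → S2} (hc : IsRegularCurve c) :
    ContDiff ℝ ∞ (velocity c) :=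
  (contDiff_infty_iff_deriv.1 hc.contDiff).2

theorem inner_cross_left (a b : E3) : inner ℝ a (cross a b) = 0 := by
  rw [inner_eq_sum, cross_zero, cross_one, cross_two]; ring

/-- A two-sided collar of a closed curve `γ`, avoiding the set `F`: an immersed annulus
`(s, t) ↦ Φ s t`, `1`-periodic in `s`, which is embedded for `|t| < δ` and has the core curve `γ`.
The basis `(∂₁Φ, ∂₂Φ)` is oriented. -/
structure Collar (γ F : Set S2) where
  Φ : ℝ → ℝ → S2
  δ : ℝ
  δ_pos : 0 < δ
  smooth : IsSmoothStrip Φ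
  periodic : ∀ s t, Φ (s + 1) t = Φ s t
  inj : ∀ s s' t t', |t| < δ → |t'| < δ → Φ s t = Φ s' t' → t = t' ∧ ∃ k : ℤ, s' = s + k
  det_pos : ∀ s t, |t| < δ → 0 < stripDet Φ s t
  core : range (fun s => Φ s 0) = γ
  regular : IsRegularCurve fun s => Φ s 0
  avoid : ∀ s t, |t| < δ → Φ s t ∉ F

/-- A strip which is immersed along an embedded closed curve is embedded near the curve. -/
theorem exists_inj_strip {Φ : ℝ → ℝ → S2} (h : IsSmoothStrip Φ)
    (hper : ∀ s t, Φ (s + 1) t = Φ s t) (hdet : ∀ s, stripDet Φ s 0 ≠ 0)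
    (hinj : ∀ s s', Φ s 0 = Φ s' 0 → ∃ k : ℤ, s' = s + k) :
    ∃ δ > 0, ∀ s s' t t', |t| < δ → |t'| < δ → Φ s t = Φ s' t' → t = t' ∧ ∃ k : ℤ, s' = s + k := by
  have hperk : ∀ (k : ℤ) s t, Φ (s + k) t = Φ s t := by
    intro k s t
    have h3 : Function.Periodic (fun s => Φ s t) 1 := fun s => hper s t
    simpa using h3.int_mul k s
  have h1 : ∀ᶠ t in 𝓝 ((0 : ℝ), (0 : ℝ)), ∀ s ∈ Icc (0 : ℝ) 1 ×ˢ Icc (0 : ℝ) 1,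
      Φ s.1 t.1 = Φ s.2 t.2 → t.1 = t.2 ∧ ∃ k : ℤ, s.2 = s.1 + k := by
    refine (isCompact_Icc.prod isCompact_Icc).eventually_forall_of_forall_eventually ?_
    rintro ⟨s, s'⟩ -
    have hc1 : Continuous fun z : (ℝ × ℝ) × (ℝ × ℝ) => Φ z.2.1 z.1.1 :=
      h.continuous.comp (f := fun z : (ℝ × ℝ) × (ℝ × ℝ) => (z.2.1, z.1.1)) (by fun_prop)
    have hc2 : Continuous fun z : (ℝ × ℝ) × (ℝ × ℝ) => Φ z.2.2 z.1.2 :=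
      h.continuous.comp (f := fun z : (ℝ × ℝ) × (ℝ × ℝ) => (z.2.2, z.1.2)) (by fun_prop)
    by_cases hss : Φ s 0 = Φ s' 0
    · obtain ⟨k, rfl⟩ := hinj s s' hss
      obtain ⟨W, hW, hWi⟩ := h.locally_injective (hdet s)
      have e1 : ∀ᶠ z : (ℝ × ℝ) × (ℝ × ℝ) in 𝓝 (((0 : ℝ), (0 : ℝ)), (s, s + (k : ℝ))),
          (z.2.1, z.1.1) ∈ W := by
        refine ContinuousAt.preimage_mem_nhds (f := fun z : (ℝ × ℝ) × (ℝ × ℝ) => (z.2.1, z.1.1))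
          (by fun_prop) hW
      have e2 : ∀ᶠ z : (ℝ × ℝ) × (ℝ × ℝ) in 𝓝 (((0 : ℝ), (0 : ℝ)), (s, s + (k : ℝ))),
          (z.2.2 - k, z.1.2) ∈ W := by
        refine ContinuousAt.preimage_mem_nhds
          (f := fun z : (ℝ × ℝ) × (ℝ × ℝ) => (z.2.2 - (k : ℝ), z.1.2)) (by fun_prop) ?_
        simpa using hW
      filter_upwards [e1, e2] with z hz1 hz2 hz
      have h3 : Φ (z.2.2 - k) z.1.2 = Φ z.2.2 z.1.2 := by
        have := hperk k (z.2.2 - k) z.1.2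
        rw [sub_add_cancel] at this
        exact this.symm
      have := hWi hz1 hz2 (by simp only [h3, hz])
      rw [Prod.mk.injEq] at this
      exact ⟨this.2, k, by rw [this.1]; ring⟩
    · have := (isOpen_ne_fun hc1 hc2).mem_nhds
        (show (((0 : ℝ), (0 : ℝ)), (s, s')) ∈
          {z : (ℝ × ℝ) × (ℝ × ℝ) | Φ z.2.1 z.1.1 ≠ Φ z.2.2 z.1.2}
          from hss)
      filter_upwards [this] with z hz hz'
      exact absurd hz' hz
  obtain ⟨δ, hδ, h2⟩ := Metric.eventually_nhds_iff.1 h1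
  refine ⟨δ, hδ, fun s s' t t' ht ht' hΦ => ?_⟩
  have hd : dist ((t, t') : ℝ × ℝ) ((0 : ℝ), (0 : ℝ)) < δ := by
    rw [Prod.dist_eq]; simp [ht, ht']
  have hf : ∀ s t, Φ (Int.fract s) t = Φ s t := fun s t => by
    conv_rhs => rw [← Int.fract_add_floor s, hperk]
  obtain ⟨h3, k, hk⟩ := h2 hd (Int.fract s, Int.fract s')
    ⟨⟨Int.fract_nonneg _, (Int.fract_lt_one _).le⟩, ⟨Int.fract_nonneg _, (Int.fract_lt_one _).le⟩⟩
    (by simp only [hf, hΦ])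
  refine ⟨h3, k + ⌊s'⌋ - ⌊s⌋, ?_⟩
  have e1 := Int.fract_add_floor s
  have e2 := Int.fract_add_floor s'
  simp only at hk
  push_cast
  linarith

/-- The strip along a curve `c` obtained by moving in the normal direction `c × c'` and projecting
back to the sphere. -/
def normalStrip (c : ℝ → S2) (s t : ℝ) : S2 :=
  radialProj (c s + t • cross (c s) (velocity c s))

theorem normalStrip_zero (c : ℝ → S2) (s : ℝ) : normalStrip c s 0 = c s := by
  simp [normalStrip, radialProj_coe]

theorem dFst_normalStrip (c : ℝ → S2) (s : ℝ) : dFst (normalStrip c) s 0 = velocity c s := by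
  rw [dFst]
  congr 1
  funext s
  exact normalStrip_zero c s

namespace IsRegularCurve

variable {c : ℝ → S2} (hreg : IsRegularCurve c)
include hreg

theorem contDiff_normal : ContDiff ℝ ∞
    fun z : ℝ × ℝ => (c z.1 : E3) + z.2 • cross (c z.1) (velocity c z.1) :=
  (hreg.contDiff.comp contDiff_fst).add (contDiff_snd.smul
    ((contDiff_cross hreg.contDiff hreg.contDiff_velocity).comp contDiff_fst))

omit hreg in
theorem normal_ne_zero (c : ℝ → S2) (z : ℝ × ℝ) :
    (c z.1 : E3) + z.2 • cross (c z.1) (velocity c z.1) ≠ 0 := by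
  intro hz
  have h1 : inner ℝ (c z.1 : E3) ((c z.1 : E3) + z.2 • cross (c z.1) (velocity c z.1)) = 1 := by
    simp only [inner_add_right, inner_smul_right, inner_cross_left]
    rw [real_inner_self_eq_norm_sq, norm_coe_S2]; norm_num
  rw [hz, inner_zero_right] at h1
  exact zero_ne_one h1

theorem contDiff_inv_norm_normal : ContDiff ℝ ∞
    fun z : ℝ × ℝ => ‖(c z.1 : E3) + z.2 • cross (c z.1) (velocity c z.1)‖⁻¹ :=
  (hreg.contDiff_normal.norm ℝ (normal_ne_zero c)).inv
    fun z => norm_ne_zero_iff.2 (normal_ne_zero c z)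

omit hreg in
theorem coe_normalStrip (c : ℝ → S2) (s t : ℝ) : (normalStrip c s t : E3) =
    ‖(c s : E3) + t • cross (c s) (velocity c s)‖⁻¹ •
      ((c s : E3) + t • cross (c s) (velocity c s)) :=
  coe_radialProj (normal_ne_zero c (s, t))

theorem isSmoothStrip_normalStrip : IsSmoothStrip (normalStrip c) := by
  unfold IsSmoothStrip
  simp only [coe_normalStrip]
  exact hreg.contDiff_inv_norm_normal.smul hreg.contDiff_normal

theorem stripDet_normalStrip_pos (s : ℝ) : 0 < stripDet (normalStrip c) s 0 := by
  have h1 : ContDiff ℝ ∞ fun t => ‖(c s : E3) + t • cross (c s) (velocity c s)‖⁻¹ :=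
    hreg.contDiff_inv_norm_normal.comp (f := fun t : ℝ => (s, t))
      (contDiff_const.prodMk contDiff_id)
  have h2 := (h1.differentiable (by simp) 0).hasDerivAt
  have h3 : HasDerivAt (fun t : ℝ => (c s : E3) + t • cross (c s) (velocity c s))
      (cross (c s) (velocity c s)) 0 := by
    have := ((hasDerivAt_id (0 : ℝ)).smul_const (cross (c s) (velocity c s))).const_add (c s : E3)
    rw [one_smul] at this
    exact this
  have h4 := h2.smul h3
  have h4' : HasDerivAt (fun t => (normalStrip c s t : E3)) _ 0 :=
    h4.congr_of_eventuallyEq (Filter.Eventually.of_forall fun t => coe_normalStrip c s t)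
  have h5 := (hreg.isSmoothStrip_normalStrip.hasDerivAt_snd s 0).unique h4'
  simp only [zero_smul, add_zero, norm_coe_S2, inv_one, one_smul] at h5
  have h7 : stripDet (normalStrip c) s 0 =
      det3 (c s) (velocity c s) (cross (c s) (velocity c s)) := by
    rw [stripDet, normalStrip_zero, dFst_normalStrip, h5]
    simp only [det3, PiLp.add_apply, PiLp.smul_apply, smul_eq_mul]
    ring
  rw [h7]
  exact det3_pos_cross (inner_velocity (hreg.hasDerivAt s)) (coe_S2_ne_zero _) (hreg.2 s)

end IsRegularCurve

/-- Tubular neighbourhoods of smooth simple closed curves in the sphere. -/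
theorem exists_collar {γ F : Set S2} (hγ : IsSmoothSimpleClosedCurve γ) (hF : IsClosed F)
    (hd : Disjoint γ F) : Nonempty (Collar γ F) := by
  obtain ⟨c, hreg, hper, hinj, hran⟩ := hγ
  let Φ : ℝ → ℝ → S2 := normalStrip c
  have hsm : IsSmoothStrip Φ := hreg.isSmoothStrip_normalStrip
  have hΦ0 : ∀ s, Φ s 0 = c s := normalStrip_zero c
  have hcore : (fun s => Φ s 0) = c := funext hΦ0
  have hdet : ∀ s, 0 < stripDet Φ s 0 := hreg.stripDet_normalStrip_pos
  have hperΦ : ∀ s t, Φ (s + 1) t = Φ s t := by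
    intro s t
    have hv : velocity c (s + 1) = velocity c s := by
      unfold velocity
      have : (fun s => (c s : E3)) = fun s => (c (s + 1) : E3) := by funext s; rw [hper]
      conv_rhs => rw [this]
      exact (deriv_comp_add_const (fun s => (c s : E3)) 1 s).symm
    simp only [Φ, normalStrip, hper, hv]
  obtain ⟨δ₁, hδ₁, hinj₁⟩ := exists_inj_strip hsm hperΦ (fun s => (hdet s).ne') (by
    intro s s' h
    rw [hΦ0, hΦ0] at h
    exact hinj s s' h)
  have hperd : ∀ t s, stripDet Φ (s + 1) t = stripDet Φ s t := by
    intro t s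
    have e1 : dFst Φ (s + 1) t = dFst Φ s t := by
      unfold dFst velocity
      have : (fun s' => (Φ s' t : E3)) = fun s' => (Φ (s' + 1) t : E3) := by
        funext s; rw [hperΦ]
      conv_rhs => rw [this]
      exact (deriv_comp_add_const (fun s' => (Φ s' t : E3)) 1 s).symm
    have e2 : dSnd Φ (s + 1) t = dSnd Φ s t := by
      unfold dSnd; simp only [hperΦ]
    rw [stripDet, stripDet, e1, e2, hperΦ]
  obtain ⟨δ₂, hδ₂, h₂⟩ := exists_strip_of_eventually
    (P := fun s t => 0 < stripDet Φ s t ∧ Φ s t ∉ F)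
    (fun t s => by rw [hperd, hperΦ])
    (fun s => by
      refine Filter.Eventually.and ?_ ?_
      · exact continuousAt_const.eventually_lt hsm.continuous_stripDet.continuousAt (hdet s)
      · refine hsm.continuous.continuousAt.eventually (hF.isOpen_compl.mem_nhds ?_)
        simp only [hΦ0]
        exact disjoint_left.1 hd (hran ▸ mem_range_self s))
  refine ⟨⟨Φ, min δ₁ δ₂, lt_min hδ₁ hδ₂, hsm, hperΦ, ?_, ?_, ?_, ?_, ?_⟩⟩
  · intro s s' t t' ht ht'
    exact hinj₁ s s' t t' (ht.trans_le (min_le_left _ _)) (ht'.trans_le (min_le_left _ _))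
  · intro s t ht
    exact (h₂ s t (ht.trans_le (min_le_right _ _))).1
  · rw [hcore, hran]
  · rw [hcore]; exact hreg
  · intro s t ht
    exact (h₂ s t (ht.trans_le (min_le_right _ _))).2

namespace Collar

variable {γ F : Set S2} (K : Collar γ F)

/-- The part of the collar over a set `T` of the second parameter. -/
def part (T : Set ℝ) : Set S2 := (fun z : ℝ × ℝ => K.Φ z.1 z.2) '' (univ ×ˢ T)

theorem periodic_int (k : ℤ) (s t : ℝ) : K.Φ (s + k) t = K.Φ s t := by
  have h3 : Function.Periodic (fun s => K.Φ s t) 1 := fun s => K.periodic s t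
  simpa using h3.int_mul k s

theorem isOpenMap_of_abs_lt {s t : ℝ} (ht : |t| < K.δ) :
    Filter.map (fun z : ℝ × ℝ => K.Φ z.1 z.2) (𝓝 (s, t)) = 𝓝 (K.Φ s t) :=
  K.smooth.map_nhds (K.det_pos s t ht).ne'

theorem isOpen_image {W : Set (ℝ × ℝ)} (hW : IsOpen W) (hWδ : ∀ z ∈ W, |z.2| < K.δ) :
    IsOpen ((fun z : ℝ × ℝ => K.Φ z.1 z.2) '' W) := by
  rw [isOpen_iff_mem_nhds]
  rintro _ ⟨⟨s, t⟩, hz, rfl⟩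
  rw [← K.isOpenMap_of_abs_lt (hWδ _ hz)]
  exact Filter.image_mem_map (hW.mem_nhds hz)

theorem isOpen_part {T : Set ℝ} (hT : IsOpen T) (hTδ : ∀ t ∈ T, |t| < K.δ) : IsOpen (K.part T) :=
  K.isOpen_image (isOpen_univ.prod hT) fun _ hz => hTδ _ hz.2

theorem isPreconnected_part {T : Set ℝ} (hT : IsPreconnected T) : IsPreconnected (K.part T) :=
  (isPreconnected_univ.prod hT).image _ K.smooth.continuous.continuousOn

theorem mem_part {T : Set ℝ} {s t : ℝ} (ht : t ∈ T) : K.Φ s t ∈ K.part T :=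
  ⟨(s, t), ⟨mem_univ _, ht⟩, rfl⟩

theorem part_disjoint {T T' : Set ℝ} (hT : ∀ t ∈ T, |t| < K.δ) (hT' : ∀ t ∈ T', |t| < K.δ)
    (h : Disjoint T T') : Disjoint (K.part T) (K.part T') := by
  rw [disjoint_left]
  rintro _ ⟨⟨s, t⟩, ⟨-, ht⟩, rfl⟩ ⟨⟨s', t'⟩, ⟨-, ht'⟩, he⟩
  have := (K.inj _ _ _ _ (hT' _ ht') (hT _ ht) he).1
  simp only at this ht ht'
  exact disjoint_left.1 h ht (this ▸ ht')

theorem mem_core_iff {s t : ℝ} (ht : |t| < K.δ) : K.Φ s t ∈ γ ↔ t = 0 := by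
  constructor
  · intro h
    obtain ⟨s', hs'⟩ := K.core.symm.subset h
    exact ((K.inj _ _ _ _ (by simpa using K.δ_pos) ht hs').1).symm
  · rintro rfl
    exact K.core.subset ⟨s, rfl⟩

end Collar

/-! ### The curves separate the sphere; uniqueness of Gauss–Bonnet weightings -/

instance preconnectedSpace_S2 : PreconnectedSpace S2 := by
  refine Subtype.preconnectedSpace (isConnected_sphere ?_ (0 : E3) zero_le_one).isPreconnected
  rw [← Module.finrank_eq_rank]
  simp

theorem IsSmoothSimpleClosedCurve.isConnected {γ : Set S2} (h : IsSmoothSimpleClosedCurve γ) :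
    IsConnected γ := by
  obtain ⟨c, hc, -, -, rfl⟩ := h
  exact isConnected_range hc.continuous

theorem IsSmoothSimpleClosedCurve.isCompact {γ : Set S2} (h : IsSmoothSimpleClosedCurve γ) :
    IsCompact γ := by
  obtain ⟨c, hc, hper, -, rfl⟩ := h
  have hp : Function.Periodic c 1 := hper
  rw [← hp.image_Icc one_pos 0]
  exact isCompact_Icc.image hc.continuous

namespace CurvesWithCorners

variable (C : CurvesWithCorners)

/-- The union of the curves other than `γ`. -/
def others (γ : Set S2) : Set S2 := ⋃₀ (C.curves \ {γ})

theorem isClosed_sUnion {T : Set (Set S2)} (hT : T ⊆ C.curves) : IsClosed (⋃₀ T) := by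
  rw [sUnion_eq_biUnion]
  exact (C.finite_curves.subset hT).isClosed_biUnion fun γ hγ =>
    (C.isCurve γ (hT hγ)).isCompact.isClosed

variable {C}

theorem disjoint_others {γ : Set S2} (hγ : γ ∈ C.curves) : Disjoint γ (C.others γ) := by
  rw [others, disjoint_sUnion_right]
  rintro γ' ⟨h1, h2⟩
  exact C.pairwise_disjoint hγ h1 fun h => h2 h.symm

theorem exists_collar {γ : Set S2} (hγ : γ ∈ C.curves) : Nonempty (Collar γ (C.others γ)) :=
  CreaseSurface.exists_collar (C.isCurve γ hγ) (C.isClosed_sUnion sdiff_subset) (disjoint_others hγ)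

theorem collar_mem_iff {γ : Set S2} (hγ : γ ∈ C.curves) (K : Collar γ (C.others γ)) {s t : ℝ}
    (ht : |t| < K.δ) : K.Φ s t ∈ ⋃₀ C.curves ↔ t = 0 := by
  rw [← K.mem_core_iff (s := s) ht]
  constructor
  · rintro ⟨γ', h1, h2⟩
    by_cases h : γ' = γ
    · rw [h] at h2; exact h2
    · exact absurd ⟨γ', ⟨h1, h⟩, h2⟩ (K.avoid s t ht)
  · exact fun h => ⟨γ, hγ, h⟩

/-- Each half of a collar of `γ` lies in a complementary region, and `γ` is contained in the
frontier of this region. -/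
theorem exists_region_of_part {γ : Set S2} (hγ : γ ∈ C.curves) (K : Collar γ (C.others γ))
    {T : Set ℝ} (hT : IsPreconnected T) (hTδ : ∀ t ∈ T, |t| < K.δ) (h0 : 0 ∉ T)
    (h0' : (0 : ℝ) ∈ closure T) :
    ∃ R ∈ C.regions, K.part T ⊆ R ∧ γ ⊆ frontier R := by
  obtain ⟨t₀, ht₀⟩ : T.Nonempty := closure_nonempty_iff.1 ⟨0, h0'⟩
  have hsub : K.part T ⊆ (⋃₀ C.curves)ᶜ := by
    rintro _ ⟨⟨s, t⟩, ⟨-, ht⟩, rfl⟩ hx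
    have := (collar_mem_iff hγ K (hTδ t ht)).1 hx
    exact h0 (this ▸ ht)
  have hp : K.Φ 0 t₀ ∈ K.part T := K.mem_part ht₀
  have hR : K.part T ⊆ connectedComponentIn (⋃₀ C.curves)ᶜ (K.Φ 0 t₀) :=
    (K.isPreconnected_part hT).subset_connectedComponentIn hp hsub
  refine ⟨_, ⟨K.Φ 0 t₀, hsub hp, rfl⟩, hR, ?_⟩
  intro x hx
  obtain ⟨s, rfl⟩ := K.core.symm.subset hx
  constructor
  · have hc : Continuous fun t => K.Φ s t :=
      K.smooth.continuous.comp (f := fun t => (s, t)) (by fun_prop)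
    exact closure_mono hR ((hc.continuousOn.image_closure (s := T)) ⟨0, h0', rfl⟩ |> closure_mono
      (by rintro _ ⟨t, ht, rfl⟩; exact K.mem_part ht))
  · intro hi
    exact connectedComponentIn_subset _ _ (interior_subset hi) ⟨γ, hγ, hx⟩

/-- `A` and `B` are disjoint open sets which together form the complement of `γ`, and `γ` borders
a complementary region of the collection in each of them. -/
structure IsSeparation (C : CurvesWithCorners) (γ A B : Set S2) : Prop where
  isOpen_left : IsOpen A
  isOpen_right : IsOpen B
  disjoint : Disjoint A B
  union_eq : A ∪ B = γᶜ
  left : ∃ R ∈ C.regions, R ⊆ A ∧ γ ⊆ frontier R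
  right : ∃ R ∈ C.regions, R ⊆ B ∧ γ ⊆ frontier R

theorem IsSeparation.symm {γ A B : Set S2} (h : C.IsSeparation γ A B) : C.IsSeparation γ B A :=
  ⟨h.isOpen_right, h.isOpen_left, h.disjoint.symm, by rw [union_comm, h.union_eq], h.right, h.left⟩

/-- A region lies on one side of a curve. -/
theorem region_subset {γ A B R : Set S2} (hγ : γ ∈ C.curves) (hA : IsOpen A) (hB : IsOpen B)
    (hd : Disjoint A B) (hu : A ∪ B = γᶜ) (hR : R ∈ C.regions) (hm : (R ∩ A).Nonempty) :
    R ⊆ A := by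
  obtain ⟨p, hp, rfl⟩ := hR
  refine isPreconnected_connectedComponentIn.subset_left_of_subset_union hA hB hd ?_ hm
  rw [hu]
  exact (connectedComponentIn_subset _ _).trans (compl_subset_compl.2 (subset_sUnion_of_mem hγ))

/-- A smooth simple closed curve separates the sphere. A function which jumps by `2πi` across the
curve is glued to a pair of logarithms of `1`, that is, of locally constant functions. -/
theorem exists_isSeparation {γ : Set S2} (hγ : γ ∈ C.curves) : ∃ A B, C.IsSeparation γ A B := by
  classical
  obtain ⟨K⟩ := exists_collar hγ
  have hP : ∀ t ∈ Ioo 0 K.δ, |t| < K.δ := fun t ht => by rw [abs_of_pos ht.1]; exact ht.2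
  have hN : ∀ t ∈ Ioo (-K.δ) 0, |t| < K.δ := fun t ht => by rw [abs_of_neg ht.2]; linarith [ht.1]
  have hA : ∀ t ∈ Ioo (-K.δ) K.δ, |t| < K.δ := fun t ht => abs_lt.2 ht
  set V₁ := K.part (Ioo 0 K.δ) with hV₁
  set V₀ := K.part (Ioo (-K.δ) 0) with hV₀
  set V := K.part (Ioo (-K.δ) K.δ) with hV
  have o₁ : IsOpen V₁ := K.isOpen_part isOpen_Ioo hP
  have o₀ : IsOpen V₀ := K.isOpen_part isOpen_Ioo hN
  have oV : IsOpen V := K.isOpen_part isOpen_Ioo hA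
  have hcl : IsClosed γ := (C.isCurve γ hγ).isCompact.isClosed
  have hd : Disjoint V₁ V₀ := K.part_disjoint hP hN (by
    rw [disjoint_left]; intro t h1 h2; linarith [h1.1, h2.2])
  have h0V : γ ⊆ V := by
    intro x hx
    obtain ⟨s, rfl⟩ := K.core.symm.subset hx
    exact K.mem_part ⟨by linarith [K.δ_pos], K.δ_pos⟩
  have hsub : γᶜ ∩ V ⊆ V₁ ∪ V₀ := by
    rintro _ ⟨hx, ⟨⟨s, t⟩, ⟨-, ht⟩, rfl⟩⟩
    rcases lt_trichotomy t 0 with h | h | h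
    · exact Or.inr (K.mem_part ⟨ht.1, h⟩)
    · exact absurd ((K.mem_core_iff (hA t ht)).2 h) hx
    · exact Or.inl (K.mem_part ⟨h, ht.2⟩)
  have hV₁sub : V₁ ⊆ γᶜ ∩ V := by
    rintro _ ⟨⟨s, t⟩, ⟨-, ht⟩, rfl⟩
    exact ⟨fun h => ht.1.ne' ((K.mem_core_iff (hP t ht)).1 h),
      K.mem_part ⟨by linarith [ht.1, K.δ_pos], ht.2⟩⟩
  have hV₀sub : V₀ ⊆ γᶜ ∩ V := by
    rintro _ ⟨⟨s, t⟩, ⟨-, ht⟩, rfl⟩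
    exact ⟨fun h => ht.2.ne ((K.mem_core_iff (hN t ht)).1 h),
      K.mem_part ⟨ht.1, by linarith [ht.2, K.δ_pos]⟩⟩
  -- the function jumping by `2πi` across the curve
  let ℓ : S2 → ℂ := fun x => if x ∈ V₁ then 2 * Real.pi * Complex.I else 0
  have hℓ : ContinuousOn ℓ (γᶜ ∩ V) := by
    intro x hx
    refine ContinuousAt.continuousWithinAt ?_
    rcases hsub hx with h | h
    · refine (continuousAt_const (y := (2 * Real.pi * Complex.I : ℂ))).congr ?_
      filter_upwards [o₁.mem_nhds h] with y hy
      exact (if_pos hy).symm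
    · refine (continuousAt_const (y := (0 : ℂ))).congr ?_
      filter_upwards [o₀.mem_nhds h] with y hy
      exact (if_neg fun h' => disjoint_left.1 hd h' hy).symm
  obtain ⟨g, q, hg, hq, hge, hqe, hgq⟩ := exists_log_of_cover hcl.isOpen_compl oV
    (by
      rw [eq_univ_iff_forall]
      intro x
      by_cases h : x ∈ γ
      · exact Or.inr (h0V h)
      · exact Or.inl h)
    (G := fun _ => 1) (Q := fun _ => 1) continuousOn_const (fun _ _ => one_ne_zero)
    continuousOn_const (fun _ _ => one_ne_zero) hℓ (by
      intro x _
      simp only [ℓ, one_mul]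
      split_ifs
      · rw [Complex.exp_two_pi_mul_I]
      · rw [Complex.exp_zero])
  have hqc : ∀ x ∈ V, ∀ y ∈ V, q x = q y := fun x hx y hy =>
    eq_of_exp_eq_one_of_isPreconnected (K.isPreconnected_part isPreconnected_Ioo) hq hqe hx hy
  set q₀ := q (K.Φ 0 0) with hq₀
  have h00 : K.Φ 0 0 ∈ V := K.mem_part ⟨by linarith [K.δ_pos], K.δ_pos⟩
  -- `g` is locally constant, as it takes values in the logarithms of `1`
  have hloc : ∀ x ∈ γᶜ, ∀ᶠ y in 𝓝 x, g y = g x := by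
    intro x hx
    have h1 : ContinuousAt g x := hg.continuousAt (hcl.isOpen_compl.mem_nhds hx)
    have h2 : ∀ᶠ y in 𝓝 x, ‖g y - g x‖ < 2 * Real.pi := by
      have : ContinuousAt (fun y => ‖g y - g x‖) x := (h1.sub continuousAt_const).norm
      refine this.eventually_lt continuousAt_const ?_
      simp [Real.pi_pos]
    filter_upwards [h2, hcl.isOpen_compl.mem_nhds hx] with y hy hy'
    have h3 : Complex.exp (g y - g x) = 1 := by rw [Complex.exp_sub, hge y hy', hge x hx, div_one]
    obtain ⟨n, hn⟩ := Complex.exp_eq_one_iff.1 h3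
    rw [hn] at hy
    simp only [norm_mul, Complex.norm_intCast, Complex.norm_ofNat, Complex.norm_real,
      Complex.norm_I, mul_one, Real.norm_of_nonneg Real.pi_pos.le] at hy
    have h4 : |(n : ℝ)| < 1 := by
      by_contra h; push Not at h
      nlinarith [Real.pi_pos]
    have h5 : n = 0 := by
      rw [← Int.abs_lt_one_iff]; exact_mod_cast h4
    rw [h5, Int.cast_zero, zero_mul, sub_eq_zero] at hn
    exact hn
  -- `g = q₀` on one half of the collar and `g = q₀ + 2πi` on the other one
  have oA : IsOpen {x | x ∈ γᶜ ∧ g x ≠ q₀} := by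
    rw [isOpen_iff_mem_nhds]
    rintro x ⟨hx, hx'⟩
    filter_upwards [hloc x hx, hcl.isOpen_compl.mem_nhds hx] with y hy hy'
    exact ⟨hy', hy.symm ▸ hx'⟩
  have oB : IsOpen {x | x ∈ γᶜ ∧ g x = q₀} := by
    rw [isOpen_iff_mem_nhds]
    rintro x ⟨hx, hx'⟩
    filter_upwards [hloc x hx, hcl.isOpen_compl.mem_nhds hx] with y hy hy'
    exact ⟨hy', hy.trans hx'⟩
  have hdAB : Disjoint {x | x ∈ γᶜ ∧ g x ≠ q₀} {x | x ∈ γᶜ ∧ g x = q₀} :=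
    disjoint_left.2 fun x h1 h2 => h1.2 h2.2
  have huAB : {x | x ∈ γᶜ ∧ g x ≠ q₀} ∪ {x | x ∈ γᶜ ∧ g x = q₀} = γᶜ := by
    ext x
    by_cases h : g x = q₀ <;> simp [h]
  have hV₁A : V₁ ⊆ {x | x ∈ γᶜ ∧ g x ≠ q₀} := by
    intro x hx
    refine ⟨(hV₁sub hx).1, fun h => ?_⟩
    have h1 := hgq x (hV₁sub hx)
    rw [h, hqc x (hV₁sub hx).2 _ h00, sub_self] at h1
    simp only [ℓ, if_pos hx] at h1
    exact Complex.two_pi_I_ne_zero h1.symm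
  have hV₀B : V₀ ⊆ {x | x ∈ γᶜ ∧ g x = q₀} := by
    intro x hx
    refine ⟨(hV₀sub hx).1, ?_⟩
    have h1 := hgq x (hV₀sub hx)
    simp only [ℓ, if_neg fun h' => disjoint_left.1 hd h' hx] at h1
    rw [sub_eq_zero.1 h1]
    exact hqc x (hV₀sub hx).2 _ h00
  refine ⟨_, _, oA, oB, hdAB, huAB, ?_, ?_⟩
  · obtain ⟨R, hR, hVR, hfr⟩ := exists_region_of_part hγ K isPreconnected_Ioo hP
      (fun h => lt_irrefl _ h.1) (by
        rw [closure_Ioo K.δ_pos.ne]; exact ⟨le_rfl, K.δ_pos.le⟩)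
    have hm : K.Φ 0 (K.δ / 2) ∈ V₁ :=
      K.mem_part ⟨by linarith [K.δ_pos], by linarith [K.δ_pos]⟩
    exact ⟨R, hR, region_subset hγ oA oB hdAB huAB hR ⟨_, hVR hm, hV₁A hm⟩, hfr⟩
  · obtain ⟨R, hR, hVR, hfr⟩ := exists_region_of_part hγ K isPreconnected_Ioo hN
      (fun h => lt_irrefl _ h.2) (by
        rw [closure_Ioo (by linarith [K.δ_pos])]; exact ⟨by linarith [K.δ_pos], le_rfl⟩)
    have hm : K.Φ 0 (-(K.δ / 2)) ∈ V₀ :=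
      K.mem_part ⟨by linarith [K.δ_pos], by linarith [K.δ_pos]⟩
    exact ⟨R, hR, region_subset hγ oB oA hdAB.symm (by rw [union_comm, huAB]) hR
      ⟨_, hVR hm, hV₀B hm⟩, hfr⟩

/-- If `γ'` lies on the side `A` of `γ`, then the side of `γ'` away from `γ` is contained in `A`. -/
theorem IsSeparation.subset {γ γ' A B A' B' : Set S2} (h : C.IsSeparation γ A B)
    (h' : C.IsSeparation γ' A' B') (hγ' : γ' ⊆ A) (hγ : γ ⊆ B') (hne : γ.Nonempty) : A' ⊆ A := by
  have h1 : (univ : Set S2) ⊆ (A' ∩ B) ∪ (B' ∪ A) := by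
    intro x _
    by_cases hx : x ∈ γ
    · exact Or.inr (Or.inl (hγ hx))
    by_cases hx' : x ∈ γ'
    · exact Or.inr (Or.inr (hγ' hx'))
    rcases (h.union_eq.symm.subset hx : x ∈ A ∪ B) with h2 | h2
    · exact Or.inr (Or.inr h2)
    rcases (h'.union_eq.symm.subset hx' : x ∈ A' ∪ B') with h3 | h3
    · exact Or.inl ⟨h3, h2⟩
    · exact Or.inr (Or.inl h3)
  have h2 : Disjoint (A' ∩ B) (B' ∪ A) := by
    rw [disjoint_left]
    rintro x ⟨h3, h4⟩ (h5 | h5)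
    · exact disjoint_left.1 h'.disjoint h3 h5
    · exact disjoint_left.1 h.disjoint h5 h4
  have h3 : (univ : Set S2) ⊆ B' ∪ A := by
    refine isPreconnected_univ.subset_right_of_subset_union (h'.isOpen_left.inter h.isOpen_right)
      (h'.isOpen_right.union h.isOpen_left) h2 h1 ?_
    obtain ⟨x, hx⟩ := hne
    exact ⟨x, mem_univ _, Or.inl (hγ hx)⟩
  intro x hx
  exact (h3 (mem_univ x)).resolve_left fun h4 => disjoint_left.1 h'.disjoint hx h4

/-- The weights of the curves of the collection are determined by their sums over the boundaries
of the regions: the dual graph is a tree. The proof is by induction on the number of curves on one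
side of the given one. -/
theorem eq_zero_of_sum_eq_zero {d : C.Side → ℤ} {σ : Set S2 → ℝ}
    (hd : ∀ s, (d s : ℝ) = σ s.curve)
    (hsum : ∀ R ∈ C.regions, ∑ᶠ s ∈ {s : C.Side | s.region = R}, d s = 0) (n : ℕ) :
    ∀ γ ∈ C.curves, ∀ A B, C.IsSeparation γ A B → {γ' ∈ C.curves | γ' ⊆ A}.ncard = n →
      σ γ = 0 := by
  induction n using Nat.strong_induction_on with
  | _ n ih =>
  intro γ hγ A B hAB hn
  obtain ⟨R, hR, hRA, hfr⟩ := hAB.left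
  let s₀ : C.Side := ⟨γ, R, hγ, hR, hfr⟩
  have hγne : γ.Nonempty := (C.isCurve γ hγ).isConnected.nonempty
  -- the other curves on the boundary of `R` have fewer curves on their sides away from `γ`
  have hother : ∀ s : C.Side, s ≠ s₀ → s.region = R → d s = 0 := by
    rintro ⟨γ', R', hγ', hR', hfr'⟩ hne hRR
    obtain rfl : R' = R := hRR
    have hγγ' : γ' ≠ γ := by rintro rfl; exact hne rfl
    have hclA : closure A ⊆ A ∪ γ := by
      have h1 : A ⊆ Bᶜ := fun x hx hx' => disjoint_left.1 hAB.disjoint hx hx'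
      intro x hx
      have h2 : x ∉ B := closure_minimal h1 hAB.isOpen_right.isClosed_compl hx
      by_cases h : x ∈ γ
      · exact Or.inr h
      · exact Or.inl ((hAB.union_eq.symm.subset h : x ∈ A ∪ B).resolve_right h2)
    have hdis : Disjoint γ' γ := C.pairwise_disjoint hγ' hγ hγγ'
    have hγ'A : γ' ⊆ A := fun x hx =>
      (hclA (closure_mono hRA (frontier_subset_closure (hfr' hx)))).resolve_right
        (disjoint_left.1 hdis hx)
    obtain ⟨A', B', hAB', hγB'⟩ : ∃ A' B', C.IsSeparation γ' A' B' ∧ γ ⊆ B' := by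
      obtain ⟨A', B', h⟩ := exists_isSeparation hγ'
      have h1 : γ ⊆ A' ∪ B' := by
        rw [h.union_eq]; exact fun x hx hx' => disjoint_left.1 hdis hx' hx
      rcases (C.isCurve γ hγ).isConnected.isPreconnected.subset_or_subset h.isOpen_left
        h.isOpen_right h.disjoint h1 with h2 | h2
      · exact ⟨B', A', h.symm, h2⟩
      · exact ⟨A', B', h, h2⟩
    have hA'A := hAB.subset hAB' hγ'A hγB' hγne
    have hlt : {γ'' ∈ C.curves | γ'' ⊆ A'}.ncard < n := by
      rw [← hn]
      refine ncard_lt_ncard ?_ (C.finite_curves.subset (sep_subset _ _))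
      refine ⟨fun γ'' h => ⟨h.1, h.2.trans hA'A⟩, fun h => ?_⟩
      have h1 := (h ⟨hγ', hγ'A⟩).2
      obtain ⟨x, hx⟩ := (C.isCurve γ' hγ').isConnected.nonempty
      exact (hAB'.union_eq.subset (Or.inl (h1 hx)) : x ∈ γ'ᶜ) hx
    have h0 := ih _ hlt γ' hγ' A' B' hAB' rfl
    have h1 := hd ⟨γ', R', hγ', hR', hfr'⟩
    simp only [h0] at h1
    exact_mod_cast h1
  have h1 := hsum R hR
  rw [finsum_eq_single _ s₀] at h1
  · have h2 : s₀ ∈ {s : C.Side | s.region = R} := rfl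
    rw [finsum_eq_if, if_pos h2] at h1
    have h3 := hd s₀
    rw [h1, Int.cast_zero] at h3
    exact h3.symm
  · intro s hs
    rw [finsum_eq_if]
    split_ifs with h
    · exact hother s hs h
    · rfl

/-- A collection has at most one Gauss–Bonnet weighting: the difference of two of them depends only
on the curve, and its sums over the boundaries of the regions vanish. -/
theorem IsGaussBonnetWeighting.unique {w₀ w₁ : C.Side → ℤ} (h₀ : C.IsGaussBonnetWeighting w₀)
    (h₁ : C.IsGaussBonnetWeighting w₁) : w₀ = w₁ := by
  obtain ⟨⟨τ₀, hτ₀⟩, hs₀⟩ := h₀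
  obtain ⟨⟨τ₁, hτ₁⟩, hs₁⟩ := h₁
  have hd : ∀ s, (((w₀ - w₁) s : ℤ) : ℝ) = (τ₀ - τ₁) s.curve := by
    intro s
    simp only [Pi.sub_apply, Int.cast_sub, hτ₀, hτ₁]
    ring
  have hsum : ∀ R ∈ C.regions, ∑ᶠ s ∈ {s : C.Side | s.region = R}, (w₀ - w₁) s = 0 := by
    intro R hR
    have hfin : {s : C.Side | s.region = R}.Finite := by
      refine Finite.of_finite_image (f := Side.curve) (C.finite_curves.subset ?_) ?_
      · rintro _ ⟨s, -, rfl⟩; exact s.curve_mem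
      · rintro ⟨γ, R₁, _, _, _⟩ h ⟨γ', R₂, _, _, _⟩ h' hγ
        simp only [mem_ofPred_eq] at h h' hγ
        subst h h' hγ
        rfl
    have h1 := finsum_mem_sub_distrib (f := w₀) (g := w₁) hfin
    rw [hs₀ R hR, hs₁ R hR, sub_self] at h1
    exact h1
  funext s
  obtain ⟨A, B, hAB⟩ := exists_isSeparation s.curve_mem
  have h1 := eq_zero_of_sum_eq_zero hd hsum _ s.curve s.curve_mem A B hAB rfl
  have h2 := hd s
  rw [h1] at h2
  have h3 : (w₀ - w₁) s = 0 := by exact_mod_cast h2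
  exact sub_eq_zero.1 h3

end CurvesWithCorners

/-! ### Alternating forms on the tangent planes -/

/-- The standard basis vectors of `ℝ³`. -/
def stdVec (i : Fin 3) : E3 := EuclideanSpace.single i 1

theorem eq_sum_stdVec (v : E3) : v = v 0 • stdVec 0 + v 1 • stdVec 1 + v 2 • stdVec 2 := by
  apply ext_E3 <;> simp [stdVec]

theorem sum_sq_coe (p : S2) : (p : E3) 0 ^ 2 + (p : E3) 1 ^ 2 + (p : E3) 2 ^ 2 = 1 := by
  have h := real_inner_self_eq_norm_sq (p : E3)
  rw [norm_coe_S2, inner_eq_sum] at h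
  linarith

/-- The coefficient of an alternating form on the tangent plane at `p` with respect to the area
form of the sphere. -/
def altCoeff {V : Type*} [AddCommGroup V] [Module ℝ V] (B : E3 → E3 → V) (p : S2) : V :=
  (p : E3) 0 • B (stdVec 1) (stdVec 2) + (p : E3) 1 • B (stdVec 2) (stdVec 0) +
    (p : E3) 2 • B (stdVec 0) (stdVec 1)

/-- A form vanishing on the normal vector `p` is a multiple of the area form `det3 p`; this is how
expressions depending on a choice of tangent vectors are turned into functions on the sphere. -/
theorem alt_eq_det3_smul {V : Type*} [AddCommGroup V] [Module ℝ V] (B : E3 →ₗ[ℝ] E3 →ₗ[ℝ] V)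
    (hB : ∀ v, B v v = 0) {p : S2} (hp : ∀ v, B p v = 0) (v w : E3) :
    B v w = det3 p v w • altCoeff (fun v w => B v w) p := by
  have hs : ∀ v w, B w v = -B v w := by
    intro v w
    have h1 := hB (v + w)
    simp only [map_add, LinearMap.add_apply, hB, zero_add, add_zero] at h1
    exact eq_neg_of_add_eq_zero_left h1
  set X := B (stdVec 1) (stdVec 2) with hX
  set Y := B (stdVec 2) (stdVec 0) with hY
  set Z := B (stdVec 0) (stdVec 1) with hZ
  have hX' := hs (stdVec 1) (stdVec 2)
  have hY' := hs (stdVec 2) (stdVec 0)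
  have hZ' := hs (stdVec 0) (stdVec 1)
  rw [← hX] at hX'
  rw [← hY] at hY'
  rw [← hZ] at hZ'
  have hexp : ∀ v w : E3, B v w = (v 1 * w 2 - v 2 * w 1) • X + (v 2 * w 0 - v 0 * w 2) • Y +
      (v 0 * w 1 - v 1 * w 0) • Z := by
    intro v w
    conv_lhs => rw [eq_sum_stdVec v, eq_sum_stdVec w]
    simp only [map_add, map_smul, LinearMap.add_apply, LinearMap.smul_apply, hB, hX', hY', hZ',
      ← hX, ← hY, ← hZ]
    module
  have h0 := hp (stdVec 0)
  have h1 := hp (stdVec 1)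
  have h2 := hp (stdVec 2)
  rw [hexp] at h0 h1 h2
  simp only [stdVec, PiLp.single_apply, Fin.isValue, Fin.reduceEq, if_true, if_false, mul_one,
    mul_zero, zero_sub, sub_zero, zero_smul, zero_add, add_zero] at h0 h1 h2
  rw [hexp]
  simp only [altCoeff, ← hX, ← hY, ← hZ, det3]
  have hn := sum_sq_coe p
  set a := (p : E3) 0
  set b := (p : E3) 1
  set c := (p : E3) 2
  have eX : X = a • (a • X + b • Y + c • Z) := by
    have e1 : (a ^ 2 + b ^ 2 + c ^ 2) • X = a • (a • X + b • Y + c • Z) := by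
      linear_combination (norm := module) b • h2 - c • h1
    rw [hn, one_smul] at e1; exact e1
  have eY : Y = b • (a • X + b • Y + c • Z) := by
    have e1 : (a ^ 2 + b ^ 2 + c ^ 2) • Y = b • (a • X + b • Y + c • Z) := by
      linear_combination (norm := module) c • h0 - a • h2
    rw [hn, one_smul] at e1; exact e1
  have eZ : Z = c • (a • X + b • Y + c • Z) := by
    have e1 : (a ^ 2 + b ^ 2 + c ^ 2) • Z = c • (a • X + b • Y + c • Z) := by
      linear_combination (norm := module) a • h1 - b • h0
    rw [hn, one_smul] at e1; exact e1
  set S := a • X + b • Y + c • Z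
  rw [eX, eY, eZ]
  module

/-- The form `A v * conj (D w) - A w * conj (D v)`. -/
def conjForm (A D : E3 →L[ℝ] ℂ) (v w : E3) : ℂ :=
  A v * (starRingEnd ℂ) (D w) - A w * (starRingEnd ℂ) (D v)

theorem conjForm_eq (A D : E3 →L[ℝ] ℂ) {p : S2} (hA : A p = 0) (hD : D p = 0) (v w : E3) :
    conjForm A D v w = det3 p v w • altCoeff (conjForm A D) p := by
  let B : E3 →ₗ[ℝ] E3 →ₗ[ℝ] ℂ := LinearMap.mk₂ ℝ (conjForm A D)
    (by intro a b c; simp only [conjForm, map_add]; ring)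
    (by intro r a b; simp only [conjForm, map_smul, Complex.real_smul, map_mul, Complex.conj_ofReal]
        ring)
    (by intro a b c; simp only [conjForm, map_add]; ring)
    (by intro r a b; simp only [conjForm, map_smul, Complex.real_smul, map_mul, Complex.conj_ofReal]
        ring)
  exact alt_eq_det3_smul B (fun v => by simp [B, conjForm]) (fun v => by
    simp [B, conjForm, hA, hD]) v w

theorem conjForm_self (A : E3 →L[ℝ] ℂ) (v w : E3) :
    conjForm A A v w = -(2 * area (A v) (A w) : ℝ) * Complex.I := by
  apply Complex.ext <;> simp [conjForm, area] <;> ring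

theorem continuous_altCoeff_conjForm {A D : S2 → E3 →L[ℝ] ℂ} (hA : Continuous A)
    (hD : Continuous D) : Continuous fun p => altCoeff (conjForm (A p) (D p)) p := by
  have hc : ∀ i, Continuous fun p : S2 => (p : E3) i :=
    fun i => (continuous_coord i).comp continuous_subtype_val
  have hA' : ∀ v, Continuous fun p => A p v := fun v => hA.clm_apply continuous_const
  have hD' : ∀ v, Continuous fun p => (starRingEnd ℂ) (D p v) :=
    fun v => Complex.continuous_conj.comp (hD.clm_apply continuous_const)
  have hf : ∀ v w, Continuous fun p => conjForm (A p) (D p) v w := fun v w =>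
    ((hA' v).mul (hD' w)).sub ((hA' w).mul (hD' v))
  exact (((hc 0).smul (hf _ _)).add ((hc 1).smul (hf _ _))).add ((hc 2).smul (hf _ _))

/-- The Jacobian determinant of a map from the sphere to the plane. -/
def jac (f : S2 → ℂ) (p : S2) : ℝ :=
  -(altCoeff (conjForm (sphereDeriv f p) (sphereDeriv f p)) p).im / 2

section

variable {f : S2 → ℂ} (hf : ContMDiff (𝓡 2) 𝓘(ℝ, ℂ) ∞ f)
include hf

/-- The characterization of the Jacobian by the areas of images of parallelograms. -/
theorem area_sphereDeriv (p : S2) (v w : E3) :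
    area (sphereDeriv f p v) (sphereDeriv f p w) = jac f p * det3 p v w := by
  have h1 := conjForm_eq (sphereDeriv f p) (sphereDeriv f p) (sphereDeriv_self hf p)
    (sphereDeriv_self hf p) v w
  rw [conjForm_self] at h1
  have h2 := congrArg Complex.im h1
  simp at h2
  rw [jac]
  linarith

theorem continuous_jac : Continuous (jac f) :=
  ((Complex.continuous_im.comp (continuous_altCoeff_conjForm (continuous_sphereDeriv hf)
    (continuous_sphereDeriv hf))).neg).div_const 2

end

theorem det3_self_cross (p : S2) (v : E3) (hv : inner ℝ (p : E3) v = 0) :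
    det3 p v (cross p v) = ‖v‖ ^ 2 := by
  have h1 : det3 p v (cross p v) =
      inner ℝ (p : E3) (p : E3) * inner ℝ v v - (inner ℝ (p : E3) v) ^ 2 := by
    simp only [det3, cross_zero, cross_one, cross_two, inner_eq_sum]; ring
  rw [h1, hv, real_inner_self_eq_norm_sq, real_inner_self_eq_norm_sq, norm_coe_S2]
  ring

theorem inner_cross_self (p : S2) (v : E3) : inner ℝ (p : E3) (cross p v) = 0 :=
  inner_cross_left _ _

/-- A nonzero vector tangent to the sphere at `p`. -/
theorem exists_tangent (p : S2) : ∃ v : E3, inner ℝ (p : E3) v = 0 ∧ v ≠ 0 := by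
  by_cases h : (p : E3) 0 = 0 ∧ (p : E3) 1 = 0
  · refine ⟨stdVec 0, by rw [inner_eq_sum]; simp [stdVec, h.1], ?_⟩
    intro h'
    have := congrArg (fun v : E3 => v 0) h'
    simp [stdVec] at this
  · refine ⟨cross p (stdVec 2), inner_cross_left _ _, ?_⟩
    intro h'
    apply h
    have h0 := congrArg (fun v : E3 => v 0) h'
    have h1 := congrArg (fun v : E3 => v 1) h'
    simp [stdVec, cross_zero, cross_one] at h0 h1
    exact ⟨h1, h0⟩

/-- Tangent vectors are combinations of a tangent vector `v` and its rotation `p × v`. -/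
theorem eq_comb_of_tangent {p : S2} {v w : E3} (hv : inner ℝ (p : E3) v = 0)
    (hw : inner ℝ (p : E3) w = 0) :
    ‖v‖ ^ 2 • w = inner ℝ v w • v + det3 p v w • cross p v := by
  have h1 := det3_smul_eq (p : E3) v (cross p v) w
  rw [det3_self_cross p v hv] at h1
  have e1 : det3 w v (cross p v) = 0 := by
    have : det3 w v (cross p v) = inner ℝ (p : E3) w * inner ℝ v v -
        inner ℝ (p : E3) v * inner ℝ v w := by
      simp only [det3, cross_zero, cross_one, cross_two, inner_eq_sum]; ring
    rw [this, hv, hw]; ring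
  have e2 : det3 p w (cross p v) = inner ℝ v w := by
    have : det3 p w (cross p v) = inner ℝ (p : E3) p * inner ℝ v w -
        inner ℝ (p : E3) v * inner ℝ (p : E3) w := by
      simp only [det3, cross_zero, cross_one, cross_two, inner_eq_sum]; ring
    rw [this, hv, hw, real_inner_self_eq_norm_sq, norm_coe_S2]; ring
  rw [e1, e2, zero_smul, zero_add] at h1
  exact h1

/-! ### Fold maps -/

/-- On the crease, where `df` takes values in the line spanned by `u`, the coordinate of `df` with
respect to `u`. -/
def foldForm (f u : S2 → ℂ) (p : S2) (v : E3) : ℝ := (sphereDeriv f p v / u p).re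

/-- The properties of the projection `f` of an embedding realizing the collection `C` that
determine its turning numbers. The differential of `f` is invertible off the curves; its Jacobian
vanishes to first order on the curves (`jac f = lam * j` with `j` vanishing transversally); on the
curves the differential of `f` has rank one and takes values in the line spanned by `u`.
The velocity of the projection of a curve changes its direction with respect to `u` precisely at
the corners, and `f` is injective at a corner on its convex side. -/
structure IsFoldMap (C : CurvesWithCorners) (f u : S2 → ℂ) : Prop where
  smooth : ContMDiff (𝓡 2) 𝓘(ℝ, ℂ) ∞ f
  continuous_dir : Continuous u
  jac_ne_zero : ∀ p ∉ ⋃₀ C.curves, jac f p ≠ 0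
  exists_transverse : ∃ j lam : S2 → ℝ, ContMDiff (𝓡 2) 𝓘(ℝ, ℝ) ∞ j ∧ Continuous lam ∧
    (∀ p, lam p ≠ 0) ∧ (∀ p, jac f p = lam p * j p) ∧ (∀ p ∈ ⋃₀ C.curves, j p = 0) ∧
    ∀ p ∈ ⋃₀ C.curves, ∃ v, sphereDeriv j p v ≠ 0
  dir_ne_zero : ∀ p ∈ ⋃₀ C.curves, u p ≠ 0
  sphereDeriv_eq : ∀ p ∈ ⋃₀ C.curves, ∀ v, sphereDeriv f p v = foldForm f u p v • u p
  exists_ne_zero : ∀ p ∈ ⋃₀ C.curves, ∃ v, foldForm f u p v ≠ 0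
  ne_zero_of_notMem : ∀ c, IsRegularCurve c → (∀ t, c t ∈ ⋃₀ C.curves) → ∀ t, c t ∉ C.corners →
    foldForm f u (c t) (velocity c t) ≠ 0
  sign_change : ∀ c, IsRegularCurve c → (∀ t, c t ∈ ⋃₀ C.curves) → ∀ t₀, c t₀ ∈ C.corners →
    ∃ e : ℝ, ∀ᶠ t in 𝓝[≠] t₀, 0 < e * (t - t₀) * foldForm f u (c t) (velocity c t)
  injOn : ∀ x ∈ C.corners, ∃ U ∈ 𝓝 x, InjOn f (U ∩ C.convexRegion x)

theorem sphereDeriv_conj {f : S2 → ℂ} (hf : ContMDiff (𝓡 2) 𝓘(ℝ, ℂ) ∞ f) (p : S2) (v : E3) :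
    sphereDeriv (fun q => (starRingEnd ℂ) (f q)) p v = (starRingEnd ℂ) (sphereDeriv f p v) := by
  have := sphereDeriv_comp_clm (Complex.conjCLE : ℂ →L[ℝ] ℂ) hf p
  have h2 := congrArg (fun L : E3 →L[ℝ] ℂ => L v) this
  simpa using h2

theorem contMDiff_conj {f : S2 → ℂ} (hf : ContMDiff (𝓡 2) 𝓘(ℝ, ℂ) ∞ f) :
    ContMDiff (𝓡 2) 𝓘(ℝ, ℂ) ∞ fun q => (starRingEnd ℂ) (f q) :=
  (Complex.conjCLE.contDiff.contMDiff (n := ∞)).comp hf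

theorem area_conj (a b : ℂ) : area ((starRingEnd ℂ) a) ((starRingEnd ℂ) b) = -area a b := by
  simp [area]; ring

theorem jac_conj {f : S2 → ℂ} (hf : ContMDiff (𝓡 2) 𝓘(ℝ, ℂ) ∞ f) (p : S2) :
    jac (fun q => (starRingEnd ℂ) (f q)) p = -jac f p := by
  obtain ⟨v, hv, hv0⟩ := exists_tangent p
  have h1 := area_sphereDeriv (contMDiff_conj hf) p v (cross p v)
  rw [sphereDeriv_conj hf, sphereDeriv_conj hf, area_conj, area_sphereDeriv hf,
    det3_self_cross p v hv] at h1
  have h2 : ‖v‖ ^ 2 ≠ 0 := by simpa using hv0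
  rw [← neg_mul] at h1
  exact (mul_right_cancel₀ h2 h1).symm

theorem foldForm_conj {f u : S2 → ℂ} (hf : ContMDiff (𝓡 2) 𝓘(ℝ, ℂ) ∞ f) (p : S2) (v : E3) :
    foldForm (fun q => (starRingEnd ℂ) (f q)) (fun q => (starRingEnd ℂ) (u q)) p v =
      foldForm f u p v := by
  rw [foldForm, sphereDeriv_conj hf, ← map_div₀, Complex.conj_re, foldForm]

/-- The reflection of a fold map in a line. -/
theorem IsFoldMap.conj {C : CurvesWithCorners} {f u : S2 → ℂ} (h : IsFoldMap C f u) :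
    IsFoldMap C (fun q => (starRingEnd ℂ) (f q)) (fun q => (starRingEnd ℂ) (u q)) := by
  refine ⟨contMDiff_conj h.smooth, Complex.continuous_conj.comp h.continuous_dir, ?_, ?_, ?_, ?_,
    ?_, ?_, ?_, ?_⟩
  · intro p hp
    rw [jac_conj h.smooth, neg_ne_zero]
    exact h.jac_ne_zero p hp
  · obtain ⟨j, lam, h1, h2, h3, h4, h5⟩ := h.exists_transverse
    refine ⟨j, fun p => -lam p, h1, h2.neg, fun p => neg_ne_zero.2 (h3 p), fun p => ?_, h5⟩
    rw [jac_conj h.smooth, h4, neg_mul]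
  · intro p hp
    simpa using h.dir_ne_zero p hp
  · intro p hp v
    rw [foldForm_conj h.smooth, sphereDeriv_conj h.smooth]
    conv_lhs => rw [h.sphereDeriv_eq p hp v]
    simp
  · intro p hp
    simp only [foldForm_conj h.smooth]
    exact h.exists_ne_zero p hp
  · intro c hc hcC t ht
    rw [foldForm_conj h.smooth]
    exact h.ne_zero_of_notMem c hc hcC t ht
  · intro c hc hcC t ht
    simp only [foldForm_conj h.smooth]
    exact h.sign_change c hc hcC t ht
  · intro x hx
    obtain ⟨U, hU, hi⟩ := h.injOn x hx
    exact ⟨U, hU, fun a ha b hb hab => hi ha hb ((starRingEnd ℂ).injective hab)⟩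

/-! ### Cusps of plane maps -/

/-- The intermediate value argument behind `not_injOn_of_cusp`: `h` decreases as long as `g` is
below the level `p`, but `h r > h 0`, so `h` takes the value `h 0` again where `g` is above `p`. -/
theorem exists_return {g h h' : ℝ → ℝ} {r p : ℝ} (hr : 0 < r) (hg : ContinuousOn g (Icc 0 r))
    (hgm : StrictMonoOn g (Icc 0 r)) (hg0 : g 0 < p) (hgr : p < g r)
    (hh : ∀ s ∈ Icc 0 r, HasDerivAt h (h' s) s) (hneg : ∀ s ∈ Icc 0 r, g s < p → h' s < 0)
    (hlt : h 0 < h r) : ∃ s ∈ Ioo 0 r, p < g s ∧ h s = h 0 := by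
  obtain ⟨s₂, hs₂, hgs₂⟩ := intermediate_value_Icc hr.le hg ⟨hg0.le, hgr.le⟩
  have h0 : 0 < s₂ := by
    rcases hs₂.1.eq_or_lt with h | h
    · rw [← h] at hgs₂; exact absurd hgs₂ hg0.ne
    · exact h
  have hsub : Icc 0 s₂ ⊆ Icc 0 r := Icc_subset_Icc le_rfl hs₂.2
  have hanti : StrictAntiOn h (Icc 0 s₂) := by
    refine strictAntiOn_of_deriv_neg (convex_Icc 0 s₂)
      (fun s hs => (hh s (hsub hs)).continuousAt.continuousWithinAt) ?_
    intro s hs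
    rw [interior_Icc] at hs
    have hs' : s ∈ Icc 0 r := hsub (Ioo_subset_Icc_self hs)
    rw [(hh s hs').deriv]
    exact hneg s hs' (hgs₂ ▸ hgm hs' hs₂ hs.2)
  have h1 : h s₂ < h 0 := hanti ⟨le_rfl, h0.le⟩ ⟨h0.le, le_rfl⟩ h0
  have hc : ContinuousOn h (Icc s₂ r) := fun s hs =>
    (hh s ⟨h0.le.trans hs.1, hs.2⟩).continuousAt.continuousWithinAt
  obtain ⟨s, hs, hse⟩ := intermediate_value_Ioo hs₂.2 hc ⟨h1, hlt⟩
  have hsr : s ∈ Icc 0 r := ⟨h0.le.trans hs.1.le, hs.2.le⟩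
  exact ⟨s, ⟨h0.trans hs.1, hs.2⟩, hgs₂ ▸ hgm hs₂ hsr hs.1, hse⟩

/-- The partial derivative of a function on the plane in the first variable. -/
def pFst (P : ℝ × ℝ → ℝ) (z : ℝ × ℝ) : ℝ := fderiv ℝ P z (1, 0)

/-- The partial derivative of a function on the plane in the second variable. -/
def pSnd (P : ℝ × ℝ → ℝ) (z : ℝ × ℝ) : ℝ := fderiv ℝ P z (0, 1)

theorem fderiv_eq_pFst_pSnd (P : ℝ × ℝ → ℝ) (z v : ℝ × ℝ) :
    fderiv ℝ P z v = v.1 * pFst P z + v.2 * pSnd P z := by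
  rw [pFst, pSnd, ← smul_eq_mul, ← smul_eq_mul, ← map_smul, ← map_smul, ← map_add]
  congr 1
  ext <;> simp

theorem continuous_pSnd {P : ℝ × ℝ → ℝ} (hP : ContDiff ℝ 1 P) : Continuous (pSnd P) :=
  (hP.continuous_fderiv (by simp)).clm_apply continuous_const

theorem hasDerivAt_pFst {P : ℝ × ℝ → ℝ} (hP : ContDiff ℝ 1 P) (s t : ℝ) :
    HasDerivAt (fun s => P (s, t)) (pFst P (s, t)) s := by
  have h1 : HasDerivAt (fun s' : ℝ => (s', t)) ((1 : ℝ), (0 : ℝ)) s :=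
    (hasDerivAt_id s).prodMk (hasDerivAt_const s t)
  exact ((hP.differentiable (by simp) (s, t)).hasFDerivAt).comp_hasDerivAt s h1

theorem hasDerivAt_pSnd {P : ℝ × ℝ → ℝ} (hP : ContDiff ℝ 1 P) (s t : ℝ) :
    HasDerivAt (fun t => P (s, t)) (pSnd P (s, t)) t := by
  have h1 : HasDerivAt (fun t' : ℝ => (s, t')) ((0 : ℝ), (1 : ℝ)) t :=
    (hasDerivAt_const t s).prodMk (hasDerivAt_id t)
  exact ((hP.differentiable (by simp) (s, t)).hasFDerivAt).comp_hasDerivAt t h1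

/-- Local coordinates `(s, P)` near the origin of the `(s, t)`-plane, when `∂P/∂t ≠ 0`: along the
level lines of `P`, the derivative of `Q` is given by the Jacobian of `(P, Q)`. -/
theorem exists_level_coordinates {P Q : ℝ × ℝ → ℝ} (hP : ContDiff ℝ 1 P) (hQ : ContDiff ℝ 1 Q)
    (hτ : pSnd P (0, 0) ≠ 0) {N : Set (ℝ × ℝ)} (hN : N ∈ 𝓝 ((0 : ℝ), (0 : ℝ))) :
    ∃ th : ℝ × ℝ → ℝ, ∀ᶠ w in 𝓝 ((0 : ℝ), P (0, 0)), (w.1, th w) ∈ N ∧ P (w.1, th w) = w.2 ∧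
      ContinuousAt (fun w => Q (w.1, th w)) w ∧
      ∃ d, HasDerivAt (fun s => Q (s, th (s, w.2))) d w.1 ∧
      d * pSnd P (w.1, th w) = pSnd P (w.1, th w) * pFst Q (w.1, th w) -
        pFst P (w.1, th w) * pSnd Q (w.1, th w) := by
  -- the inverse function theorem for `(s, t) ↦ (s, P)`
  let M : ℝ × ℝ → ℝ × ℝ := fun z => (z.1, P z)
  have hM : ContDiff ℝ 1 M := contDiff_fst.prodMk hP
  set a := pFst P (0, 0)
  set b := pSnd P (0, 0)
  let L : (ℝ × ℝ) ≃ₗ[ℝ] (ℝ × ℝ) :=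
    { toFun := fun v => (v.1, v.1 * a + v.2 * b)
      map_add' := by intro v w; ext <;> simp; ring
      map_smul' := by intro r v; ext <;> simp; ring
      invFun := fun v => (v.1, (v.2 - v.1 * a) / b)
      left_inv := by intro v; ext <;> simp; field_simp
      right_inv := by intro v; ext <;> simp; field_simp; ring }
  have hM' : HasFDerivAt M (L.toContinuousLinearEquiv : (ℝ × ℝ) →L[ℝ] (ℝ × ℝ)) (0, 0) := by
    have h1 : HasFDerivAt M ((ContinuousLinearMap.fst ℝ ℝ ℝ).prod (fderiv ℝ P (0, 0))) (0, 0) :=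
      hasFDerivAt_fst.prodMk (hP.differentiable (by simp) (0, 0)).hasFDerivAt
    convert h1 using 1
    refine ContinuousLinearMap.ext fun v => ?_
    have : L v = (v.1, v.1 * a + v.2 * b) := rfl
    simp only [ContinuousLinearMap.prod_apply, fderiv_eq_pFst_pSnd]
    exact this
  have hc := hM.contDiffAt (x := ((0 : ℝ), (0 : ℝ)))
  let e := hc.toOpenPartialHomeomorph M hM' one_ne_zero
  let R := hc.localInverse hM' one_ne_zero
  have hR0 : R (0, P (0, 0)) = (0, 0) := hc.localInverse_apply_image hM' one_ne_zero
  have hRc : ContDiffAt ℝ 1 R (0, P (0, 0)) := hc.to_localInverse hM' one_ne_zero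
  have htar : ∀ᶠ w in 𝓝 ((0 : ℝ), P (0, 0)), w ∈ e.target :=
    e.open_target.mem_nhds (hc.image_mem_toOpenPartialHomeomorph_target hM' one_ne_zero)
  have hMR : ∀ w ∈ e.target, M (R w) = w := fun w hw => e.right_inv hw
  have hRN : ∀ᶠ w in 𝓝 ((0 : ℝ), P (0, 0)), R w ∈ N :=
    hRc.continuousAt.eventually_mem (by rw [hR0]; exact hN)
  have hdiff : ∀ᶠ w in 𝓝 ((0 : ℝ), P (0, 0)), DifferentiableAt ℝ R w := by
    filter_upwards [hRc.eventually (by simp)] with w hw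
    exact hw.differentiableAt (by simp)
  have hPd : Differentiable ℝ P := hP.differentiable (by simp)
  have hQd : Differentiable ℝ Q := hQ.differentiable (by simp)
  refine ⟨fun w => (R w).2, ?_⟩
  filter_upwards [hRN, hdiff, htar, e.open_target.mem_nhds
    (hc.image_mem_toOpenPartialHomeomorph_target hM' one_ne_zero)] with w hwN hwd hwt hwt'
  have hR1 : ∀ w' ∈ e.target, (w'.1, (R w').2) = R w' := by
    intro w' hw'
    have := congrArg Prod.fst (hMR w' hw')
    exact Prod.ext this.symm rfl
  have hev : ∀ᶠ w' in 𝓝 w, w' ∈ e.target := e.open_target.mem_nhds hwt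
  have hline : ContinuousAt (fun s : ℝ => (s, w.2)) w.1 := by fun_prop
  have hlineR : HasDerivAt (fun s : ℝ => R (s, w.2)) (fderiv ℝ R w (1, 0)) w.1 := by
    have h1 : HasDerivAt (fun s' : ℝ => (s', w.2)) ((1 : ℝ), (0 : ℝ)) w.1 :=
      (hasDerivAt_id w.1).prodMk (hasDerivAt_const w.1 w.2)
    exact HasFDerivAt.comp_hasDerivAt (x := w.1) (f := fun s' : ℝ => (s', w.2))
      (l := R) hwd.hasFDerivAt h1
  have hlinet : ∀ᶠ s in 𝓝 w.1, (s, w.2) ∈ e.target := hline.eventually_mem hev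
  set v := fderiv ℝ R w (1, 0) with hv
  have hv1 : v.1 = 1 := by
    have h1 : HasDerivAt (fun s : ℝ => (R (s, w.2)).1) v.1 w.1 :=
      HasFDerivAt.comp_hasDerivAt (x := w.1) (f := fun s' : ℝ => R (s', w.2))
        (l := Prod.fst) (hasFDerivAt_fst (𝕜 := ℝ)) hlineR
    have h2 : HasDerivAt (fun s : ℝ => (R (s, w.2)).1) 1 w.1 := by
      refine (hasDerivAt_id w.1).congr_of_eventuallyEq ?_
      filter_upwards [hlinet] with s hs
      exact congrArg Prod.fst (hMR _ hs)
    exact h1.unique h2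
  have hPv : v.1 * pFst P (R w) + v.2 * pSnd P (R w) = 0 := by
    rw [← fderiv_eq_pFst_pSnd]
    have h1 : HasDerivAt (fun s : ℝ => P (R (s, w.2))) (fderiv ℝ P (R w) v) w.1 :=
      HasFDerivAt.comp_hasDerivAt (x := w.1) (f := fun s' : ℝ => R (s', w.2))
        (l := P) (hPd (R w)).hasFDerivAt hlineR
    have h2 : HasDerivAt (fun s : ℝ => P (R (s, w.2))) 0 w.1 := by
      refine (hasDerivAt_const w.1 w.2).congr_of_eventuallyEq ?_
      filter_upwards [hlinet] with s hs
      exact congrArg Prod.snd (hMR _ hs)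
    exact h1.unique h2
  have hQv : HasDerivAt (fun s : ℝ => Q (R (s, w.2)))
      (v.1 * pFst Q (R w) + v.2 * pSnd Q (R w)) w.1 := by
    rw [← fderiv_eq_pFst_pSnd]
    exact HasFDerivAt.comp_hasDerivAt (x := w.1) (f := fun s' : ℝ => R (s', w.2))
        (l := Q) (hQd (R w)).hasFDerivAt hlineR
  rw [hR1 w hwt]
  refine ⟨hwN, congrArg Prod.snd (hMR w hwt), ?_, _, hQv.congr_of_eventuallyEq ?_, ?_⟩
  · have h1 : ContinuousAt (fun w' => Q (R w')) w :=
      ContinuousAt.comp (g := Q) hQ.continuous.continuousAt hwd.continuousAt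
    refine h1.congr ?_
    filter_upwards [hev] with w' hw'
    simp only [hR1 w' hw']
  · filter_upwards [hlinet] with s hs
    simp only [hR1 _ hs]
  · rw [hv1] at hPv ⊢
    linear_combination pSnd Q (R w) * hPv

/-- A plane map `(P, Q)` folding along the axis `t = 0`, with a cusp at the origin (`P` restricted
to the axis has a strict minimum at the origin), is not injective on the side `t > 0` if `P`
decreases in the direction of this side: this is the side on which the map turns around the cusp by
more than a half turn. -/
theorem not_injOn_of_cusp {P Q : ℝ × ℝ → ℝ} (hP : ContDiff ℝ 1 P) (hQ : ContDiff ℝ 1 Q)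
    (hs : ∀ᶠ s in 𝓝[≠] (0 : ℝ), 0 < s * pFst P (s, 0)) (hτ : pSnd P (0, 0) < 0)
    (ha : ∀ᶠ z in 𝓝 ((0 : ℝ), (0 : ℝ)), z.2 ≠ 0 →
      0 < z.2 * (pFst P z * pSnd Q z - pSnd P z * pFst Q z))
    {W : Set (ℝ × ℝ)} (hW : W ∈ 𝓝 ((0 : ℝ), (0 : ℝ))) :
    ∃ z ∈ W, ∃ z' ∈ W, 0 < z.2 ∧ 0 < z'.2 ∧ z ≠ z' ∧ P z = P z' ∧ Q z = Q z' := by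
  have hτ' : ∀ᶠ z in 𝓝 ((0 : ℝ), (0 : ℝ)), pSnd P z < 0 :=
    (continuous_pSnd hP).continuousAt.eventually_lt continuousAt_const hτ
  -- a box on which all the sign conditions hold
  obtain ⟨ρ, hρ, hbox⟩ := Metric.eventually_nhds_iff.1 (hτ'.and (ha.and hW))
  have hbox' : ∀ s t : ℝ, |s| < ρ → |t| < ρ → pSnd P (s, t) < 0 ∧ (t ≠ 0 →
      0 < t * (pFst P (s, t) * pSnd Q (s, t) - pSnd P (s, t) * pFst Q (s, t))) ∧ (s, t) ∈ W := by
    intro s t hs ht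
    have := hbox (y := (s, t)) (by rw [Prod.dist_eq]; simp [hs, ht])
    exact this
  have hN : {z : ℝ × ℝ | |z.1| < ρ ∧ |z.2| < ρ} ∈ 𝓝 ((0 : ℝ), (0 : ℝ)) := by
    refine IsOpen.mem_nhds ?_ (by simp [hρ])
    exact (isOpen_lt continuous_fst.abs continuous_const).inter
      (isOpen_lt continuous_snd.abs continuous_const)
  obtain ⟨th, hth⟩ := exists_level_coordinates hP hQ hτ.ne hN
  set p₀ := P (0, 0) with hp₀
  obtain ⟨η, hη, hth'⟩ := Metric.eventually_nhds_iff.1 hth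
  obtain ⟨r₁, hr₁, hs'⟩ := Metric.eventually_nhds_iff.1 (eventually_nhdsWithin_iff.1 hs)
  let g : ℝ → ℝ := fun s => P (s, 0)
  have hgd : ∀ s, HasDerivAt g (pFst P (s, 0)) s := fun s => hasDerivAt_pFst hP s 0
  have hgc : Continuous g := hP.continuous.comp (by fun_prop : Continuous fun s : ℝ => (s, (0 : ℝ)))
  obtain ⟨r, hr, hrη, hrr, hrρ⟩ : ∃ r, 0 < r ∧ r < η ∧ r < r₁ ∧ r < ρ :=
    ⟨min η (min r₁ ρ) / 2, by positivity,
      by linarith [min_le_left η (min r₁ ρ), show 0 < min η (min r₁ ρ) by positivity],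
      by linarith [min_le_right η (min r₁ ρ), min_le_left r₁ ρ,
        show 0 < min η (min r₁ ρ) by positivity],
      by linarith [min_le_right η (min r₁ ρ), min_le_right r₁ ρ,
        show 0 < min η (min r₁ ρ) by positivity]⟩
  have hgs : ∀ s, |s| ≤ r → s ≠ 0 → 0 < s * pFst P (s, 0) := fun s hs hs0 =>
    hs' (by simpa using hs.trans_lt hrr) hs0
  have hmono : StrictMonoOn g (Icc 0 r) := by
    refine strictMonoOn_of_deriv_pos (convex_Icc 0 r) hgc.continuousOn ?_
    intro s hs
    rw [interior_Icc] at hs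
    rw [(hgd s).deriv]
    exact pos_of_mul_pos_right (hgs s (by rw [abs_of_pos hs.1]; exact hs.2.le) hs.1.ne') hs.1.le
  have hmono' : StrictMonoOn (fun s => g (-s)) (Icc 0 r) := by
    refine strictMonoOn_of_deriv_pos (convex_Icc 0 r) (hgc.comp continuous_neg).continuousOn ?_
    intro s hs
    rw [interior_Icc] at hs
    have hd : HasDerivAt (fun s => g (-s)) (pFst P (-s, 0) * -1) s :=
      (hgd (-s)).comp s (hasDerivAt_neg s)
    rw [hd.deriv]
    have := hgs (-s) (by rw [abs_neg, abs_of_pos hs.1]; exact hs.2.le) (neg_ne_zero.2 hs.1.ne')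
    nlinarith [hs.1]
  have hg0 : g 0 = p₀ := rfl
  have hgr : p₀ < g r := hg0 ▸ hmono ⟨le_rfl, hr.le⟩ ⟨hr.le, le_rfl⟩ hr
  have hgr' : p₀ < g (-r) := by
    have := hmono' ⟨le_rfl, hr.le⟩ ⟨hr.le, le_rfl⟩ hr
    simpa [hg0] using this
  -- facts about the coordinates on the box `|s| ≤ r`, `|p - p₀| < η`
  have hcoord : ∀ s p : ℝ, |s| ≤ r → |p - p₀| < η → |th (s, p)| < ρ ∧ P (s, th (s, p)) = p ∧
      ContinuousAt (fun w : ℝ × ℝ => Q (w.1, th w)) (s, p) ∧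
      ∃ d, HasDerivAt (fun s => Q (s, th (s, p))) d s ∧
      d * pSnd P (s, th (s, p)) = pSnd P (s, th (s, p)) * pFst Q (s, th (s, p)) -
        pFst P (s, th (s, p)) * pSnd Q (s, th (s, p)) := by
    intro s p hsr hp
    have := hth' (y := (s, p)) (by
      rw [Prod.dist_eq]; simp only [Real.dist_eq, sub_zero]; exact max_lt (hsr.trans_lt hrη) hp)
    exact ⟨this.1.2, this.2⟩
  -- the position of a point with respect to the axis can be read off from the value of `P`
  have hside : ∀ s p : ℝ, |s| ≤ r → |p - p₀| < η →
      (p < g s → 0 < th (s, p)) ∧ (g s < p → th (s, p) < 0) := by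
    intro s p hsr hp
    obtain ⟨h1, h2, -⟩ := hcoord s p hsr hp
    have hanti : StrictAntiOn (fun t => P (s, t)) (Ioo (-ρ) ρ) := by
      refine strictAntiOn_of_deriv_neg (convex_Ioo _ _)
        (fun t _ => (hasDerivAt_pSnd hP s t).continuousAt.continuousWithinAt) ?_
      intro t ht
      rw [interior_Ioo] at ht
      rw [(hasDerivAt_pSnd hP s t).deriv]
      exact (hbox' s t (hsr.trans_lt hrρ) (abs_lt.2 ht)).1
    have h0 : (0 : ℝ) ∈ Ioo (-ρ) ρ := ⟨by linarith, hρ⟩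
    have ht := abs_lt.1 h1
    constructor
    · intro h
      by_contra hle
      have := hanti.antitoneOn ht h0 (not_lt.1 hle)
      simp only [h2] at this
      exact absurd h (not_lt.2 this)
    · intro h
      by_contra hle
      have := hanti.antitoneOn h0 ht (not_lt.1 hle)
      simp only [h2] at this
      exact absurd h (not_lt.2 this)
  -- so `Q` increases with `s` along the part of a level line in `t > 0`, and decreases in `t < 0`
  choose! d hd hdeq using fun s p (hsr : |s| ≤ r) (hp : |p - p₀| < η) => (hcoord s p hsr hp).2.2.2
  have hdsign : ∀ s p : ℝ, |s| ≤ r → |p - p₀| < η →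
      (p < g s → 0 < d s p) ∧ (g s < p → d s p < 0) := by
    intro s p hsr hp
    obtain ⟨h1, h2⟩ := hside s p hsr hp
    have h3 := (hcoord s p hsr hp).1
    obtain ⟨h4, h5, -⟩ := hbox' s (th (s, p)) (hsr.trans_lt hrρ) h3
    have h6 := hdeq s p hsr hp
    constructor
    · intro h
      have h7 := h5 (h1 h).ne'
      have h8 := pos_of_mul_pos_right h7 (h1 h).le
      have h9 : d s p * pSnd P (s, th (s, p)) < 0 := by rw [h6]; linarith
      by_contra hle
      exact absurd h9 (not_lt.2 (mul_nonneg_of_nonpos_of_nonpos (not_lt.1 hle) h4.le))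
    · intro h
      have h7 := h5 (h2 h).ne
      have h9 : 0 < d s p * pSnd P (s, th (s, p)) := by rw [h6]; nlinarith [h2 h]
      by_contra hle
      exact absurd h9 (not_lt.2 (mul_nonpos_of_nonneg_of_nonpos (not_lt.1 hle) h4.le))
  let h : ℝ → ℝ → ℝ := fun p s => Q (s, th (s, p))
  have hp₀η : |p₀ - p₀| < η := by simpa using hη
  have habs : ∀ s ∈ Icc 0 r, |s| ≤ r := fun s hs => by rw [abs_of_nonneg hs.1]; exact hs.2
  have habs' : ∀ s ∈ Icc 0 r, |(-s)| ≤ r := fun s hs => by rw [abs_neg]; exact habs s hs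
  -- the level line of the cusp lies in the half plane `t ≥ 0`
  have hpos₀ : h p₀ 0 < h p₀ r := by
    have : StrictMonoOn (h p₀) (Icc 0 r) := by
      refine strictMonoOn_of_deriv_pos (convex_Icc 0 r)
        (fun s hs => (hd s p₀ (habs s hs) hp₀η).continuousAt.continuousWithinAt) ?_
      intro s hs
      rw [interior_Icc] at hs
      have hs1 := habs s (Ioo_subset_Icc_self hs)
      rw [(hd s p₀ hs1 hp₀η).deriv]
      exact (hdsign s p₀ hs1 hp₀η).1
        (hg0 ▸ hmono ⟨le_rfl, hr.le⟩ (Ioo_subset_Icc_self hs) hs.1)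
    exact this ⟨le_rfl, hr.le⟩ ⟨hr.le, le_rfl⟩ hr
  have hneg₀ : h p₀ (-r) < h p₀ 0 := by
    have : StrictAntiOn (fun s => h p₀ (-s)) (Icc 0 r) := by
      have hd' : ∀ s ∈ Icc 0 r, HasDerivAt (fun s => h p₀ (-s)) (d (-s) p₀ * -1) s := fun s hs =>
        (hd (-s) p₀ (habs' s hs) hp₀η).comp s (hasDerivAt_neg s)
      refine strictAntiOn_of_deriv_neg (convex_Icc 0 r)
        (fun s hs => (hd' s hs).continuousAt.continuousWithinAt) ?_
      intro s hs
      rw [interior_Icc] at hs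
      have hs1 := Ioo_subset_Icc_self hs
      rw [(hd' s hs1).deriv]
      have h1 := hmono' ⟨le_rfl, hr.le⟩ hs1 hs.1
      simp only [neg_zero, hg0] at h1
      linarith [(hdsign (-s) p₀ (habs' s hs1) hp₀η).1 h1]
    simpa using this ⟨le_rfl, hr.le⟩ ⟨hr.le, le_rfl⟩ hr
  -- a level slightly above the one of the cusp
  have hcont : ∀ s, |s| ≤ r → ContinuousAt (fun p => h p s) p₀ := fun s hsr =>
    ContinuousAt.comp (g := fun w : ℝ × ℝ => Q (w.1, th w)) (f := fun p => (s, p))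
      (hcoord s p₀ hsr hp₀η).2.2.1 (by fun_prop)
  have hr0 : |(0 : ℝ)| ≤ r := by simpa using hr.le
  have hrr' : |r| ≤ r := habs r ⟨hr.le, le_rfl⟩
  have hrn : |(-r)| ≤ r := habs' r ⟨hr.le, le_rfl⟩
  have hev : ∀ᶠ p in 𝓝 p₀, |p - p₀| < η ∧ p < g r ∧ p < g (-r) ∧ h p 0 < h p r ∧
      h p (-r) < h p 0 := by
    refine Filter.Eventually.and ?_ (Filter.Eventually.and (gt_mem_nhds hgr)
      (Filter.Eventually.and (gt_mem_nhds hgr') (Filter.Eventually.and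
        ((hcont 0 hr0).eventually_lt (hcont r hrr') hpos₀)
        ((hcont (-r) hrn).eventually_lt (hcont 0 hr0) hneg₀))))
    exact Metric.eventually_nhds_iff.2 ⟨η, hη, fun p hp => hp⟩
  obtain ⟨p, ⟨hpη, hpr, hpr', hp1, hp2⟩, hpp⟩ :=
    ((hev.filter_mono nhdsWithin_le_nhds).and (self_mem_nhdsWithin (s := Ioi p₀))).exists
  obtain ⟨s₁, hs₁, hgs₁, hhs₁⟩ := exists_return (g := g) (h := h p) (h' := fun s => d s p) hr
    hgc.continuousOn hmono (hg0 ▸ hpp) hpr (fun s hs => hd s p (habs s hs) hpη)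
    (fun s hs => (hdsign s p (habs s hs) hpη).2) hp1
  obtain ⟨s₂, hs₂, hgs₂, hhs₂⟩ := exists_return (g := fun s => g (-s)) (h := fun s => -h p (-s))
    (h' := fun s => -(d (-s) p * -1)) hr (hgc.comp continuous_neg).continuousOn hmono'
    (by simpa [hg0] using hpp) hpr'
    (fun s hs => ((hd (-s) p (habs' s hs) hpη).comp s (hasDerivAt_neg s)).neg)
    (fun s hs hlt => by linarith [(hdsign (-s) p (habs' s hs) hpη).2 hlt])
    (by simpa using hp2)
  have ha₁ := habs s₁ (Ioo_subset_Icc_self hs₁)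
  have ha₂ := habs' s₂ (Ioo_subset_Icc_self hs₂)
  have c₁ := hcoord s₁ p ha₁ hpη
  have c₂ := hcoord (-s₂) p ha₂ hpη
  refine ⟨(s₁, th (s₁, p)), (hbox' _ _ (ha₁.trans_lt hrρ) c₁.1).2.2, (-s₂, th (-s₂, p)),
    (hbox' _ _ (ha₂.trans_lt hrρ) c₂.1).2.2, (hside s₁ p ha₁ hpη).1 hgs₁,
    (hside (-s₂) p ha₂ hpη).1 hgs₂, ?_, c₁.2.1.trans c₂.2.1.symm, ?_⟩
  · intro h'
    have := congrArg Prod.fst h'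
    simp only at this
    linarith [hs₁.1, hs₂.1]
  · have e1 : h p s₁ = h p 0 := hhs₁
    have e2 : h p (-s₂) = h p 0 := by simpa using hhs₂
    exact e1.trans e2.symm

/-! ### Curves in the zero set of a function on the sphere -/

/-- Near `a`, the sign of `f t - f a` is that of `d * (t - a)`. -/
theorem eventually_mul_pos_of_hasDerivAt {f : ℝ → ℝ} {a d : ℝ} (hf : HasDerivAt f d a)
    (hd : d ≠ 0) : ∀ᶠ t in 𝓝[≠] a, 0 < d * (f t - f a) * (t - a) := by
  have h1 : ∀ᶠ t in 𝓝[≠] a, 0 < d * slope f a t :=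
    ((hasDerivAt_iff_tendsto_slope.1 hf).const_mul d).eventually (lt_mem_nhds (mul_self_pos.2 hd))
  filter_upwards [h1, self_mem_nhdsWithin] with t ht hta
  have h2 : t - a ≠ 0 := sub_ne_zero.2 hta
  have h3 : d * (f t - f a) * (t - a) = d * slope f a t * (t - a) ^ 2 := by
    rw [slope_def_field]; field_simp
  rw [h3]; positivity

theorem map_eq_zero_of_det3_ne_zero {V : Type*} [AddCommGroup V] [Module ℝ V] (A : E3 →ₗ[ℝ] V)
    {a b c : E3} (h : det3 a b c ≠ 0) (ha : A a = 0) (hb : A b = 0) (hc : A c = 0) (v : E3) :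
    A v = 0 := by
  have h1 := congrArg A (det3_smul_eq a b c v)
  simp only [map_add, map_smul, ha, hb, hc, smul_zero, add_zero] at h1
  exact (smul_eq_zero.1 h1).resolve_left h

section

variable {j : S2 → ℝ} (hj : ContMDiff (𝓡 2) 𝓘(ℝ, ℝ) ∞ j)
include hj

theorem sphereDeriv_velocity_eq_zero {c : ℝ → S2} (hc : IsRegularCurve c) (h : ∀ t, j (c t) = 0)
    (t : ℝ) : sphereDeriv j (c t) (velocity c t) = 0 := by
  have h1 := hasDerivAt_comp_curve hj (hc.hasDerivAt t)
  simp only [h] at h1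
  exact h1.unique (hasDerivAt_const t 0)

theorem sphereDeriv_cross_ne_zero {p : S2} {v : E3} (hv : inner ℝ (p : E3) v = 0) (hv0 : v ≠ 0)
    (hjv : sphereDeriv j p v = 0) (h : ∃ w, sphereDeriv j p w ≠ 0) :
    sphereDeriv j p (cross p v) ≠ 0 := by
  intro h0
  obtain ⟨w, hw⟩ := h
  refine hw (map_eq_zero_of_det3_ne_zero (sphereDeriv j p : E3 →ₗ[ℝ] ℝ) (a := p) (b := v)
    (c := cross p v) ?_ (sphereDeriv_self hj p) hjv h0 w)
  rw [det3_self_cross p v hv]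
  simpa using hv0

/-- Two regular curves in the zero set of `j` through a point where `j` vanishes transversally
run through the same points near this point, in the same or in opposite directions. -/
theorem exists_param_transfer {c c₁ : ℝ → S2} (hc : IsRegularCurve c) (hc₁ : IsRegularCurve c₁)
    (h : ∀ t, j (c t) = 0) (h₁ : ∀ t, j (c₁ t) = 0) {t₀ : ℝ} (hx : c t₀ = c₁ 0)
    (htr : ∃ v, sphereDeriv j (c₁ 0) v ≠ 0) :
    ∃ s : ℝ, s ≠ 0 ∧ ∀ δ > 0, ∀ᶠ t in 𝓝[≠] t₀, ∃ t', |t'| < δ ∧ c t = c₁ t' ∧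
      0 < s * (t - t₀) * t' := by
  set X := velocity c t₀
  set X₁ := velocity c₁ 0
  have hX0 : X ≠ 0 := hc.2 t₀
  have hX₁0 : X₁ ≠ 0 := hc₁.2 0
  have hXt : inner ℝ (c₁ 0 : E3) X = 0 := hx ▸ inner_velocity (hc.hasDerivAt t₀)
  have hX₁t : inner ℝ (c₁ 0 : E3) X₁ = 0 := inner_velocity (hc₁.hasDerivAt 0)
  have hjX : sphereDeriv j (c₁ 0) X = 0 := hx ▸ sphereDeriv_velocity_eq_zero hj hc h t₀
  have hjX₁ : sphereDeriv j (c₁ 0) X₁ = 0 := sphereDeriv_velocity_eq_zero hj hc₁ h₁ 0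
  have hn : inner ℝ X₁ X ≠ 0 := by
    intro h0
    have e1 := eq_comb_of_tangent hX₁t hXt
    have e2 := congrArg (sphereDeriv j (c₁ 0)) e1
    simp only [map_add, map_smul, hjX, hjX₁, mul_zero, zero_add, smul_eq_mul] at e2
    have e3 := (mul_eq_zero.1 e2.symm).resolve_right
      (sphereDeriv_cross_ne_zero hj hX₁t hX₁0 hjX₁ htr)
    rw [h0, e3, zero_smul, zero_smul, add_zero, smul_eq_zero] at e1
    rcases e1 with e1 | e1
    · exact hX₁0 (by simpa using e1)
    · exact hX0 e1
  -- the coordinate in the direction of `X₁` detects the position on both curves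
  have hd : HasDerivAt (fun t => inner ℝ X₁ (c t : E3)) (inner ℝ X₁ X) t₀ :=
    (hasDerivAt_const t₀ X₁).inner ℝ (hc.hasDerivAt t₀) |>.congr_deriv (by simp [X])
  have hd₁ : HasDerivAt (fun t => inner ℝ X₁ (c₁ t : E3)) (inner ℝ X₁ X₁) 0 :=
    (hasDerivAt_const (0 : ℝ) X₁).inner ℝ (hc₁.hasDerivAt 0) |>.congr_deriv (by simp [X₁])
  have hn₁ : 0 < inner ℝ X₁ X₁ := real_inner_self_pos.2 hX₁0
  have hs := eventually_mul_pos_of_hasDerivAt hd hn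
  have hs₁ := eventually_nhdsWithin_iff.1 (eventually_mul_pos_of_hasDerivAt hd₁ hn₁.ne')
  refine ⟨inner ℝ X₁ X, hn, fun δ hδ => ?_⟩
  have hsm := hc₁.isSmoothStrip_normalStrip
  have hdet := hc₁.stripDet_normalStrip_pos 0
  set Φ := normalStrip c₁ with hΦ
  have hΦ0 : ∀ s, Φ s 0 = c₁ s := normalStrip_zero c₁
  have hdj : ∀ s t, HasDerivAt (fun t => j (Φ s t)) (sphereDeriv j (Φ s t) (dSnd Φ s t)) t :=
    fun s t => hasDerivAt_comp_curve hj (hsm.hasDerivAt_snd s t)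
  have hdjc : Continuous fun z : ℝ × ℝ => sphereDeriv j (Φ z.1 z.2) (dSnd Φ z.1 z.2) :=
    ((continuous_sphereDeriv hj).comp hsm.continuous).clm_apply hsm.continuous_dSnd
  have hd0 : sphereDeriv j (Φ 0 0) (dSnd Φ 0 0) ≠ 0 := by
    intro h0
    obtain ⟨w, hw⟩ := htr
    rw [← hΦ0] at hw hjX₁
    refine hw (map_eq_zero_of_det3_ne_zero (sphereDeriv j (Φ 0 0) : E3 →ₗ[ℝ] ℝ)
      (show det3 (Φ 0 0) (dFst Φ 0 0) (dSnd Φ 0 0) ≠ 0 from hdet.ne')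
      (sphereDeriv_self hj _) ?_ h0 w)
    rw [dFst_normalStrip]; exact hjX₁
  have hne : ∀ᶠ z : ℝ × ℝ in 𝓝 (0, 0), sphereDeriv j (Φ z.1 z.2) (dSnd Φ z.1 z.2) ≠ 0 :=
    hdjc.continuousAt.eventually_ne hd0
  have hs₁' : ∀ᶠ z : ℝ × ℝ in 𝓝 (0, 0), z.1 ≠ 0 →
      0 < inner ℝ X₁ X₁ * (inner ℝ X₁ (c₁ z.1 : E3) - inner ℝ X₁ (c₁ 0 : E3)) * (z.1 - 0) :=
    (continuous_fst.tendsto ((0 : ℝ), (0 : ℝ))).eventually hs₁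
  obtain ⟨ρ, hρ, hbox⟩ := Metric.eventually_nhds_iff.1 (hne.and hs₁')
  have hcore : ∀ s t : ℝ, |s| < ρ → |t| < ρ → j (Φ s t) = 0 → t = 0 := by
    intro s t hs ht hjt
    by_contra h0
    have hz : ∀ t', |t'| < ρ → sphereDeriv j (Φ s t') (dSnd Φ s t') ≠ 0 := fun t' ht' =>
      (hbox (y := (s, t')) (by rw [Prod.dist_eq]; simp [hs, ht'])).1
    have hc0 : Continuous fun t => j (Φ s t) :=
      continuous_iff_continuousAt.2 fun t => (hdj s t).continuousAt
    have hj0 : j (Φ s 0) = 0 := by rw [hΦ0, h₁]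
    rcases lt_or_gt_of_ne h0 with h0 | h0
    · obtain ⟨t', ht', hd'⟩ := exists_deriv_eq_zero h0 hc0.continuousOn (by rw [hjt, hj0])
      rw [(hdj s t').deriv] at hd'
      refine hz t' ?_ hd'
      rw [abs_of_neg ht'.2]; rw [abs_of_neg h0] at ht; linarith [ht'.1]
    · obtain ⟨t', ht', hd'⟩ := exists_deriv_eq_zero h0 hc0.continuousOn (by rw [hjt, hj0])
      rw [(hdj s t').deriv] at hd'
      refine hz t' ?_ hd'
      rw [abs_of_pos ht'.1]; rw [abs_of_pos h0] at ht; linarith [ht'.2]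
  have hW : {z : ℝ × ℝ | |z.1| < min δ ρ ∧ |z.2| < ρ} ∈ 𝓝 ((0 : ℝ), (0 : ℝ)) := by
    refine IsOpen.mem_nhds ?_ (by simp [hρ, hδ])
    exact (isOpen_lt continuous_fst.abs continuous_const).inter
      (isOpen_lt continuous_snd.abs continuous_const)
  have hW' := Filter.image_mem_map (m := fun z : ℝ × ℝ => Φ z.1 z.2) hW
  rw [hsm.map_nhds hdet.ne', hΦ0, ← hx] at hW'
  have hev : ∀ᶠ t in 𝓝[≠] t₀, c t ∈ (fun z : ℝ × ℝ => Φ z.1 z.2) ''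
      {z : ℝ × ℝ | |z.1| < min δ ρ ∧ |z.2| < ρ} :=
    nhdsWithin_le_nhds (hc.continuous.continuousAt.eventually_mem hW')
  filter_upwards [hev, hs, self_mem_nhdsWithin] with t ht hst htt
  obtain ⟨⟨t', τ⟩, ⟨ht', hτ⟩, he⟩ := ht
  simp only at ht' hτ he
  have ht'δ := ht'.trans_le (min_le_left _ _)
  have ht'ρ := ht'.trans_le (min_le_right _ _)
  obtain rfl := hcore t' τ ht'ρ hτ (by rw [he, h])
  rw [hΦ0] at he
  refine ⟨t', ht'δ, he.symm, ?_⟩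
  have ht0 : t' ≠ 0 := by
    rintro rfl
    rw [← he, ← hx, sub_self] at hst
    simp at hst
  have h2 := (hbox (y := (t', 0)) (by rw [Prod.dist_eq]; simp [ht'ρ])).2 ht0
  simp only [sub_zero] at h2
  rw [← he, hx] at hst
  set r := inner ℝ X₁ (c₁ t' : E3) - inner ℝ X₁ (c₁ 0 : E3)
  have h3 : 0 < r * t' := by
    rw [mul_assoc] at h2; exact pos_of_mul_pos_right h2 hn₁.le
  have h4 : 0 < (inner ℝ X₁ X * r * (t - t₀)) * (r * t') := mul_pos hst h3
  have h5 : (inner ℝ X₁ X * r * (t - t₀)) * (r * t') = r ^ 2 * (inner ℝ X₁ X * (t - t₀) * t') := by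
    ring
  rw [h5] at h4
  exact pos_of_mul_pos_right h4 (sq_nonneg r)

end

theorem isRegularCurve_shift {c : ℝ → S2} (hc : IsRegularCurve c) (a : ℝ) :
    IsRegularCurve fun t => c (t + a) := by
  refine ⟨hc.1.comp (contDiff_id.add contDiff_const).contMDiff, fun t => ?_⟩
  have : velocity (fun t => c (t + a)) t = velocity c (t + a) :=
    deriv_comp_add_const (fun s => (c s : E3)) a t
  rw [this]
  exact hc.2 _

/-! ### The projection of a regular embedding is a fold map -/

/-- The projection to the plane as a continuous linear map. -/
def projL : E3 →L[ℝ] ℂ := LinearMap.toContinuousLinearMap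
  { toFun := proj
    map_add' := fun x y => by apply Complex.ext <;> simp [proj]
    map_smul' := fun r x => by apply Complex.ext <;> simp [proj] }

/-- At a crease point, where the normal is horizontal, the horizontal direction tangent to the
surface: the normal rotated by a quarter turn. -/
def creaseDir (N : S2 → E3) (p : S2) : ℂ := ⟨-(N p 1), N p 0⟩

section

variable {ε N : S2 → E3}

theorem contMDiff_proj (hε : ContMDiff (𝓡 2) 𝓘(ℝ, E3) ∞ ε) :
    ContMDiff (𝓡 2) 𝓘(ℝ, ℂ) ∞ (proj ∘ ε) :=
  (projL.contDiff.contMDiff (n := ∞)).comp hε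

theorem sphereDeriv_proj (hε : ContMDiff (𝓡 2) 𝓘(ℝ, E3) ∞ ε) (p : S2) (v : E3) :
    sphereDeriv (proj ∘ ε) p v = proj (sphereDeriv ε p v) := by
  have := congrArg (fun L : E3 →L[ℝ] ℂ => L v) (sphereDeriv_comp_clm projL hε p)
  exact this

theorem contMDiff_coord {N : S2 → E3} (hN : ContMDiff (𝓡 2) 𝓘(ℝ, E3) ∞ N) (i : Fin 3) :
    ContMDiff (𝓡 2) 𝓘(ℝ, ℝ) ∞ fun q => N q i :=
  ((contDiff_coord i).contMDiff (n := ∞)).comp hN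

/-- The derivative at an arbitrary vector is the one at a tangent vector. -/
theorem exists_tangent_sphereDeriv_eq {F : Type*} [NormedAddCommGroup F] [NormedSpace ℝ F]
    {g : S2 → F} (hg : ContMDiff (𝓡 2) 𝓘(ℝ, F) ∞ g) (p : S2) (v : E3) :
    ∃ w, sphereDeriv g p v = mfderiv (𝓡 2) 𝓘(ℝ, F) g p w := by
  have h1 : inner ℝ (p : E3) (v - inner ℝ (p : E3) v • (p : E3)) = 0 := by
    rw [inner_sub_right, inner_smul_right, real_inner_self_eq_norm_sq, norm_coe_S2]; ring
  obtain ⟨w, hw⟩ := exists_tangentIncl_eq h1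
  refine ⟨w, ?_⟩
  rw [mfderiv_eq_sphereDeriv hg, hw, map_sub, map_smul, sphereDeriv_self hg, smul_zero, sub_zero]

theorem inner_sphereDeriv_normal (hε : IsSmoothEmbedding ε) (hN : IsGaussMap ε N) (p : S2)
    (v : E3) : inner ℝ (sphereDeriv ε p v) (N p) = 0 := by
  obtain ⟨w, hw⟩ := exists_tangent_sphereDeriv_eq hε.1 p v
  rw [hw]
  exact hN.2.2 p w

theorem eq_zero_of_sphereDeriv_eq_zero (hε : IsSmoothEmbedding ε) {p : S2} {v : E3}
    (hv : inner ℝ (p : E3) v = 0) (h : sphereDeriv ε p v = 0) : v = 0 := by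
  obtain ⟨w, rfl⟩ := exists_tangentIncl_eq hv
  rw [← mfderiv_eq_sphereDeriv hε.1] at h
  have : w = 0 := hε.2.2 p (h.trans (map_zero _).symm)
  rw [this, map_zero]

theorem cross_eq_det3_smul {n a b : E3} (hn : ‖n‖ = 1) (ha : inner ℝ a n = 0)
    (hb : inner ℝ b n = 0) : cross a b = det3 n a b • n := by
  have h1 := real_inner_self_eq_norm_sq n
  rw [hn, inner_eq_sum] at h1
  rw [inner_eq_sum] at ha hb
  apply ext_E3
  · simp only [cross_zero, det3, PiLp.smul_apply, smul_eq_mul]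
    linear_combination (-(a 1 * b 2 - a 2 * b 1)) * h1 - (a 2 * n 1 - a 1 * n 2) * hb +
      (b 2 * n 1 - b 1 * n 2) * ha
  · simp only [cross_one, det3, PiLp.smul_apply, smul_eq_mul]
    linear_combination (-(a 2 * b 0 - a 0 * b 2)) * h1 - (a 0 * n 2 - a 2 * n 0) * hb +
      (b 0 * n 2 - b 2 * n 0) * ha
  · simp only [cross_two, det3, PiLp.smul_apply, smul_eq_mul]
    linear_combination (-(a 0 * b 1 - a 1 * b 0)) * h1 - (a 1 * n 0 - a 0 * n 1) * hb +
      (b 1 * n 0 - b 0 * n 1) * ha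

/-- The area distortion of the embedding, with the sign comparing the orientation of the sphere
with the one given by the normal. -/
def areaFactor (ε N : S2 → E3) (p : S2) : ℝ :=
  altCoeff (fun v w => det3 (N p) (sphereDeriv ε p v) (sphereDeriv ε p w)) p

/-- The oriented area, with respect to the normal, of the image of a parallelogram. -/
theorem det3_normal_eq (hε : IsSmoothEmbedding ε) (N : S2 → E3) (p : S2) (v w : E3) :
    det3 (N p) (sphereDeriv ε p v) (sphereDeriv ε p w) = det3 p v w * areaFactor ε N p := by
  let B : E3 →ₗ[ℝ] E3 →ₗ[ℝ] ℝ := LinearMap.mk₂ ℝ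
    (fun v w => det3 (N p) (sphereDeriv ε p v) (sphereDeriv ε p w))
    (by intro a b c; simp only [det3, map_add, PiLp.add_apply]; ring)
    (by intro r a b; simp only [det3, map_smul, PiLp.smul_apply, smul_eq_mul]; ring)
    (by intro a b c; simp only [det3, map_add, PiLp.add_apply]; ring)
    (by intro r a b; simp only [det3, map_smul, PiLp.smul_apply, smul_eq_mul]; ring)
  exact alt_eq_det3_smul B (fun v => by simp only [B, LinearMap.mk₂_apply, det3]; ring)
    (fun v => by
      simp only [B, LinearMap.mk₂_apply, det3, sphereDeriv_self hε.1 p, PiLp.zero_apply]; ring) v w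

theorem continuous_areaFactor (hε : IsSmoothEmbedding ε) (hN : IsGaussMap ε N) :
    Continuous (areaFactor ε N) := by
  have hc : ∀ i, Continuous fun p : S2 => (p : E3) i :=
    fun i => (continuous_coord i).comp continuous_subtype_val
  have hE : ∀ v, Continuous fun p => sphereDeriv ε p v := fun v =>
    (continuous_sphereDeriv hε.1).clm_apply continuous_const
  have hf : ∀ v w, Continuous fun p => det3 (N p) (sphereDeriv ε p v) (sphereDeriv ε p w) :=
    fun v w => continuous_det3 hN.1.continuous (hE v) (hE w)
  exact (((hc 0).smul (hf _ _)).add ((hc 1).smul (hf _ _))).add ((hc 2).smul (hf _ _))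

theorem areaFactor_ne_zero (hε : IsSmoothEmbedding ε) (hN : IsGaussMap ε N) (p : S2) :
    areaFactor ε N p ≠ 0 := by
  intro h0
  obtain ⟨v, hv, hv0⟩ := exists_tangent p
  set w := cross p v with hw
  have hwt : inner ℝ (p : E3) w = 0 := inner_cross_self p v
  set a := sphereDeriv ε p v with ha
  set b := sphereDeriv ε p w with hb
  have h1 : cross a b = 0 := by
    rw [cross_eq_det3_smul (hN.2.1 p) (inner_sphereDeriv_normal hε hN p v)
      (inner_sphereDeriv_normal hε hN p w), det3_normal_eq hε, h0, mul_zero, zero_smul]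
  have h2 : inner ℝ a a • b - inner ℝ a b • a = 0 := by
    have e0 := congrArg (fun x : E3 => x 0) h1
    have e1 := congrArg (fun x : E3 => x 1) h1
    have e2 := congrArg (fun x : E3 => x 2) h1
    simp only [cross_zero, cross_one, cross_two, PiLp.zero_apply] at e0 e1 e2
    apply ext_E3 <;> simp only [PiLp.sub_apply, PiLp.smul_apply, smul_eq_mul, inner_eq_sum,
      PiLp.zero_apply]
    · linear_combination (-(a 1)) * e2 + a 2 * e1
    · linear_combination a 0 * e2 - a 2 * e0
    · linear_combination (-(a 0)) * e1 + a 1 * e0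
  rw [hb, ha, ← map_smul, ← map_smul, ← map_sub, ← ha, ← hb] at h2
  have h3 := eq_zero_of_sphereDeriv_eq_zero hε (by
    rw [inner_sub_right, inner_smul_right, inner_smul_right, hwt, hv]; ring) h2
  have h4 : det3 p v (inner ℝ a a • w - inner ℝ a b • v) = det3 p v 0 := by rw [h3]
  have h5 : det3 p v (inner ℝ a a • w - inner ℝ a b • v) = inner ℝ a a * det3 p v w := by
    simp only [det3, PiLp.sub_apply, PiLp.smul_apply, smul_eq_mul]; ring
  rw [h5, det3_self_cross p v hv] at h4
  simp only [det3, PiLp.zero_apply, mul_zero, sub_zero, add_zero, mul_eq_zero] at h4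
  rcases h4 with h4 | h4
  · exact hv0 (eq_zero_of_sphereDeriv_eq_zero hε hv (inner_self_eq_zero.1 h4))
  · exact hv0 (by simpa using h4)

/-- The Jacobian of the projection is the vertical component of the normal, up to a nonvanishing
factor; so transversality of the Gauss map to the equator means that it vanishes to first order. -/
theorem jac_eq (hε : IsSmoothEmbedding ε) (hN : IsGaussMap ε N) (p : S2) :
    jac (proj ∘ ε) p = areaFactor ε N p * N p 2 := by
  obtain ⟨v, hv, hv0⟩ := exists_tangent p
  have h1 := area_sphereDeriv (contMDiff_proj hε.1) p v (cross p v)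
  have h2 := congrArg (fun x : E3 => x 2) (cross_eq_det3_smul (hN.2.1 p)
    (inner_sphereDeriv_normal hε hN p v) (inner_sphereDeriv_normal hε hN p (cross p v)))
  rw [det3_normal_eq hε] at h2
  simp only [cross_two, PiLp.smul_apply, smul_eq_mul] at h2
  rw [sphereDeriv_proj hε.1, sphereDeriv_proj hε.1] at h1
  simp only [area, proj] at h1
  rw [h2, det3_self_cross p v hv] at h1
  have h3 : ‖v‖ ^ 2 ≠ 0 := by simpa using hv0
  apply mul_right_cancel₀ h3
  linarith

/-- The critical points of the projection are the zeros of its Jacobian. -/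
theorem mem_creaseSet_iff (hε : IsSmoothEmbedding ε) (p : S2) :
    p ∈ creaseSet ε ↔ jac (proj ∘ ε) p = 0 := by
  have hf := contMDiff_proj hε.1
  have hL := mfderiv_eq_sphereDeriv hf p
  constructor
  · intro h
    by_contra h0
    refine h fun ζ => ?_
    obtain ⟨v, hv, hv0⟩ := exists_tangent p
    set w := cross p v with hw
    have h1 := area_sphereDeriv hf p v w
    rw [det3_self_cross p v hv] at h1
    set a := sphereDeriv (proj ∘ ε) p v
    set b := sphereDeriv (proj ∘ ε) p w
    have hab : area a b ≠ 0 := by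
      rw [h1]; exact mul_ne_zero h0 (by simpa using hv0)
    obtain ⟨x, hx⟩ := exists_tangentIncl_eq
      (show inner ℝ (p : E3) ((area ζ b / area a b) • v + (area a ζ / area a b) • w) = 0 by
        rw [inner_add_right, inner_smul_right, inner_smul_right, hv, inner_cross_self]; ring)
    refine ⟨x, ?_⟩
    rw [hL, hx, map_add, map_smul, map_smul]
    change (area ζ b / area a b) • a + (area a ζ / area a b) • b = ζ
    apply Complex.ext
    · simp only [Complex.add_re, Complex.smul_re, smul_eq_mul]
      field_simp
      simp only [area]; ring
    · simp only [Complex.add_im, Complex.smul_im, smul_eq_mul]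
      field_simp
      simp only [area]; ring
  · intro h0 hs
    obtain ⟨x, hx⟩ := hs (1 : ℂ)
    obtain ⟨y, hy⟩ := hs Complex.I
    rw [hL] at hx hy
    have h1 := area_sphereDeriv hf p (tangentIncl p x) (tangentIncl p y)
    rw [h0, hx, hy] at h1
    have h2 : area 1 Complex.I = 1 := by simp [area]
    erw [h2] at h1
    simp at h1

theorem dVertNormal_eq (hN : IsGaussMap ε N) (p : S2) (v : TangentSpace (𝓡 2) p) :
    dVertNormal N p v = sphereDeriv (fun q => N q 2) p (tangentIncl p v) :=
  mfderiv_eq_sphereDeriv (contMDiff_coord hN.1 2) p v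

/-- The Gauss map is unique up to sign. -/
theorem IsGaussMap.eq_or_eq_neg {N' : S2 → E3} (hε : IsSmoothEmbedding ε) (hN : IsGaussMap ε N)
    (hN' : IsGaussMap ε N') : (∀ p, N' p = N p) ∨ ∀ p, N' p = -N p := by
  have h1 : ∀ p, N' p = N p ∨ N' p = -N p := by
    intro p
    obtain ⟨v, hv, hv0⟩ := exists_tangent p
    set a := sphereDeriv ε p v
    set b := sphereDeriv ε p (cross p v)
    have e1 : cross a b = det3 (N p) a b • N p := cross_eq_det3_smul (hN.2.1 p)
      (inner_sphereDeriv_normal hε hN p v) (inner_sphereDeriv_normal hε hN p _)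
    have e2 : cross a b = det3 (N' p) a b • N' p := cross_eq_det3_smul (hN'.2.1 p)
      (inner_sphereDeriv_normal hε hN' p v) (inner_sphereDeriv_normal hε hN' p _)
    have h3 : ‖v‖ ^ 2 ≠ 0 := by simpa using hv0
    have d1 : det3 (N p) a b ≠ 0 := by
      rw [det3_normal_eq hε, det3_self_cross p v hv]
      exact mul_ne_zero h3 (areaFactor_ne_zero hε hN p)
    have d2 : det3 (N' p) a b ≠ 0 := by
      rw [det3_normal_eq hε, det3_self_cross p v hv]
      exact mul_ne_zero h3 (areaFactor_ne_zero hε hN' p)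
    rw [e1] at e2
    have e3 := congrArg norm e2
    rw [norm_smul, norm_smul, hN.2.1, hN'.2.1, mul_one, mul_one, Real.norm_eq_abs,
      Real.norm_eq_abs, abs_eq_abs] at e3
    rcases e3 with e3 | e3
    · rw [e3] at e2
      exact Or.inl (smul_right_injective E3 d2 e2).symm
    · rw [e3, neg_smul] at e2
      refine Or.inr ?_
      have e4 : det3 (N' p) a b • N p = det3 (N' p) a b • -N' p := by rw [smul_neg, ← e2, neg_neg]
      rw [smul_right_injective E3 d2 e4, neg_neg]
  have hc : ContinuousOn (fun p => inner ℝ (N' p) (N p)) univ :=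
    (hN'.1.continuous.inner hN.1.continuous).continuousOn
  have hv : ∀ p, inner ℝ (N' p) (N p) = 1 ∧ N' p = N p ∨
      inner ℝ (N' p) (N p) = -1 ∧ N' p = -N p := by
    intro p
    rcases h1 p with h | h
    · left; refine ⟨?_, h⟩; rw [h, real_inner_self_eq_norm_sq, hN.2.1]; norm_num
    · right; refine ⟨?_, h⟩; rw [h, inner_neg_left, real_inner_self_eq_norm_sq, hN.2.1]; norm_num
  by_contra! hcon
  obtain ⟨⟨p, hp⟩, q, hq⟩ := hcon
  have hp' := (hv p).resolve_left fun h => hp h.2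
  have hq' := (hv q).resolve_right fun h => hq h.2
  obtain ⟨x, -, hx⟩ := isPreconnected_univ.intermediate_value (mem_univ p) (mem_univ q) hc
    (show (0 : ℝ) ∈ Icc _ _ by rw [hp'.1, hq'.1]; constructor <;> norm_num)
  simp only at hx
  rcases hv x with h | h <;> rw [h.1] at hx <;> norm_num at hx

theorem creaseDir_sq {p : S2} (hN1 : ‖N p‖ = 1) (h2 : N p 2 = 0) :
    N p 0 ^ 2 + N p 1 ^ 2 = 1 := by
  have h1 := real_inner_self_eq_norm_sq (N p)
  rw [hN1, inner_eq_sum, h2] at h1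
  linarith

theorem creaseDir_ne_zero {p : S2} (hN1 : ‖N p‖ = 1) (h2 : N p 2 = 0) : creaseDir N p ≠ 0 := by
  intro h
  have h0 := congrArg Complex.re h
  have h1 := congrArg Complex.im h
  simp only [creaseDir, Complex.zero_re, Complex.zero_im] at h0 h1
  have := creaseDir_sq hN1 h2
  rw [neg_eq_zero.1 h0, h1] at this
  norm_num at this

theorem proj_eq_smul_creaseDir {p : S2} (hN1 : ‖N p‖ = 1) (h2 : N p 2 = 0) {x : E3}
    (hx : inner ℝ x (N p) = 0) : proj x = (N p 0 * x 1 - N p 1 * x 0) • creaseDir N p := by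
  have h1 := creaseDir_sq hN1 h2
  rw [inner_eq_sum, h2] at hx
  apply Complex.ext
  · simp only [proj, creaseDir, Complex.smul_re, smul_eq_mul]
    linear_combination (-(x 0)) * h1 + N p 0 * hx
  · simp only [proj, creaseDir, Complex.smul_im, smul_eq_mul]
    linear_combination (-(x 1)) * h1 + N p 1 * hx

theorem foldForm_proj (hε : IsSmoothEmbedding ε) (hN : IsGaussMap ε N) {p : S2} (h2 : N p 2 = 0)
    (v : E3) : foldForm (proj ∘ ε) (creaseDir N) p v =
      N p 0 * sphereDeriv ε p v 1 - N p 1 * sphereDeriv ε p v 0 := by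
  rw [foldForm, sphereDeriv_proj hε.1, proj_eq_smul_creaseDir (hN.2.1 p) h2
    (inner_sphereDeriv_normal hε hN p v), Complex.real_smul, mul_div_assoc,
    div_self (creaseDir_ne_zero (hN.2.1 p) h2), mul_one, Complex.ofReal_re]

/-- The folding sign at a crease point determines the direction of the projected crease: if `v` is
the tangent vector mapped to the vertical vector, and `X` is tangent to the crease, then
`dN₂(v)` and the velocity of the projected crease have the same sign, up to a factor which is
continuous and nonzero along the crease. -/
theorem foldForm_mul_eq (hε : IsSmoothEmbedding ε) (hN : IsGaussMap ε N) {p : S2} (h2 : N p 2 = 0)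
    {X : E3} (hX : inner ℝ (p : E3) X = 0) (hjX : sphereDeriv (fun q => N q 2) p X = 0)
    {v : TangentSpace (𝓡 2) p} (hv : mfderiv (𝓡 2) 𝓘(ℝ, E3) ε p v = vert) :
    foldForm (proj ∘ ε) (creaseDir N) p X *
        (areaFactor ε N p * sphereDeriv (fun q => N q 2) p (cross p X)) =
      areaFactor ε N p ^ 2 * ‖X‖ ^ 2 * dVertNormal N p v := by
  rw [mfderiv_eq_sphereDeriv hε.1] at hv
  rw [dVertNormal_eq hN, foldForm_proj hε hN h2]
  set w := tangentIncl p v with hw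
  have hwt : inner ℝ (p : E3) w = 0 := inner_tangentIncl p v
  have e1 := congrArg (sphereDeriv (fun q => N q 2) p) (eq_comb_of_tangent hX hwt)
  simp only [map_add, map_smul, hjX, smul_eq_mul] at e1
  have e2 := det3_normal_eq hε N p X w
  rw [hv] at e2
  have e3 : det3 (N p) (sphereDeriv ε p X) vert =
      N p 0 * sphereDeriv ε p X 1 - N p 1 * sphereDeriv ε p X 0 := by
    simp [det3, vert]; ring
  rw [e3] at e2
  rw [e2]
  linear_combination (-(areaFactor ε N p ^ 2)) * e1

end

/-- The projection of a regular embedding realizing `C` is a fold map. -/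
theorem CurvesWithCorners.IsRealizedBy.isFoldMap {C : CurvesWithCorners} {ε : S2 → E3}
    (h : C.IsRealizedBy ε) : ∃ u, IsFoldMap C (proj ∘ ε) u := by
  obtain ⟨N, hN, htr⟩ := h.regular.transverse
  have hε := h.regular.embedding
  have hf := contMDiff_proj hε.1
  have hj := contMDiff_coord hN.1 2
  have hcr : ∀ p, p ∈ ⋃₀ C.curves ↔ N p 2 = 0 := by
    intro p
    rw [← h.creaseSet_eq, mem_creaseSet_iff hε, jac_eq hε hN, mul_eq_zero,
      or_iff_right (areaFactor_ne_zero hε hN p)]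
  have htr' : ∀ p ∈ ⋃₀ C.curves, ∃ v, sphereDeriv (fun q => N q 2) p v ≠ 0 := by
    intro p hp
    obtain ⟨v, hv⟩ := htr p ((hcr p).1 hp)
    rw [dVertNormal_eq hN] at hv
    exact ⟨_, hv⟩
  have hdir : ∀ p ∈ ⋃₀ C.curves, creaseDir N p ≠ 0 := fun p hp =>
    creaseDir_ne_zero (hN.2.1 p) ((hcr p).1 hp)
  have heq : ∀ p ∈ ⋃₀ C.curves, ∀ v, sphereDeriv (proj ∘ ε) p v =
      foldForm (proj ∘ ε) (creaseDir N) p v • creaseDir N p := by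
    intro p hp v
    rw [foldForm_proj hε hN ((hcr p).1 hp), sphereDeriv_proj hε.1]
    exact proj_eq_smul_creaseDir (hN.2.1 p) ((hcr p).1 hp) (inner_sphereDeriv_normal hε hN p v)
  refine ⟨creaseDir N, hf, ?_, ?_, ?_, hdir, heq, ?_, ?_, ?_, ?_⟩
  · have h0 := (continuous_coord 0).comp hN.1.continuous
    have h1 := (continuous_coord 1).comp hN.1.continuous
    have : creaseDir N = fun p => ((-(N p 1) : ℝ) : ℂ) + ((N p 0 : ℝ) : ℂ) * Complex.I := by
      funext p; apply Complex.ext <;> simp [creaseDir]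
    rw [this]
    exact (Complex.continuous_ofReal.comp h1.neg).add
      ((Complex.continuous_ofReal.comp h0).mul continuous_const)
  · intro p hp h0
    rw [← h.creaseSet_eq] at hp
    exact hp ((mem_creaseSet_iff hε p).2 h0)
  · exact ⟨fun q => N q 2, areaFactor ε N, hj, continuous_areaFactor hε hN,
      areaFactor_ne_zero hε hN, jac_eq hε hN, fun p hp => (hcr p).1 hp, htr'⟩
  · intro p hp
    by_contra! hcon
    obtain ⟨v, hv, hv0⟩ := exists_tangent p
    have e1 := det3_normal_eq hε N p v (cross p v)
    rw [det3_self_cross p v hv] at e1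
    have e2 := hcon v
    have e3 := hcon (cross p v)
    have h2 := (hcr p).1 hp
    rw [foldForm_proj hε hN h2] at e2 e3
    have e4 : det3 (N p) (sphereDeriv ε p v) (sphereDeriv ε p (cross p v)) = 0 := by
      rw [det3, h2]
      linear_combination sphereDeriv ε p (cross p v) 2 * e2 - sphereDeriv ε p v 2 * e3
    rw [e4] at e1
    have h3 : ‖v‖ ^ 2 ≠ 0 := by simpa using hv0
    exact mul_ne_zero h3 (areaFactor_ne_zero hε hN p) e1.symm
  · intro c hc hcC t ht h0
    refine ht ((h.mem_corners_iff _).2 (h.regular.corner_of_rankZero _ ?_))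
    refine ⟨fun s => c (s + t), ⟨isRegularCurve_shift hc t, fun s => ?_⟩, by simp, ?_⟩
    · rw [h.creaseSet_eq]; exact hcC _
    · have h1 := hasDerivAt_comp_curve hf ((isRegularCurve_shift hc t).hasDerivAt 0)
      refine (h1.deriv).trans ?_
      have hv : velocity (fun s => c (s + t)) 0 = velocity c t := by
        have := deriv_comp_add_const (fun s => (c s : E3)) t 0
        rw [zero_add] at this
        exact this
      rw [hv]
      simp only [zero_add]
      rw [heq _ (hcC t), h0, zero_smul]
  · intro c hc hcC t₀ ht₀
    obtain ⟨N', c₁, hN', ⟨hc₁, hc₁C⟩, hx, δ, hδ, hneg, hpos⟩ := (h.mem_corners_iff _).1 ht₀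
    rw [h.creaseSet_eq] at hc₁C
    -- the folding signs with respect to `N` along `c₁` are those with respect to `N'`, up to `a`
    obtain ⟨a, ha0, hfold⟩ : ∃ a : ℝ, a ≠ 0 ∧ ∀ t, |t| < δ → t ≠ 0 →
        ∃ v : TangentSpace (𝓡 2) (c₁ t), mfderiv (𝓡 2) 𝓘(ℝ, E3) ε (c₁ t) v = vert ∧
          0 < a * t * dVertNormal N (c₁ t) v := by
      have hsgn : ∀ t, |t| < δ → t ≠ 0 →
          ∃ v : TangentSpace (𝓡 2) (c₁ t), mfderiv (𝓡 2) 𝓘(ℝ, E3) ε (c₁ t) v = vert ∧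
            0 < t * dVertNormal N' (c₁ t) v := by
        intro t ht ht0
        rcases lt_or_gt_of_ne ht0 with h0 | h0
        · obtain ⟨v, hv, hv'⟩ := hneg t ⟨by linarith [(abs_lt.1 ht).1], h0⟩
          exact ⟨v, hv, mul_pos_of_neg_of_neg h0 hv'⟩
        · obtain ⟨v, hv, hv'⟩ := hpos t ⟨h0, (abs_lt.1 ht).2⟩
          exact ⟨v, hv, mul_pos h0 hv'⟩
      rcases hN.eq_or_eq_neg hε hN' with hNN | hNN
      · refine ⟨1, one_ne_zero, fun t ht ht0 => ?_⟩
        obtain ⟨v, hv, hv'⟩ := hsgn t ht ht0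
        refine ⟨v, hv, ?_⟩
        have : N' = N := funext hNN
        rw [this] at hv'
        rwa [one_mul]
      · refine ⟨-1, by norm_num, fun t ht ht0 => ?_⟩
        obtain ⟨v, hv, hv'⟩ := hsgn t ht ht0
        refine ⟨v, hv, ?_⟩
        have e1 : dVertNormal N' (c₁ t) v = -dVertNormal N (c₁ t) v := by
          rw [dVertNormal_eq hN', dVertNormal_eq hN]
          have e2 := congrArg (fun L : E3 →L[ℝ] ℝ => L (tangentIncl (c₁ t) v))
            (sphereDeriv_comp_clm (-ContinuousLinearMap.id ℝ ℝ) hj (c₁ t))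
          have e3 : (fun q => N' q 2) = fun q => (-ContinuousLinearMap.id ℝ ℝ) (N q 2) := by
            funext q; simp [hNN q]
          rw [e3]
          simpa using e2
        rw [e1] at hv'
        linarith
    have hjc : ∀ t, N (c t) 2 = 0 := fun t => (hcr _).1 (hcC t)
    obtain ⟨s, hs0, hs⟩ := exists_param_transfer hj hc hc₁ hjc
      (fun t => (hcr _).1 (hc₁C t)) hx.symm (htr' _ (hc₁C 0))
    let κ : ℝ → ℝ := fun t =>
      areaFactor ε N (c t) * sphereDeriv (fun q => N q 2) (c t) (cross (c t) (velocity c t))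
    have hκc : Continuous κ := by
      refine ((continuous_areaFactor hε hN).comp hc.continuous).mul ?_
      refine ((continuous_sphereDeriv hj).comp hc.continuous).clm_apply ?_
      exact (contDiff_cross hc.contDiff hc.contDiff_velocity).continuous
    have htan : ∀ t, inner ℝ (c t : E3) (velocity c t) = 0 := fun t =>
      inner_velocity (hc.hasDerivAt t)
    have hjv : ∀ t, sphereDeriv (fun q => N q 2) (c t) (velocity c t) = 0 :=
      sphereDeriv_velocity_eq_zero hj hc hjc
    have hκ0 : κ t₀ ≠ 0 := mul_ne_zero (areaFactor_ne_zero hε hN _)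
      (sphereDeriv_cross_ne_zero hj (htan t₀) (hc.2 t₀) (hjv t₀) (htr' _ (hcC t₀)))
    have hκev : ∀ᶠ t in 𝓝[≠] t₀, 0 < κ t₀ * κ t := by
      refine nhdsWithin_le_nhds ?_
      refine (continuousAt_const.mul hκc.continuousAt).eventually (lt_mem_nhds ?_)
      simp only
      exact mul_self_pos.2 hκ0
    refine ⟨a * s * κ t₀, ?_⟩
    filter_upwards [hs δ hδ, hκev] with t ht hκt
    obtain ⟨t', ht', hct, hpos'⟩ := ht
    have ht'0 : t' ≠ 0 := by rintro rfl; simp at hpos'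
    obtain ⟨v, hv, hv'⟩ : ∃ v : TangentSpace (𝓡 2) (c t), mfderiv (𝓡 2) 𝓘(ℝ, E3) ε (c t) v = vert ∧
        0 < a * t' * dVertNormal N (c t) v := by
      rw [hct]; exact hfold t' ht' ht'0
    have e1 := foldForm_mul_eq hε hN (hjc t) (htan t) (hjv t) hv
    set F := foldForm (proj ∘ ε) (creaseDir N) (c t) (velocity c t)
    set d := dVertNormal N (c t) v
    change F * κ t = _ at e1
    have hpos2 : 0 < areaFactor ε N (c t) ^ 2 * ‖velocity c t‖ ^ 2 := by
      have := areaFactor_ne_zero hε hN (c t)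
      have := norm_pos_iff.2 (hc.2 t)
      positivity
    set m := areaFactor ε N (c t) ^ 2 * ‖velocity c t‖ ^ 2
    -- multiply the positive quantities and remove the squares
    have e2 : 0 < (s * (t - t₀) * t') * (a * t' * d) * m * (κ t₀ * κ t) :=
      mul_pos (mul_pos (mul_pos hpos' hv') hpos2) hκt
    have e3 : (s * (t - t₀) * t') * (a * t' * d) * m * (κ t₀ * κ t) =
        (t' * κ t) ^ 2 * (a * s * κ t₀ * (t - t₀) * F) := by
      linear_combination (-(s * (t - t₀) * t' * a * t' * (κ t₀ * κ t))) * e1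
    rw [e3] at e2
    exact pos_of_mul_pos_right e2 (sq_nonneg _)
  · intro x hx
    exact h.convex x hx

/-! ### Fold maps near a curve -/

/-- A continuous function without zeros has a constant sign on preconnected sets. -/
theorem mul_pos_of_isPreconnected {X : Type*} [TopologicalSpace X] {S : Set X}
    (hS : IsPreconnected S) {g : X → ℝ} (hg : ContinuousOn g S) (h0 : ∀ x ∈ S, g x ≠ 0) {x y : X}
    (hx : x ∈ S) (hy : y ∈ S) : 0 < g x * g y := by
  by_contra hcon
  have hne := mul_ne_zero (h0 x hx) (h0 y hy)
  have hneg : g x * g y < 0 := lt_of_le_of_ne (not_lt.1 hcon) hne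
  rcases mul_neg_iff.1 hneg with ⟨h1, h2⟩ | ⟨h1, h2⟩
  · obtain ⟨z, hz, hgz⟩ := hS.intermediate_value hy hx hg
      (show (0 : ℝ) ∈ Icc _ _ from ⟨h2.le, h1.le⟩)
    exact h0 z hz hgz
  · obtain ⟨z, hz, hgz⟩ := hS.intermediate_value hx hy hg
      (show (0 : ℝ) ∈ Icc _ _ from ⟨h1.le, h2.le⟩)
    exact h0 z hz hgz

theorem exists_mem_Ioo_of_eventually {p : ℝ → Prop} (h : ∀ᶠ t in 𝓝[≠] (0 : ℝ), p t) {δ : ℝ}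
    (hδ : 0 < δ) : (∃ t ∈ Ioo 0 δ, p t) ∧ ∃ t ∈ Ioo (-δ) 0, p t := by
  constructor
  · have h1 : ∀ᶠ t in 𝓝[>] (0 : ℝ), p t := nhdsWithin_mono _ (fun t ht => ne_of_gt ht) h
    obtain ⟨t, ht, hp⟩ := (h1.and (Ioo_mem_nhdsGT hδ)).exists
    exact ⟨t, hp, ht⟩
  · have h1 : ∀ᶠ t in 𝓝[<] (0 : ℝ), p t := nhdsWithin_mono _ (fun t ht => ne_of_lt ht) h
    obtain ⟨t, ht, hp⟩ := (h1.and (Ioo_mem_nhdsLT (by linarith : -δ < 0))).exists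
    exact ⟨t, hp, ht⟩

namespace IsSmoothStrip

variable {F : Type*} [NormedAddCommGroup F] [NormedSpace ℝ F] {g : S2 → F} {Φ : ℝ → ℝ → S2}

theorem contDiff_comp (h : IsSmoothStrip Φ) (hg : ContMDiff (𝓡 2) 𝓘(ℝ, F) ∞ g) :
    ContDiff ℝ ∞ fun z : ℝ × ℝ => g (Φ z.1 z.2) := by
  have h1 : (fun z : ℝ × ℝ => g (Φ z.1 z.2)) =
      radialExt g ∘ fun z : ℝ × ℝ => (Φ z.1 z.2 : E3) := by
    funext z; simp [radialExt_coe]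
  rw [h1, contDiff_iff_contDiffAt]
  exact fun z => (contDiffAt_radialExt hg (coe_S2_ne_zero _)).comp z (ContDiff.contDiffAt h)

end IsSmoothStrip

namespace CurvesWithCorners

variable {C : CurvesWithCorners}

theorem region_eq_of_mem {R R' : Set S2} (hR : R ∈ C.regions) (hR' : R' ∈ C.regions) {x : S2}
    (hx : x ∈ R) (hx' : x ∈ R') : R = R' := by
  obtain ⟨p, hp, rfl⟩ := hR
  obtain ⟨q, hq, rfl⟩ := hR'
  rw [connectedComponentIn_eq hx, connectedComponentIn_eq hx']

theorem notMem_of_mem_region {R : Set S2} (hR : R ∈ C.regions) {x : S2} (hx : x ∈ R) :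
    x ∉ ⋃₀ C.curves := by
  obtain ⟨p, hp, rfl⟩ := hR
  exact connectedComponentIn_subset _ _ hx

theorem isPreconnected_region {R : Set S2} (hR : R ∈ C.regions) : IsPreconnected R := by
  obtain ⟨p, hp, rfl⟩ := hR
  exact isPreconnected_connectedComponentIn

/-- A region whose closure meets `γ` contains one of the two halves of a collar of `γ`. -/
theorem exists_half_subset {γ : Set S2} (hγ : γ ∈ C.curves) (K : Collar γ (C.others γ))
    {R : Set S2} (hR : R ∈ C.regions) {x : S2} (hxγ : x ∈ γ) (hx : x ∈ closure R) :
    ∃ h : ℝ, (h = 1 ∨ h = -1) ∧ ∀ s t, 0 < h * t → |t| < K.δ → K.Φ s t ∈ R := by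
  have hopen : IsOpen (K.part (Ioo (-K.δ) K.δ)) := K.isOpen_part isOpen_Ioo fun t ht => abs_lt.2 ht
  have hxU : x ∈ K.part (Ioo (-K.δ) K.δ) := by
    obtain ⟨s, rfl⟩ := K.core.symm.subset hxγ
    exact K.mem_part ⟨by linarith [K.δ_pos], K.δ_pos⟩
  obtain ⟨_, ⟨⟨s, t⟩, ⟨-, ht⟩, rfl⟩, hyR⟩ := mem_closure_iff.1 hx _ hopen hxU
  have htδ : |t| < K.δ := abs_lt.2 ht
  have ht0 : t ≠ 0 := fun h0 =>
    notMem_of_mem_region hR hyR ((collar_mem_iff hγ K htδ).2 h0)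
  rcases lt_or_gt_of_ne ht0 with h0 | h0
  · refine ⟨-1, Or.inr rfl, fun s' t' ht' htδ' => ?_⟩
    obtain ⟨R', hR', hsub, -⟩ := exists_region_of_part hγ K (T := Ioo (-K.δ) 0) isPreconnected_Ioo
      (fun t ht => by rw [abs_of_neg ht.2]; linarith [ht.1]) (by simp)
      (by rw [closure_Ioo (by linarith [K.δ_pos] : -K.δ ≠ 0)]; simp [K.δ_pos.le])
    rw [region_eq_of_mem hR hR' hyR (hsub (K.mem_part ⟨ht.1, h0⟩))]
    exact hsub (K.mem_part ⟨by linarith [(abs_lt.1 htδ').1], by linarith⟩)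
  · refine ⟨1, Or.inl rfl, fun s' t' ht' htδ' => ?_⟩
    obtain ⟨R', hR', hsub, -⟩ := exists_region_of_part hγ K (T := Ioo 0 K.δ) isPreconnected_Ioo
      (fun t ht => by rw [abs_of_pos ht.1]; exact ht.2) (by simp)
      (by rw [closure_Ioo (by linarith [K.δ_pos] : (0 : ℝ) ≠ K.δ)]; simp [K.δ_pos.le])
    rw [region_eq_of_mem hR hR' hyR (hsub (K.mem_part ⟨h0, ht.2⟩))]
    exact hsub (K.mem_part ⟨by linarith, (abs_lt.1 htδ').2⟩)

end CurvesWithCorners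

namespace IsFoldMap

open CurvesWithCorners

variable {C : CurvesWithCorners} {γ : Set S2} {f u : S2 → ℂ}

theorem core_mem (hγ : γ ∈ C.curves) (K : Collar γ (C.others γ)) (s : ℝ) :
    K.Φ s 0 ∈ ⋃₀ C.curves := ⟨γ, hγ, K.core.subset ⟨s, rfl⟩⟩

/-- The Jacobian changes its sign across the curves. -/
theorem exists_jac_sign (hF : IsFoldMap C f u) (hγ : γ ∈ C.curves) (K : Collar γ (C.others γ)) :
    ∃ η : ℝ, η ≠ 0 ∧ ∀ s t, |t| < K.δ → t ≠ 0 → 0 < η * t * jac f (K.Φ s t) := by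
  obtain ⟨j, lam, hj, hlam, hlam0, hjac, hj0, htr⟩ := hF.exists_transverse
  have hcore := core_mem hγ K
  set d := sphereDeriv j (K.Φ 0 0) (dSnd K.Φ 0 0) with hd
  have hd0 : d ≠ 0 := by
    intro h0
    obtain ⟨v, hv⟩ := htr _ (hcore 0)
    exact hv (map_eq_zero_of_det3_ne_zero (sphereDeriv j (K.Φ 0 0) : E3 →ₗ[ℝ] ℝ)
      (show det3 (K.Φ 0 0) (dFst K.Φ 0 0) (dSnd K.Φ 0 0) ≠ 0 from
        (K.det_pos 0 0 (by simpa using K.δ_pos)).ne') (sphereDeriv_self hj _)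
      (sphereDeriv_velocity_eq_zero hj K.regular (fun t => hj0 _ (hcore t)) 0) h0 v)
  have h1 := eventually_mul_pos_of_hasDerivAt
    (hasDerivAt_comp_curve hj (K.smooth.hasDerivAt_snd 0 0)) hd0
  have h2 : ∀ᶠ t in 𝓝[≠] (0 : ℝ), 0 < lam (K.Φ 0 0) * lam (K.Φ 0 t) := by
    refine nhdsWithin_le_nhds ?_
    have hc : Continuous fun t => lam (K.Φ 0 0) * lam (K.Φ 0 t) :=
      continuous_const.mul (hlam.comp (K.smooth.continuous.comp (Continuous.prodMk_right (0 : ℝ))))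
    exact hc.continuousAt.eventually (lt_mem_nhds (mul_self_pos.2 (hlam0 _)))
  have h3 : ∀ᶠ t in 𝓝[≠] (0 : ℝ), 0 < (d * lam (K.Φ 0 0)) * t * jac f (K.Φ 0 t) := by
    filter_upwards [h1, h2] with t ht1 ht2
    rw [hj0 _ (hcore 0), sub_zero, sub_zero] at ht1
    rw [hjac]
    have := mul_pos ht1 ht2
    calc 0 < _ := this
      _ = _ := by ring
  obtain ⟨⟨a, ha, hpa⟩, b, hb, hpb⟩ := exists_mem_Ioo_of_eventually h3 K.δ_pos
  have hcont : Continuous fun z : ℝ × ℝ => jac f (K.Φ z.1 z.2) :=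
    (continuous_jac hF.smooth).comp K.smooth.continuous
  have hne : ∀ s t, |t| < K.δ → t ≠ 0 → jac f (K.Φ s t) ≠ 0 := fun s t ht ht0 =>
    hF.jac_ne_zero _ fun h => ht0 ((collar_mem_iff hγ K ht).1 h)
  refine ⟨d * lam (K.Φ 0 0), mul_ne_zero hd0 (hlam0 _), fun s t ht ht0 => ?_⟩
  have key : ∀ T : Set ℝ, IsPreconnected T → (∀ t ∈ T, |t| < K.δ ∧ t ≠ 0) → ∀ t₁ ∈ T, t ∈ T →
      0 < t₁ * t → 0 < (d * lam (K.Φ 0 0)) * t₁ * jac f (K.Φ 0 t₁) →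
      0 < (d * lam (K.Φ 0 0)) * t * jac f (K.Φ s t) := by
    intro T hT hTδ t₁ ht₁ htT hpos h4
    have h5 := mul_pos_of_isPreconnected (isPreconnected_univ.prod hT) hcont.continuousOn
      (fun z hz => hne z.1 z.2 (hTδ _ hz.2).1 (hTδ _ hz.2).2) (x := ((0 : ℝ), t₁)) (y := (s, t))
      ⟨mem_univ _, ht₁⟩ ⟨mem_univ _, htT⟩
    simp only at h5
    have h6 := mul_pos (mul_pos h4 h5) hpos
    have h7 : (d * lam (K.Φ 0 0)) * t₁ * jac f (K.Φ 0 t₁) *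
        (jac f (K.Φ 0 t₁) * jac f (K.Φ s t)) * (t₁ * t) =
        (t₁ * jac f (K.Φ 0 t₁)) ^ 2 * ((d * lam (K.Φ 0 0)) * t * jac f (K.Φ s t)) := by ring
    rw [h7] at h6
    exact pos_of_mul_pos_right h6 (sq_nonneg _)
  rcases lt_or_gt_of_ne ht0 with h0 | h0
  · exact key (Ioo (-K.δ) 0) isPreconnected_Ioo
      (fun t ht => ⟨by rw [abs_of_neg ht.2]; linarith [ht.1], ht.2.ne⟩) b hb
      ⟨(abs_lt.1 ht).1, h0⟩ (mul_pos_of_neg_of_neg hb.2 h0) hpb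
  · exact key (Ioo 0 K.δ) isPreconnected_Ioo
      (fun t ht => ⟨by rw [abs_of_pos ht.1]; exact ht.2, ht.1.ne'⟩) a ha
      ⟨h0, (abs_lt.1 ht).2⟩ (mul_pos ha.1 h0) hpa

/-- The coordinate, with respect to the direction `u`, of the velocity of the image of the core
curve of a collar. -/
def coreSpeed (f u : S2 → ℂ) (Φ : ℝ → ℝ → S2) (s : ℝ) : ℝ := foldForm f u (Φ s 0) (dFst Φ s 0)

theorem continuous_coreSpeed (hF : IsFoldMap C f u) (hγ : γ ∈ C.curves)
    (K : Collar γ (C.others γ)) : Continuous (coreSpeed f u K.Φ) := by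
  have h0 : Continuous fun s : ℝ => (s, (0 : ℝ)) := by fun_prop
  have h1 : Continuous fun s => K.Φ s 0 := K.smooth.continuous.comp h0
  refine Complex.continuous_re.comp (Continuous.div ?_ (hF.continuous_dir.comp h1)
    fun s => hF.dir_ne_zero _ (core_mem hγ K s))
  exact ((continuous_sphereDeriv hF.smooth).comp h1).clm_apply (K.smooth.continuous_dFst.comp h0)

/-- The velocity of the image of the core vanishes where it changes its direction. -/
theorem coreSpeed_eq_zero (hF : IsFoldMap C f u) (hγ : γ ∈ C.curves) (K : Collar γ (C.others γ))
    {s₀ e : ℝ} (he : ∀ᶠ s in 𝓝[≠] s₀, 0 < e * (s - s₀) * coreSpeed f u K.Φ s) :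
    coreSpeed f u K.Φ s₀ = 0 := by
  by_contra h0
  have h1 : ∀ᶠ s in 𝓝 s₀, 0 < coreSpeed f u K.Φ s₀ * coreSpeed f u K.Φ s :=
    (continuous_const.mul (hF.continuous_coreSpeed hγ K)).continuousAt.eventually
      (lt_mem_nhds (mul_self_pos.2 h0))
  obtain ⟨r, hr, h2⟩ := Metric.eventually_nhds_iff.1 (h1.and (eventually_nhdsWithin_iff.1 he))
  have h3 := h2 (y := s₀ + r / 2) (by simp [abs_of_pos hr]; linarith)
  have h4 := h2 (y := s₀ - r / 2) (by simp [abs_of_pos hr]; linarith)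
  have h5 := h3.2 (by simp; linarith)
  have h6 := h4.2 (by simp; linarith)
  have h7 := h3.1
  have h8 := h4.1
  set A := coreSpeed f u K.Φ (s₀ + r / 2)
  set B := coreSpeed f u K.Φ (s₀ - r / 2)
  have h9 := mul_pos (mul_pos h5 h6) (mul_pos h7 h8)
  have h10 : e * (s₀ + r / 2 - s₀) * A * (e * (s₀ - r / 2 - s₀) * B) *
      (coreSpeed f u K.Φ s₀ * A * (coreSpeed f u K.Φ s₀ * B)) =
      -(e * (r / 2) * A * B * coreSpeed f u K.Φ s₀) ^ 2 := by ring
  rw [h10] at h9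
  nlinarith [sq_nonneg (e * (r / 2) * A * B * coreSpeed f u K.Φ s₀)]

/-- At a corner, the direction in which the image of the curve turns back is determined by the
convex side: if `f` is injective near the corner on the side `h * t > 0` of the curve, then this
side of the surface leaves the corner in the direction in which the image of the curve does. -/
theorem pos_of_injOn (hF : IsFoldMap C f u) (hγ : γ ∈ C.curves) (K : Collar γ (C.others γ))
    {s₀ e h : ℝ} (he : ∀ᶠ s in 𝓝[≠] s₀, 0 < e * (s - s₀) * coreSpeed f u K.Φ s)
    (hh : h = 1 ∨ h = -1) {U : Set S2} (hU : U ∈ 𝓝 (K.Φ s₀ 0))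
    (hinj : ∀ s t s' t', 0 < h * t → |t| < K.δ → 0 < h * t' → |t'| < K.δ → K.Φ s t ∈ U →
      K.Φ s' t' ∈ U → f (K.Φ s t) = f (K.Φ s' t') → K.Φ s t = K.Φ s' t') :
    0 < e * h * foldForm f u (K.Φ s₀ 0) (dSnd K.Φ s₀ 0) := by
  have hx := core_mem hγ K s₀
  have hu0 := hF.dir_ne_zero _ hx
  set u₀ := u (K.Φ s₀ 0) with hu₀
  have hhh : h * h = 1 := by rcases hh with rfl | rfl <;> norm_num
  have hh0 : h ≠ 0 := by rcases hh with rfl | rfl <;> norm_num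
  have hha : |h| = 1 := by rcases hh with rfl | rfl <;> norm_num
  have he0 : e ≠ 0 := by
    rintro rfl
    obtain ⟨s, hs⟩ := he.exists
    simp at hs
  set b := foldForm f u (K.Φ s₀ 0) (dSnd K.Φ s₀ 0) with hb
  have hb0 : b ≠ 0 := by
    intro h0
    have hz := hF.coreSpeed_eq_zero hγ K he
    obtain ⟨v, hv⟩ := hF.exists_ne_zero _ hx
    have hA := hF.sphereDeriv_eq _ hx
    have h1 := map_eq_zero_of_det3_ne_zero (sphereDeriv f (K.Φ s₀ 0) : E3 →ₗ[ℝ] ℂ)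
      (show det3 (K.Φ s₀ 0) (dFst K.Φ s₀ 0) (dSnd K.Φ s₀ 0) ≠ 0 from
        (K.det_pos s₀ 0 (by simpa using K.δ_pos)).ne') (sphereDeriv_self hF.smooth _)
      ((hA _).trans (by rw [show foldForm f u (K.Φ s₀ 0) (dFst K.Φ s₀ 0) = 0 from hz, zero_smul]))
      ((hA _).trans (by rw [← hb, h0, zero_smul])) v
    apply hv
    rw [foldForm]
    rw [show sphereDeriv f (K.Φ s₀ 0) v = 0 from h1]
    simp
  -- otherwise `not_injOn_of_cusp` applies to the real and the imaginary part of `f / u₀`, up to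
  -- factors: `e` makes the real part have a minimum along the curve, and `e * η` makes the Jacobian
  -- positive on the side under consideration
  obtain ⟨η, hη, hjac⟩ := hF.exists_jac_sign hγ K
  by_contra hcon
  have hneg : e * h * b < 0 :=
    lt_of_le_of_ne (not_lt.1 hcon) (mul_ne_zero (mul_ne_zero he0 hh0) hb0)
  let g : ℝ × ℝ → ℂ := fun z => f (K.Φ (s₀ + z.1) (h * z.2)) / u₀
  have hg : ContDiff ℝ 1 g := by
    have h1 : ContDiff ℝ ∞ fun z : ℝ × ℝ => (s₀ + z.1, h * z.2) := by fun_prop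
    have h2 := (K.smooth.contDiff_comp hF.smooth).comp h1
    have h3 : ContDiff ℝ ∞ g := by
      simp only [g, div_eq_mul_inv]
      exact h2.mul contDiff_const
    exact h3.of_le (by norm_cast)
  have hgs : ∀ s t, HasDerivAt (fun s => g (s, t))
      (sphereDeriv f (K.Φ (s₀ + s) (h * t)) (dFst K.Φ (s₀ + s) (h * t)) / u₀) s := by
    intro s t
    have h1 := hasDerivAt_comp_curve hF.smooth (K.smooth.hasDerivAt_fst (s₀ + s) (h * t))
    exact (h1.comp_const_add s₀ s).div_const u₀
  have hgt : ∀ s t, HasDerivAt (fun t => g (s, t))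
      (h * (sphereDeriv f (K.Φ (s₀ + s) (h * t)) (dSnd K.Φ (s₀ + s) (h * t)) / u₀)) t := by
    intro s t
    have h1 := hasDerivAt_comp_curve hF.smooth (K.smooth.hasDerivAt_snd (s₀ + s) (h * t))
    have h2 : HasDerivAt (fun t : ℝ => h * t) h t := by simpa using (hasDerivAt_id t).const_mul h
    have h3 := (h1.scomp t h2).div_const u₀
    rw [Complex.real_smul, mul_div_assoc] at h3
    exact h3
  have hre : ∀ {w : ℝ → ℂ} {d : ℂ} {a : ℝ} (r : ℝ), HasDerivAt w d a →
      HasDerivAt (fun x => r * (w x).re) (r * d.re) a := fun r hw =>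
    ((Complex.reCLM.hasFDerivAt.comp_hasDerivAt _ hw).const_mul r)
  have him : ∀ {w : ℝ → ℂ} {d : ℂ} {a : ℝ} (r : ℝ), HasDerivAt w d a →
      HasDerivAt (fun x => r * (w x).im) (r * d.im) a := fun r hw =>
    ((Complex.imCLM.hasFDerivAt.comp_hasDerivAt _ hw).const_mul r)
  let P : ℝ × ℝ → ℝ := fun z => e * (g z).re
  let Q : ℝ × ℝ → ℝ := fun z => (e * η) * (g z).im
  have hP : ContDiff ℝ 1 P := contDiff_const.mul (Complex.reCLM.contDiff.comp hg)
  have hQ : ContDiff ℝ 1 Q := contDiff_const.mul (Complex.imCLM.contDiff.comp hg)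
  have hPs : ∀ z, pFst P z = _ := fun z =>
    (hasDerivAt_pFst hP z.1 z.2).unique (hre e (hgs z.1 z.2))
  have hQs : ∀ z, pFst Q z = _ := fun z =>
    (hasDerivAt_pFst hQ z.1 z.2).unique (him (e * η) (hgs z.1 z.2))
  have hPt : ∀ z, pSnd P z = _ := fun z =>
    (hasDerivAt_pSnd hP z.1 z.2).unique (hre e (hgt z.1 z.2))
  have hQt : ∀ z, pSnd Q z = _ := fun z =>
    (hasDerivAt_pSnd hQ z.1 z.2).unique (him (e * η) (hgt z.1 z.2))
  have hc0 : Continuous fun s : ℝ => K.Φ (s₀ + s) 0 :=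
    K.smooth.continuous.comp (by fun_prop : Continuous fun s : ℝ => (s₀ + s, (0 : ℝ)))
  have hW : {z : ℝ × ℝ | K.Φ (s₀ + z.1) (h * z.2) ∈ U ∧ |z.1| < 1 / 2 ∧ |z.2| < K.δ} ∈
      𝓝 ((0 : ℝ), (0 : ℝ)) := by
    have hcont : Continuous fun z : ℝ × ℝ => K.Φ (s₀ + z.1) (h * z.2) :=
      K.smooth.continuous.comp (by fun_prop : Continuous fun z : ℝ × ℝ => (s₀ + z.1, h * z.2))
    refine Filter.inter_mem (hcont.continuousAt.preimage_mem_nhds (by simpa using hU)) ?_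
    refine IsOpen.mem_nhds (s := {z : ℝ × ℝ | |z.1| < 1 / 2 ∧ |z.2| < K.δ}) ?_ (by simp [K.δ_pos])
    exact (isOpen_lt continuous_fst.abs continuous_const).inter
      (isOpen_lt continuous_snd.abs continuous_const)
  have hcusp : ∀ᶠ s in 𝓝[≠] (0 : ℝ), 0 < s * pFst P (s, 0) := by
    have hu1 : ∀ᶠ s in 𝓝 (0 : ℝ), 0 < (u (K.Φ (s₀ + s) 0) / u₀).re := by
      have hcu : Continuous fun s : ℝ => (u (K.Φ (s₀ + s) 0) / u₀).re :=
        Complex.continuous_re.comp ((hF.continuous_dir.comp hc0).div_const u₀)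
      refine hcu.continuousAt.eventually (lt_mem_nhds ?_)
      simp only
      rw [add_zero, ← hu₀, div_self hu0]
      norm_num
    have he' : ∀ᶠ s in 𝓝[≠] (0 : ℝ), 0 < e * s * coreSpeed f u K.Φ (s₀ + s) := by
      rw [eventually_nhdsWithin_iff] at he ⊢
      have ht : Filter.Tendsto (fun s : ℝ => s₀ + s) (𝓝 0) (𝓝 s₀) := by
        have : Continuous fun s : ℝ => s₀ + s := by fun_prop
        simpa using this.tendsto 0
      filter_upwards [ht.eventually he] with s hs hs0
      have := hs (by simpa using hs0)
      rwa [add_sub_cancel_left] at this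
    filter_upwards [he', nhdsWithin_le_nhds hu1] with s hs1 hs2
    rw [hPs]
    simp only [mul_zero]
    rw [hF.sphereDeriv_eq _ (core_mem hγ K _), Complex.real_smul, mul_div_assoc,
      Complex.re_ofReal_mul]
    have := mul_pos hs1 hs2
    calc 0 < _ := this
      _ = _ := by rw [coreSpeed]; ring
  have hside : pSnd P (0, 0) < 0 := by
    rw [hPt]
    simp only [mul_zero, add_zero]
    rw [hF.sphereDeriv_eq _ hx, Complex.real_smul, ← hu₀, mul_div_assoc, div_self hu0, mul_one,
      ← Complex.ofReal_mul, Complex.ofReal_re]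
    rw [← hb]
    linarith
  have harea : ∀ᶠ z in 𝓝 ((0 : ℝ), (0 : ℝ)), z.2 ≠ 0 →
      0 < z.2 * (pFst P z * pSnd Q z - pSnd P z * pFst Q z) := by
    have hev : ∀ᶠ z : ℝ × ℝ in 𝓝 ((0 : ℝ), (0 : ℝ)), |z.2| < K.δ :=
      (isOpen_lt continuous_snd.abs continuous_const).mem_nhds (by simp [K.δ_pos])
    filter_upwards [hev] with z hz hz0
    rw [hPs, hQs, hPt, hQt]
    have h1 := area_sphereDeriv hF.smooth (K.Φ (s₀ + z.1) (h * z.2)) (dFst K.Φ (s₀ + z.1) (h * z.2))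
      (dSnd K.Φ (s₀ + z.1) (h * z.2))
    set A := sphereDeriv f (K.Φ (s₀ + z.1) (h * z.2)) (dFst K.Φ (s₀ + z.1) (h * z.2))
    set B := sphereDeriv f (K.Φ (s₀ + z.1) (h * z.2)) (dSnd K.Φ (s₀ + z.1) (h * z.2))
    have hhz : |h * z.2| < K.δ := by rw [abs_mul, hha, one_mul]; exact hz
    have h2 := K.det_pos (s₀ + z.1) (h * z.2) hhz
    have h3 := hjac (s₀ + z.1) (h * z.2) hhz (mul_ne_zero hh0 hz0)
    rw [stripDet] at h2
    have hN : 0 < Complex.normSq u₀ := Complex.normSq_pos.2 hu0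
    have h4 : (A / u₀).re * (B / u₀).im - (B / u₀).re * (A / u₀).im =
        area A B / Complex.normSq u₀ := by
      simp only [Complex.div_re, Complex.div_im, area]
      field_simp
      rw [Complex.normSq_apply]
      ring
    have h5 : z.2 * (e * (A / u₀).re * (e * η * ((h : ℂ) * (B / u₀)).im) -
        e * ((h : ℂ) * (B / u₀)).re * (e * η * (A / u₀).im)) =
        e ^ 2 * (η * (h * z.2) * (area A B / Complex.normSq u₀)) := by
      rw [← h4, Complex.im_ofReal_mul, Complex.re_ofReal_mul]; ring
    have h6 : η * (h * z.2) * (area A B / Complex.normSq u₀) =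
      (η * (h * z.2) * jac f (K.Φ (s₀ + z.1) (h * z.2))) *
        det3 (K.Φ (s₀ + z.1) (h * z.2)) (dFst K.Φ (s₀ + z.1) (h * z.2))
          (dSnd K.Φ (s₀ + z.1) (h * z.2)) / Complex.normSq u₀ := by
      rw [h1]; ring
    rw [h5, h6]
    exact mul_pos (by positivity) (div_pos (mul_pos h3 h2) hN)
  obtain ⟨z, hz, z', hz', hz0, hz0', hne, hPz, hQz⟩ := not_injOn_of_cusp hP hQ hcusp hside harea hW
  have hgz : g z = g z' := Complex.ext (mul_left_cancel₀ he0 hPz)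
    (mul_left_cancel₀ (mul_ne_zero he0 hη) hQz)
  have hfz := (div_left_inj' hu0).1 hgz
  have hab : ∀ t : ℝ, |h * t| = |t| := fun t => by rw [abs_mul, hha, one_mul]
  have hp : ∀ t : ℝ, 0 < t → 0 < h * (h * t) := fun t ht => by rwa [← mul_assoc, hhh, one_mul]
  have h1 := hinj _ _ _ _ (hp _ hz0) (by rw [hab]; exact hz.2.2) (hp _ hz0')
    (by rw [hab]; exact hz'.2.2) hz.1 hz'.1 hfz
  obtain ⟨h2, k, hk⟩ := K.inj _ _ _ _ (by rw [hab]; exact hz.2.2) (by rw [hab]; exact hz'.2.2) h1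
  refine hne (Prod.ext ?_ (mul_left_cancel₀ hh0 h2))
  have hk0 : |(k : ℝ)| < 1 := by
    have : (k : ℝ) = z'.1 - z.1 := by linarith
    rw [this]
    have a1 := abs_lt.1 hz.2.1
    have a2 := abs_lt.1 hz'.2.1
    rw [abs_lt]; constructor <;> linarith [a1.1, a1.2, a2.1, a2.2]
  have hk1 : k = 0 := by
    have : |k| < 1 := by exact_mod_cast hk0
    exact Int.abs_lt_one_iff.1 this
  rw [hk1] at hk
  simp at hk
  exact hk.symm

/-- Two fold maps for the same collection of curves with corners fold in the same way, up to a
sign, along each of the curves. -/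
theorem exists_common_sign {f₀ u₀ f₁ u₁ : S2 → ℂ} (h₀ : IsFoldMap C f₀ u₀) (h₁ : IsFoldMap C f₁ u₁)
    (hγ : γ ∈ C.curves) : ∃ σ : ℝ, (σ = 1 ∨ σ = -1) ∧
      ∀ p ∈ γ, ∃ v, 0 < σ * foldForm f₀ u₀ p v * foldForm f₁ u₁ p v := by
  obtain ⟨K⟩ := CurvesWithCorners.exists_collar hγ
  set F₀ := coreSpeed f₀ u₀ K.Φ
  set F₁ := coreSpeed f₁ u₁ K.Φ
  have hc : Continuous fun s => F₀ s * F₁ s :=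
    (h₀.continuous_coreSpeed hγ K).mul (h₁.continuous_coreSpeed hγ K)
  have hnc : ∀ s, K.Φ s 0 ∉ C.corners → F₀ s * F₁ s ≠ 0 := fun s hs => mul_ne_zero
    (h₀.ne_zero_of_notMem _ K.regular (core_mem hγ K) s hs)
    (h₁.ne_zero_of_notMem _ K.regular (core_mem hγ K) s hs)
  -- at a corner both speeds change their signs, so the sign of the product is locally constant
  have hloc : ∀ s, ∃ a : ℝ, ∀ᶠ s' in 𝓝[≠] s, 0 < a * (F₀ s' * F₁ s') := by
    intro s
    by_cases hs : K.Φ s 0 ∈ C.corners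
    · obtain ⟨e₀, he₀⟩ := h₀.sign_change _ K.regular (core_mem hγ K) s hs
      obtain ⟨e₁, he₁⟩ := h₁.sign_change _ K.regular (core_mem hγ K) s hs
      refine ⟨e₀ * e₁, ?_⟩
      filter_upwards [he₀, he₁] with s' h2 h3
      have h4 : 0 < (e₀ * (s' - s) * F₀ s') * (e₁ * (s' - s) * F₁ s') := mul_pos h2 h3
      have h5 : (e₀ * (s' - s) * F₀ s') * (e₁ * (s' - s) * F₁ s') =
          (s' - s) ^ 2 * (e₀ * e₁ * (F₀ s' * F₁ s')) := by ring
      rw [h5] at h4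
      exact pos_of_mul_pos_right h4 (sq_nonneg _)
    · refine ⟨F₀ s * F₁ s, nhdsWithin_le_nhds ?_⟩
      exact (continuous_const.mul hc).continuousAt.eventually
        (lt_mem_nhds (mul_self_pos.2 (hnc s hs)))
  have hopen : ∀ σ : ℝ, IsOpen {s | ∀ᶠ s' in 𝓝[≠] s, 0 < σ * (F₀ s' * F₁ s')} := by
    intro σ
    rw [Metric.isOpen_iff]
    intro s hs
    obtain ⟨r, hr, h2⟩ := Metric.eventually_nhds_iff.1 (eventually_nhdsWithin_iff.1 hs)
    refine ⟨r, hr, fun y hy => ?_⟩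
    by_cases hys : y = s
    · rw [hys]; exact hs
    · refine nhdsWithin_le_nhds ?_
      filter_upwards [isOpen_ball.mem_nhds hy, isOpen_ne.mem_nhds hys] with y' h3 h4
      exact h2 h3 h4
  have hcov : ∀ s, s ∈ {s | ∀ᶠ s' in 𝓝[≠] s, 0 < (1 : ℝ) * (F₀ s' * F₁ s')} ∪
      {s | ∀ᶠ s' in 𝓝[≠] s, 0 < (-1 : ℝ) * (F₀ s' * F₁ s')} := by
    intro s
    obtain ⟨a, ha⟩ := hloc s
    have ha0 : a ≠ 0 := by
      rintro rfl
      obtain ⟨s', hs'⟩ := ha.exists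
      simp at hs'
    rcases lt_or_gt_of_ne ha0 with h | h
    · right
      filter_upwards [ha] with s' hs'
      have h2 : F₀ s' * F₁ s' < 0 := by
        by_contra h'
        exact absurd hs' (not_lt.2 (mul_nonpos_of_nonpos_of_nonneg h.le (not_lt.1 h')))
      linarith
    · left
      filter_upwards [ha] with s' hs'
      rw [one_mul]
      exact pos_of_mul_pos_right hs' h.le
  have hdisj : Disjoint {s | ∀ᶠ s' in 𝓝[≠] s, 0 < (1 : ℝ) * (F₀ s' * F₁ s')}
      {s | ∀ᶠ s' in 𝓝[≠] s, 0 < (-1 : ℝ) * (F₀ s' * F₁ s')} := by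
    rw [disjoint_left]
    intro s h2 h3
    rw [mem_ofPred_eq] at h2 h3
    obtain ⟨s', h4, h5⟩ := (h2.and h3).exists
    linarith
  obtain ⟨σ, hσ, hall⟩ : ∃ σ : ℝ, (σ = 1 ∨ σ = -1) ∧
      ∀ s, ∀ᶠ s' in 𝓝[≠] s, 0 < σ * (F₀ s' * F₁ s') := by
    rcases isPreconnected_univ.subset_or_subset (hopen 1) (hopen (-1)) hdisj fun s _ => hcov s
      with h | h
    · exact ⟨1, Or.inl rfl, fun s => h (mem_univ s)⟩
    · exact ⟨-1, Or.inr rfl, fun s => h (mem_univ s)⟩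
  refine ⟨σ, hσ, fun p hp => ?_⟩
  obtain ⟨s, rfl⟩ := K.core.symm.subset hp
  simp only
  by_cases hs : K.Φ s 0 ∈ C.corners
  -- at a corner, where the velocities vanish, a vector transverse to the curve is used instead
  · obtain ⟨h, hh, hhalf⟩ := exists_half_subset hγ K (C.convexRegion_mem _ hs) hp
      (C.mem_closure_convexRegion _ hs)
    have hpos : ∀ {f u : S2 → ℂ}, IsFoldMap C f u → ∃ e : ℝ,
        (∀ᶠ s' in 𝓝[≠] s, 0 < e * (s' - s) * coreSpeed f u K.Φ s') ∧
        0 < e * h * foldForm f u (K.Φ s 0) (dSnd K.Φ s 0) := by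
      intro f u hF
      obtain ⟨e, he⟩ := hF.sign_change _ K.regular (core_mem hγ K) s hs
      obtain ⟨U, hU, hinj⟩ := hF.injOn _ hs
      exact ⟨e, he, hF.pos_of_injOn hγ K he hh hU fun s t s' t' h1 h2 h3 h4 h5 h6 h7 =>
        hinj ⟨h5, hhalf s t h1 h2⟩ ⟨h6, hhalf s' t' h3 h4⟩ h7⟩
    obtain ⟨e₀, he₀, hb₀⟩ := hpos h₀
    obtain ⟨e₁, he₁, hb₁⟩ := hpos h₁
    refine ⟨dSnd K.Φ s 0, ?_⟩
    set b₀ := foldForm f₀ u₀ (K.Φ s 0) (dSnd K.Φ s 0)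
    set b₁ := foldForm f₁ u₁ (K.Φ s 0) (dSnd K.Φ s 0)
    obtain ⟨s', ⟨h2, h3⟩, h4⟩ := ((he₀.and he₁).and (hall s)).exists
    have h5 : 0 < (e₀ * (s' - s) * F₀ s') * (e₁ * (s' - s) * F₁ s') * (σ * (F₀ s' * F₁ s')) *
      ((e₀ * h * b₀) * (e₁ * h * b₁)) := mul_pos (mul_pos (mul_pos h2 h3) h4) (mul_pos hb₀ hb₁)
    have h6 : (e₀ * (s' - s) * F₀ s') * (e₁ * (s' - s) * F₁ s') * (σ * (F₀ s' * F₁ s')) *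
      ((e₀ * h * b₀) * (e₁ * h * b₁)) =
      (e₀ * e₁ * h * (s' - s) * F₀ s' * F₁ s') ^ 2 * (σ * b₀ * b₁) := by ring
    rw [h6] at h5
    exact pos_of_mul_pos_right h5 (sq_nonneg _)
  · refine ⟨dFst K.Φ s 0, ?_⟩
    change 0 < σ * F₀ s * F₁ s
    have h2 : ∀ᶠ s' in 𝓝[≠] s, 0 < (F₀ s * F₁ s) * (F₀ s' * F₁ s') := nhdsWithin_le_nhds
      ((continuous_const.mul hc).continuousAt.eventually (lt_mem_nhds (mul_self_pos.2 (hnc s hs))))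
    obtain ⟨s', h3, h4⟩ := (h2.and (hall s)).exists
    have h5 := mul_pos h3 h4
    have h6 : F₀ s * F₁ s * (F₀ s' * F₁ s') * (σ * (F₀ s' * F₁ s')) =
      (F₀ s' * F₁ s') ^ 2 * (σ * F₀ s * F₁ s) := by ring
    rw [h6] at h5
    exact pos_of_mul_pos_right h5 (sq_nonneg _)

end IsFoldMap

/-! ### The quotient of two fold maps -/

namespace IsFoldMap

open CurvesWithCorners

variable {C : CurvesWithCorners} {f₀ u₀ f₁ u₁ : S2 → ℂ}

/-- The complement of the curves is dense. -/
theorem frequently_notMem (C : CurvesWithCorners) (p : S2) : ∃ᶠ q in 𝓝 p, q ∉ ⋃₀ C.curves := by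
  by_cases hp : p ∈ ⋃₀ C.curves
  · obtain ⟨γ, hγ, hpγ⟩ := hp
    obtain ⟨K⟩ := CurvesWithCorners.exists_collar hγ
    obtain ⟨s, rfl⟩ := K.core.symm.subset hpγ
    have hc : Continuous fun t => K.Φ s t := K.smooth.continuous.comp (Continuous.prodMk_right s)
    have ht : Filter.Tendsto (fun t => K.Φ s t) (𝓝[≠] (0 : ℝ)) (𝓝 (K.Φ s 0)) :=
      hc.continuousAt.tendsto.mono_left nhdsWithin_le_nhds
    refine ht.frequently (Filter.Eventually.frequently ?_)
    have h1 : ∀ᶠ t in 𝓝[≠] (0 : ℝ), |t| < K.δ := nhdsWithin_le_nhds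
      ((isOpen_lt continuous_abs continuous_const).mem_nhds (by simp [K.δ_pos]))
    filter_upwards [h1, self_mem_nhdsWithin] with t h2 h3 h4
    exact h3 ((collar_mem_iff hγ K h2).1 h4)
  · intro h
    exact h.self_of_nhds hp

/-- The Jacobians of two fold maps for the same curves have the same signs, up to a global sign. -/
theorem exists_jac_mul_sign (h₀ : IsFoldMap C f₀ u₀) (h₁ : IsFoldMap C f₁ u₁) :
    ∃ κ : ℝ, (κ = 1 ∨ κ = -1) ∧ ∀ p ∉ ⋃₀ C.curves, 0 < κ * (jac f₀ p * jac f₁ p) := by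
  let S : ℝ → Set S2 := fun κ =>
    {p | ∀ᶠ q in 𝓝 p, q ∉ ⋃₀ C.curves → 0 < κ * (jac f₀ q * jac f₁ q)}
  have hopen : ∀ κ, IsOpen (S κ) := fun κ => isOpen_setOfPred_eventually_nhds
  have hdisj : Disjoint (S 1) (S (-1)) := by
    rw [disjoint_left]
    intro p h2 h3
    obtain ⟨q, hq, h4, h5⟩ := ((frequently_notMem C p).and_eventually
      (Filter.Eventually.and (show ∀ᶠ q in 𝓝 p, _ from h2) (show ∀ᶠ q in 𝓝 p, _ from h3))).exists
    linarith [h4 hq, h5 hq]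
  have hloc : ∀ p, ∃ a : ℝ, ∀ᶠ q in 𝓝 p, q ∉ ⋃₀ C.curves → 0 < a * (jac f₀ q * jac f₁ q) := by
    intro p
    by_cases hp : p ∈ ⋃₀ C.curves
    · obtain ⟨γ, hγ, hpγ⟩ := hp
      obtain ⟨K⟩ := CurvesWithCorners.exists_collar hγ
      obtain ⟨η₀, -, hη₀⟩ := h₀.exists_jac_sign hγ K
      obtain ⟨η₁, -, hη₁⟩ := h₁.exists_jac_sign hγ K
      refine ⟨η₀ * η₁, ?_⟩
      have hU : K.part (Ioo (-K.δ) K.δ) ∈ 𝓝 p := by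
        refine (K.isOpen_part isOpen_Ioo fun t ht => abs_lt.2 ht).mem_nhds ?_
        obtain ⟨s, rfl⟩ := K.core.symm.subset hpγ
        exact K.mem_part ⟨by linarith [K.δ_pos], K.δ_pos⟩
      filter_upwards [hU] with q hq hqC
      obtain ⟨⟨s, t⟩, ⟨-, ht⟩, rfl⟩ := hq
      simp only at hqC ht ⊢
      have ht0 : t ≠ 0 := fun h => hqC ((collar_mem_iff hγ K (abs_lt.2 ht)).2 h)
      have h2 := mul_pos (hη₀ s t (abs_lt.2 ht) ht0) (hη₁ s t (abs_lt.2 ht) ht0)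
      have h3 : η₀ * t * jac f₀ (K.Φ s t) * (η₁ * t * jac f₁ (K.Φ s t)) =
        t ^ 2 * (η₀ * η₁ * (jac f₀ (K.Φ s t) * jac f₁ (K.Φ s t))) := by ring
      rw [h3] at h2
      exact pos_of_mul_pos_right h2 (sq_nonneg t)
    · refine ⟨jac f₀ p * jac f₁ p, ?_⟩
      have hc : Continuous fun q => jac f₀ p * jac f₁ p * (jac f₀ q * jac f₁ q) :=
        continuous_const.mul ((continuous_jac h₀.smooth).mul (continuous_jac h₁.smooth))
      filter_upwards [hc.continuousAt.eventually (lt_mem_nhds (mul_self_pos.2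
        (mul_ne_zero (h₀.jac_ne_zero p hp) (h₁.jac_ne_zero p hp))))] with q hq _ using hq
  have hcov : (univ : Set S2) ⊆ S 1 ∪ S (-1) := by
    intro p _
    obtain ⟨a, ha⟩ := hloc p
    rcases lt_or_ge a 0 with h | h
    · right
      change ∀ᶠ q in 𝓝 p, _
      filter_upwards [ha] with q hq hqC
      have h2 : jac f₀ q * jac f₁ q < 0 := by
        by_contra h'
        exact absurd (hq hqC) (not_lt.2 (mul_nonpos_of_nonpos_of_nonneg h.le (not_lt.1 h')))
      linarith
    · left
      change ∀ᶠ q in 𝓝 p, _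
      filter_upwards [ha] with q hq hqC
      rw [one_mul]
      exact pos_of_mul_pos_right (hq hqC) h
  have hfin : ∀ κ, (univ : Set S2) ⊆ S κ → ∀ p ∉ ⋃₀ C.curves, 0 < κ * (jac f₀ p * jac f₁ p) := by
    intro κ h p hp
    have h1 : ∀ᶠ q in 𝓝 p, q ∉ ⋃₀ C.curves → 0 < κ * (jac f₀ q * jac f₁ q) := h (mem_univ p)
    exact h1.self_of_nhds hp
  rcases isPreconnected_univ.subset_or_subset (hopen 1) (hopen (-1)) hdisj hcov with h | h
  · exact ⟨1, Or.inl rfl, hfin 1 h⟩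
  · exact ⟨-1, Or.inr rfl, hfin (-1) h⟩

/-- Off the curves, a function `G` such that `G · df₀(v)` and `df₁(v)` never point in opposite
directions: twice the complex linear part of `df₁ ∘ df₀⁻¹`. -/
def dirQuotient (f₀ f₁ : S2 → ℂ) (p : S2) : ℂ :=
  Complex.I * altCoeff (conjForm (sphereDeriv f₁ p) (sphereDeriv f₀ p)) p / (jac f₀ p : ℂ)

/-- If `df₁ ∘ df₀⁻¹` is `z ↦ a z + b z̄` and preserves the orientation, then `|b| < |a|`, and so the
vectors `a z` and `a z + b z̄` form an acute angle. -/
theorem dirQuotient_re_pos (h₀ : IsFoldMap C f₀ u₀) (h₁ : IsFoldMap C f₁ u₁) {p : S2}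
    (hpos : 0 < jac f₀ p * jac f₁ p) {v : E3} (hv : inner ℝ (p : E3) v = 0) (hv0 : v ≠ 0) :
    0 < (dirQuotient f₀ f₁ p * sphereDeriv f₀ p v * (starRingEnd ℂ) (sphereDeriv f₁ p v)).re := by
  have e1 := conjForm_eq (sphereDeriv f₁ p) (sphereDeriv f₀ p) (sphereDeriv_self h₁.smooth p)
    (sphereDeriv_self h₀.smooth p) v (cross p v)
  have a0 := area_sphereDeriv h₀.smooth p v (cross p v)
  have a1 := area_sphereDeriv h₁.smooth p v (cross p v)
  rw [det3_self_cross p v hv] at e1 a0 a1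
  have hd : 0 < ‖v‖ ^ 2 := by have := norm_pos_iff.2 hv0; positivity
  set d := ‖v‖ ^ 2
  set A := altCoeff (conjForm (sphereDeriv f₁ p) (sphereDeriv f₀ p)) p
  set J₀ := jac f₀ p with hJ₀
  set J₁ := jac f₁ p
  have hJ0 : J₀ ≠ 0 := left_ne_zero_of_mul hpos.ne'
  set z := sphereDeriv f₀ p v
  set z' := sphereDeriv f₀ p (cross p v)
  set w := sphereDeriv f₁ p v
  set w' := sphereDeriv f₁ p (cross p v)
  have hz0 : z ≠ 0 := by
    intro h
    rw [h] at a0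
    exact mul_ne_zero hJ0 hd.ne' (by rw [← a0]; simp [area])
  have hA : A = ((1 / d : ℝ) : ℂ) * (w * (starRingEnd ℂ) z' - w' * (starRingEnd ℂ) z) := by
    have : conjForm (sphereDeriv f₁ p) (sphereDeriv f₀ p) v (cross p v) =
      w * (starRingEnd ℂ) z' - w' * (starRingEnd ℂ) z := rfl
    rw [← this, e1, Complex.real_smul, ← mul_assoc, ← Complex.ofReal_mul, one_div,
      inv_mul_cancel₀ hd.ne', Complex.ofReal_one, one_mul]
  have key : dirQuotient f₀ f₁ p * z * (starRingEnd ℂ) w = ((1 / (d * J₀) : ℝ) : ℂ) *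
      (Complex.I * (w * (starRingEnd ℂ) z' - w' * (starRingEnd ℂ) z) * z * (starRingEnd ℂ) w) := by
    rw [dirQuotient, show altCoeff (conjForm (sphereDeriv f₁ p) (sphereDeriv f₀ p)) p = A from rfl,
      hA,
      ← hJ₀]
    push_cast
    field_simp
  rw [key, Complex.re_ofReal_mul]
  have e2 : (Complex.I * (w * (starRingEnd ℂ) z' - w' * (starRingEnd ℂ) z) * z *
      (starRingEnd ℂ) w).re = Complex.normSq w * area z z' + Complex.normSq z * area w w' := by
    simp only [area, Complex.normSq_apply, Complex.mul_re, Complex.mul_im, Complex.sub_re,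
      Complex.sub_im, Complex.I_re, Complex.I_im, Complex.conj_re, Complex.conj_im]
    ring
  rw [e2, a0, a1]
  have e3 : 1 / (d * J₀) * (Complex.normSq w * (J₀ * d) + Complex.normSq z * (J₁ * d)) =
      Complex.normSq w + Complex.normSq z * (J₀ * J₁) / J₀ ^ 2 := by
    field_simp
  rw [e3]
  have := Complex.normSq_pos.2 hz0
  have := Complex.normSq_nonneg w
  positivity

theorem dirQuotient_ne_zero (h₀ : IsFoldMap C f₀ u₀) (h₁ : IsFoldMap C f₁ u₁) {p : S2}
    (hpos : 0 < jac f₀ p * jac f₁ p) : dirQuotient f₀ f₁ p ≠ 0 := by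
  obtain ⟨v, hv, hv0⟩ := exists_tangent p
  intro h
  have := dirQuotient_re_pos h₀ h₁ hpos hv hv0
  rw [h] at this
  simp at this

theorem continuousOn_dirQuotient (h₀ : IsFoldMap C f₀ u₀) (h₁ : IsFoldMap C f₁ u₁) :
    ContinuousOn (dirQuotient f₀ f₁) (⋃₀ C.curves)ᶜ := by
  refine ContinuousOn.div (continuous_const.mul (continuous_altCoeff_conjForm
    (continuous_sphereDeriv h₁.smooth) (continuous_sphereDeriv h₀.smooth))).continuousOn
    (Complex.continuous_ofReal.comp (continuous_jac h₀.smooth)).continuousOn fun p hp => ?_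
  exact_mod_cast h₀.jac_ne_zero p hp

/-- Near the curves, `G` is homotopic to `σ u₁ / u₀`: their quotient lies in the slit plane. -/
theorem eventually_mem_slitPlane (h₀ : IsFoldMap C f₀ u₀) (h₁ : IsFoldMap C f₁ u₁)
    (hpos : ∀ p ∉ ⋃₀ C.curves, 0 < jac f₀ p * jac f₁ p) {σ : ℝ} (hσ : σ = 1 ∨ σ = -1) {x : S2}
    (hx : x ∈ ⋃₀ C.curves) {v : E3} (hv : 0 < σ * foldForm f₀ u₀ x v * foldForm f₁ u₁ x v) :
    ∀ᶠ p in 𝓝 x, u₀ p ≠ 0 ∧ u₁ p ≠ 0 ∧ (p ∉ ⋃₀ C.curves →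
      (σ : ℂ) * dirQuotient f₀ f₁ p * u₀ p / u₁ p ∈ Complex.slitPlane) := by
  have hσσ : σ * σ = 1 := by rcases hσ with rfl | rfl <;> norm_num
  have hu₀ := h₀.continuous_dir.continuousAt.eventually_ne (h₀.dir_ne_zero x hx)
  have hu₁ := h₁.continuous_dir.continuousAt.eventually_ne (h₁.dir_ne_zero x hx)
  have hz : Continuous fun p => sphereDeriv f₀ p v :=
    (continuous_sphereDeriv h₀.smooth).clm_apply continuous_const
  have hw : Continuous fun p => sphereDeriv f₁ p v :=
    (continuous_sphereDeriv h₁.smooth).clm_apply continuous_const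
  let X : S2 → ℂ := fun p => (σ : ℂ) * (sphereDeriv f₀ p v / u₀ p) *
    (starRingEnd ℂ) (sphereDeriv f₁ p v / u₁ p)
  have hX : ContinuousAt X x := by
    refine ContinuousAt.mul (continuousAt_const.mul (hz.continuousAt.div
      h₀.continuous_dir.continuousAt (h₀.dir_ne_zero x hx))) ?_
    exact Complex.continuous_conj.continuousAt.comp (hw.continuousAt.div
      h₁.continuous_dir.continuousAt (h₁.dir_ne_zero x hx))
  have hXx : 0 < (X x).re := by
    simp only [X]
    rw [h₀.sphereDeriv_eq x hx, h₁.sphereDeriv_eq x hx, Complex.real_smul, Complex.real_smul,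
      mul_div_assoc, mul_div_assoc, div_self (h₀.dir_ne_zero x hx),
      div_self (h₁.dir_ne_zero x hx), mul_one, mul_one, Complex.conj_ofReal,
      ← Complex.ofReal_mul, ← Complex.ofReal_mul, Complex.ofReal_re]
    exact hv
  have hXev : ∀ᶠ p in 𝓝 x, 0 < (X p).re :=
    (Complex.continuous_re.continuousAt.comp hX).eventually (lt_mem_nhds hXx)
  filter_upwards [hu₀, hu₁, hXev] with p hp₀ hp₁ hXp
  refine ⟨hp₀, hp₁, fun hp => ?_⟩
  -- the tangential part of `v`
  set v' := v - inner ℝ (p : E3) v • (p : E3) with hv'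
  have hv't : inner ℝ (p : E3) v' = 0 := by
    rw [hv', inner_sub_right, inner_smul_right, real_inner_self_eq_norm_sq, norm_coe_S2]; ring
  have e0 : sphereDeriv f₀ p v' = sphereDeriv f₀ p v := by
    rw [hv', map_sub, map_smul, sphereDeriv_self h₀.smooth, smul_zero, sub_zero]
  have e1 : sphereDeriv f₁ p v' = sphereDeriv f₁ p v := by
    rw [hv', map_sub, map_smul, sphereDeriv_self h₁.smooth, smul_zero, sub_zero]
  have hv'0 : v' ≠ 0 := by
    intro h
    rw [h, map_zero] at e0
    simp only [X, ← e0] at hXp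
    simp at hXp
  have hre := dirQuotient_re_pos h₀ h₁ (hpos p hp) hv't hv'0
  rw [e0, e1] at hre
  set G := dirQuotient f₀ f₁ p
  set Y := (σ : ℂ) * G * u₀ p / u₁ p with hY
  have hYX : G * sphereDeriv f₀ p v * (starRingEnd ℂ) (sphereDeriv f₁ p v) =
      ((Complex.normSq (u₁ p) : ℝ) : ℂ) * (Y * X p) := by
    have hc : (starRingEnd ℂ) (u₁ p) ≠ 0 := by simpa using hp₁
    have hσc : (σ : ℂ) * σ = 1 := by exact_mod_cast congrArg ((↑) : ℝ → ℂ) hσσ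
    simp only [hY, X, Complex.normSq_eq_conj_mul_self, map_div₀]
    field_simp
    linear_combination (-(G * sphereDeriv f₀ p v * (starRingEnd ℂ) (sphereDeriv f₁ p v))) * hσc
  rw [hYX, Complex.re_ofReal_mul] at hre
  have hre' := pos_of_mul_pos_right hre (Complex.normSq_nonneg _)
  by_contra hcon
  rw [Complex.mem_slitPlane_iff, not_or, not_lt, not_not] at hcon
  rw [Complex.mul_re, hcon.2, zero_mul, sub_zero] at hre'
  exact absurd hre' (not_lt.2 (mul_nonpos_of_nonpos_of_nonneg hcon.1 hXp.le))

/-- The function `dirQuotient` has a continuous logarithm off the curves. -/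
theorem exists_log_dirQuotient (h₀ : IsFoldMap C f₀ u₀) (h₁ : IsFoldMap C f₁ u₁)
    (hpos : ∀ p ∉ ⋃₀ C.curves, 0 < jac f₀ p * jac f₁ p) :
    ∃ g : S2 → ℂ, ContinuousOn g (⋃₀ C.curves)ᶜ ∧
      ∀ p ∉ ⋃₀ C.curves, Complex.exp (g p) = dirQuotient f₀ f₁ p := by
  classical
  have hsig : ∀ γ ∈ C.curves, ∃ σ : ℝ, (σ = 1 ∨ σ = -1) ∧
      ∀ p ∈ γ, ∃ v, 0 < σ * foldForm f₀ u₀ p v * foldForm f₁ u₁ p v := fun γ hγ =>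
    exists_common_sign h₀ h₁ hγ
  choose! σ hσ hσv using hsig
  have hcl : ∀ T ⊆ C.curves, IsClosed (⋃₀ T) := fun T hT => C.isClosed_sUnion hT
  obtain ⟨O, O', hO, hO', hsub, hsub', hdisj⟩ : SeparatedNhds
      (⋃₀ {γ ∈ C.curves | σ γ = 1}) (⋃₀ {γ ∈ C.curves | σ γ = -1}) := by
    refine NormalSpace.normal _ _ (hcl _ (sep_subset _ _))
      (hcl _ (sep_subset _ _)) ?_
    rw [disjoint_left]
    rintro x ⟨γ, ⟨hγ, h1⟩, hx⟩ ⟨γ', ⟨hγ', h2⟩, hx'⟩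
    have : γ = γ' := by
      by_contra hne
      exact disjoint_left.1 (C.pairwise_disjoint hγ hγ' hne) hx hx'
    rw [this, h2] at h1
    norm_num at h1
  let B : ℝ → Set S2 := fun a => {p | u₀ p ≠ 0 ∧ u₁ p ≠ 0 ∧ (p ∉ ⋃₀ C.curves →
    (a : ℂ) * dirQuotient f₀ f₁ p * u₀ p / u₁ p ∈ Complex.slitPlane)}
  let W : ℝ → Set S2 := fun a => interior (B a)
  let V : Set S2 := (O ∩ W 1) ∪ (O' ∩ W (-1))
  have hV : IsOpen V := (hO.inter isOpen_interior).union (hO'.inter isOpen_interior)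
  -- near each curve `γ`, the function `e` is the sign `σ γ`
  let e : S2 → ℝ := fun p => if p ∈ O then 1 else -1
  have heO : ∀ p ∈ O, e p = 1 := fun p hp => if_pos hp
  have heO' : ∀ p ∈ O', e p = -1 := fun p hp => if_neg fun h => disjoint_left.1 hdisj h hp
  have hee : ∀ p, e p * e p = 1 := by
    intro p; simp only [e]; split_ifs <;> norm_num
  have hec : ContinuousOn e V := by
    rintro p (⟨hp, -⟩ | ⟨hp, -⟩)
    · exact (continuousAt_const.congr (Filter.eventually_of_mem (hO.mem_nhds hp)
        fun q hq => (heO q hq).symm)).continuousWithinAt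
    · exact (continuousAt_const.congr (Filter.eventually_of_mem (hO'.mem_nhds hp)
        fun q hq => (heO' q hq).symm)).continuousWithinAt
  have hecC : ContinuousOn (fun p => (e p : ℂ)) V := Complex.continuous_ofReal.comp_continuousOn hec
  have hVe : ∀ p ∈ V, u₀ p ≠ 0 ∧ u₁ p ≠ 0 ∧ (p ∉ ⋃₀ C.curves →
      (e p : ℂ) * dirQuotient f₀ f₁ p * u₀ p / u₁ p ∈ Complex.slitPlane) := by
    rintro p (⟨hp, hW⟩ | ⟨hp, hW⟩)
    · rw [heO p hp]; exact (interior_subset hW : p ∈ B 1)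
    · rw [heO' p hp]; exact (interior_subset hW : p ∈ B (-1))
  have hUV : (⋃₀ C.curves)ᶜ ∪ V = univ := by
    refine eq_univ_of_forall fun p => ?_
    by_cases hp : p ∈ ⋃₀ C.curves
    · right
      obtain ⟨γ, hγ, hpγ⟩ := hp
      obtain ⟨v, hv⟩ := hσv γ hγ p hpγ
      have hWp : p ∈ W (σ γ) := mem_interior_iff_mem_nhds.2
        (eventually_mem_slitPlane h₀ h₁ hpos (hσ γ hγ) ⟨γ, hγ, hpγ⟩ hv)
      rcases hσ γ hγ with h | h
      · rw [h] at hWp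
        exact Or.inl ⟨hsub ⟨γ, ⟨hγ, h⟩, hpγ⟩, hWp⟩
      · rw [h] at hWp
        exact Or.inr ⟨hsub' ⟨γ, ⟨hγ, h⟩, hpγ⟩, hWp⟩
    · exact Or.inl hp
  have hGc := continuousOn_dirQuotient h₀ h₁
  obtain ⟨g, q, hg, -, hgG, -⟩ := exists_log_of_cover (hcl _ Subset.rfl).isOpen_compl hV hUV hGc
    (fun p hp => dirQuotient_ne_zero h₀ h₁ (hpos p hp))
    (Q := fun p => (e p : ℂ) * u₁ p / u₀ p)
    (ℓ := fun p => Complex.log ((e p : ℂ) * dirQuotient f₀ f₁ p * u₀ p / u₁ p))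
    ((hecC.mul h₁.continuous_dir.continuousOn).div h₀.continuous_dir.continuousOn
      fun p hp => (hVe p hp).1)
    (fun p hp => div_ne_zero (mul_ne_zero (by exact_mod_cast left_ne_zero_of_mul_eq_one (hee p))
      (hVe p hp).2.1) (hVe p hp).1)
    (ContinuousOn.clog ((((hecC.mono inter_subset_right).mul (hGc.mono inter_subset_left)).mul
      h₀.continuous_dir.continuousOn).div h₁.continuous_dir.continuousOn
        fun p hp => (hVe p hp.2).2.1) fun p hp => (hVe p hp.2).2.2 hp.1)
    (fun p hp => by
      have h1 := (hVe p hp.2).2.2 hp.1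
      rw [Complex.exp_log (Complex.slitPlane_ne_zero h1)]
      have h2 := (hVe p hp.2).1
      have h3 := (hVe p hp.2).2.1
      have h4 : (e p : ℂ) * e p = 1 := by exact_mod_cast congrArg ((↑) : ℝ → ℂ) (hee p)
      field_simp
      linear_combination (-(dirQuotient f₀ f₁ p)) * h4)
  exact ⟨g, hg, hgG⟩

end IsFoldMap

/-! ### Degrees of closed curves in the punctured plane -/

/-- The `1`-periodic function `g` without zeros has degree `n`: a continuous logarithm of `g`
increases by `2πin` over a period. -/
def HasDegree (g : ℝ → ℂ) (n : ℤ) : Prop :=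
  ∃ L : ℝ → ℂ, Continuous L ∧ (∀ s, Complex.exp (L s) = g s) ∧
    ∀ s, L (s + 1) = L s + n * (2 * Real.pi * Complex.I)

theorem sub_eq_sub_of_exp_eq {X : Type*} [TopologicalSpace X] [PreconnectedSpace X] {L L' : X → ℂ}
    (hL : Continuous L) (hL' : Continuous L') (h : ∀ x, Complex.exp (L x) = Complex.exp (L' x))
    (x y : X) : L x - L' x = L y - L' y :=
  eq_of_exp_eq_one_of_isPreconnected isPreconnected_univ (hL.sub hL').continuousOn
    (fun x _ => by simp only [Pi.sub_apply]; rw [Complex.exp_sub, h,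
      div_self (Complex.exp_ne_zero _)])
    (mem_univ x) (mem_univ y)

theorem two_pi_I_mul_cancel {m n : ℤ}
    (h : (m : ℂ) * (2 * Real.pi * Complex.I) = n * (2 * Real.pi * Complex.I)) : m = n := by
  have h1 : (2 * Real.pi * Complex.I : ℂ) ≠ 0 := Complex.two_pi_I_ne_zero
  exact_mod_cast mul_right_cancel₀ h1 h

theorem hasDegree_of_log {g L : ℝ → ℂ} {n : ℤ} (hL : Continuous L)
    (hg : ∀ s, Complex.exp (L s) = g s) (hper : ∀ s, g (s + 1) = g s)
    (hn : L 1 = L 0 + n * (2 * Real.pi * Complex.I)) : HasDegree g n := by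
  refine ⟨L, hL, hg, fun s => ?_⟩
  have h1 := sub_eq_sub_of_exp_eq (hL.comp (by fun_prop : Continuous
    fun s : ℝ => s + 1)) hL (fun s => by simp only [Function.comp]; rw [hg, hg, hper]) s 0
  simp only [Function.comp, zero_add, hn] at h1
  linear_combination h1

theorem exists_hasDegree {g : ℝ → ℂ} (hg : Continuous g) (h0 : ∀ s, g s ≠ 0)
    (hper : ∀ s, g (s + 1) = g s) : ∃ n, HasDegree g n := by
  obtain ⟨L, hL, hLg⟩ := exists_log_of_simplyConnected hg h0
  have h1 : Complex.exp (L 1) = Complex.exp (L 0) := by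
    rw [hLg, hLg]; simpa using hper 0
  obtain ⟨n, hn⟩ := Complex.exp_eq_exp_iff_exists_int.1 h1
  exact ⟨n, hasDegree_of_log hL hLg hper hn⟩

namespace HasDegree

theorem unique {g : ℝ → ℂ} {m n : ℤ} (hm : HasDegree g m) (hn : HasDegree g n) : m = n := by
  obtain ⟨L, hL, hLg, hLm⟩ := hm
  obtain ⟨L', hL', hLg', hLn⟩ := hn
  have h1 := sub_eq_sub_of_exp_eq hL hL' (fun s => by rw [hLg, hLg']) (0 + 1) 0
  rw [hLm, hLn] at h1
  refine two_pi_I_mul_cancel ?_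
  linear_combination h1

theorem const_mul {g : ℝ → ℂ} {n : ℤ} (h : HasDegree g n) {c : ℂ} (hc : c ≠ 0) :
    HasDegree (fun s => c * g s) n := by
  obtain ⟨L, hL, hLg, hLn⟩ := h
  refine ⟨fun s => Complex.log c + L s, continuous_const.add hL, fun s => ?_, fun s => ?_⟩
  · rw [Complex.exp_add, Complex.exp_log hc, hLg]
  · simp only [hLn]; ring

theorem conj {g : ℝ → ℂ} {n : ℤ} (h : HasDegree g n) :
    HasDegree (fun s => (starRingEnd ℂ) (g s)) (-n) := by
  obtain ⟨L, hL, hLg, hLn⟩ := h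
  refine ⟨fun s => (starRingEnd ℂ) (L s), Complex.continuous_conj.comp hL, fun s => ?_, fun s => ?_⟩
  · rw [Complex.exp_conj, hLg]
  · simp [hLn, map_ofNat]

/-- A change of parameter winding `k` times around the period multiplies the degree by `k`. -/
theorem comp {g : ℝ → ℂ} {n : ℤ} (h : HasDegree g n) {φ : ℝ → ℝ} (hφ : Continuous φ) {k : ℤ}
    (hk : ∀ s, φ (s + 1) = φ s + k) : HasDegree (fun s => g (φ s)) (k * n) := by
  obtain ⟨L, hL, hLg, hLn⟩ := h
  have hlin : Function.Periodic (fun s : ℝ => L s - s * (n * (2 * Real.pi * Complex.I))) 1 := by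
    intro s
    simp only [hLn]
    push_cast
    ring
  refine ⟨fun s => L (φ s), hL.comp hφ, fun s => hLg _, fun s => ?_⟩
  have h1 := hlin.int_mul k (φ s)
  simp only [mul_one] at h1
  simp only [hk]
  push_cast at h1 ⊢
  linear_combination h1

/-- Homotopy invariance of the degree. -/
theorem homotopy {g : ℝ → ℝ → ℂ} (hg : Continuous fun z : ℝ × ℝ => g z.1 z.2)
    (h0 : ∀ s, ∀ r ∈ Icc (0 : ℝ) 1, g s r ≠ 0)
    (hper : ∀ s, ∀ r ∈ Icc (0 : ℝ) 1, g (s + 1) r = g s r)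
    {n : ℤ} (hn : HasDegree (fun s => g s 0) n) : HasDegree (fun s => g s 1) n := by
  let q : ℝ → ℝ := fun r => max 0 (min r 1)
  have hq : Continuous q := by fun_prop
  have hqm : ∀ r, q r ∈ Icc (0 : ℝ) 1 := fun r =>
    ⟨le_max_left _ _, max_le zero_le_one (min_le_right _ _)⟩
  have hq0 : q 0 = 0 := by simp [q]
  have hq1 : q 1 = 1 := by simp [q]
  obtain ⟨L, hL, hLg⟩ := exists_log_of_simplyConnected (X := ℝ × ℝ) (f := fun z => g z.1 (q z.2))
    (hg.comp (continuous_fst.prodMk (hq.comp continuous_snd))) fun z => h0 _ _ (hqm _)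
  obtain ⟨L₀, hL₀, hLg₀, hLn₀⟩ := hn
  have hshift : Continuous fun z : ℝ × ℝ => L (z.1 + 1, z.2) := hL.comp (by fun_prop)
  have hD := sub_eq_sub_of_exp_eq hshift hL (fun z => by rw [hLg, hLg]; exact hper _ _ (hqm _))
  have h1 := sub_eq_sub_of_exp_eq (hL.comp (Continuous.prodMk_left (0 : ℝ))) hL₀
    (fun s => by simp only [Function.comp]; rw [hLg, hLg₀]; simp only [hq0]) (0 + 1) 0
  simp only [Function.comp, hLn₀] at h1
  refine ⟨fun s => L (s, 1), hL.comp (Continuous.prodMk_left (1 : ℝ)), fun s => ?_, fun s => ?_⟩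
  · rw [hLg]; simp only [hq1]
  · have h2 := hD (s, 1) (0, 0)
    simp only at h2
    linear_combination h2 + h1

/-- If `q * g₀` and `g₁` never point in opposite directions, where `q` has a periodic logarithm,
then `g₀` and `g₁` have the same degree. -/
theorem congr_of_re_pos {g₀ g₁ q : ℝ → ℂ} {n : ℤ} (h : HasDegree g₀ n) (hg₁ : Continuous g₁)
    (hper : ∀ s, g₁ (s + 1) = g₁ s) (hq : Continuous q) (hqper : ∀ s, q (s + 1) = q s)
    (hre : ∀ s, 0 < (Complex.exp (q s) * g₀ s * (starRingEnd ℂ) (g₁ s)).re) : HasDegree g₁ n := by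
  obtain ⟨L, hL, hLg, hLn⟩ := h
  have h1 : HasDegree (fun s => Complex.exp (q s) * g₀ s) n := by
    refine ⟨fun s => q s + L s, hq.add hL, fun s => ?_, fun s => ?_⟩
    · rw [Complex.exp_add, hLg]
    · simp only [hqper, hLn]; ring
  have hg₀ : Continuous g₀ := by
    have : g₀ = fun s => Complex.exp (L s) := funext fun s => (hLg s).symm
    rw [this]; exact Complex.continuous_exp.comp hL
  have hper₀ : ∀ s, g₀ (s + 1) = g₀ s := by
    intro s
    rw [← hLg, ← hLg, hLn, Complex.exp_add, Complex.exp_int_mul_two_pi_mul_I, mul_one]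
  have hqe : Continuous fun s => Complex.exp (q s) := Complex.continuous_exp.comp hq
  have h2 := homotopy (g := fun s r => ((1 - r : ℝ) : ℂ) * (Complex.exp (q s) * g₀ s) +
    ((r : ℝ) : ℂ) * g₁ s) (n := n) (by fun_prop) ?_ ?_ (by simpa using h1)
  · simpa using h2
  · intro s r hr h0
    have h3 := hre s
    have h4 : g₁ s ≠ 0 := by
      intro h; rw [h] at h3; simp at h3
    have h5 : (((1 - r : ℝ) : ℂ) * (Complex.exp (q s) * g₀ s) + ((r : ℝ) : ℂ) * g₁ s) *
        (starRingEnd ℂ) (g₁ s) = 0 := by rw [h0, zero_mul]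
    have h6 := congrArg Complex.re h5
    rw [add_mul, mul_assoc, mul_assoc ((r : ℝ) : ℂ), Complex.add_re, Complex.re_ofReal_mul,
      Complex.re_ofReal_mul, Complex.mul_conj, Complex.ofReal_re, Complex.zero_re] at h6
    have h7 := Complex.normSq_pos.2 h4
    rcases eq_or_lt_of_le hr.1 with h8 | h8
    · rw [← h8] at h6
      linarith
    · have := mul_pos h8 h7
      have := mul_nonneg (sub_nonneg.2 hr.2) h3.le
      linarith
  · intro s r _
    simp only [hper, hper₀, hqper]

end HasDegree

/-- Turning numbers are degrees of the velocity. -/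
theorem HasTurningNumber.hasDegree {F g : ℝ → ℂ} {T : ℤ} (h : HasTurningNumber F T)
    (hF : ∀ s, HasDerivAt F (g s) s) (hg : Continuous g) (hper : ∀ s, g (s + 1) = g s) :
    HasDegree g T := by
  obtain ⟨θ, hθ, hθF, hT⟩ := h
  simp only [(hF _).deriv] at hθF
  refine hasDegree_of_log (L := fun s => ((Real.log ‖g s‖ : ℝ) : ℂ) + θ s * Complex.I) ?_ ?_ hper ?_
  · have h1 : Continuous fun s => Real.log ‖g s‖ :=
      hg.norm.log fun s => norm_ne_zero_iff.2 (hθF s).1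
    fun_prop
  · intro s
    rw [Complex.exp_add, ← Complex.ofReal_exp, Real.exp_log (norm_pos_iff.2 (hθF s).1)]
    exact (hθF s).2.symm
  · have h1 := hper 0
    rw [zero_add] at h1
    have h2 : (θ 1 : ℂ) = θ 0 + 2 * Real.pi * T := by
      have : θ 1 = θ 0 + 2 * Real.pi * T := by linarith
      rw [this]; push_cast; ring
    rw [h1, h2]
    ring

/-! ### Coordinates on a collar -/

namespace Collar

variable {γ F : Set S2} (K : Collar γ F)

/-- A family of points in a collar has continuous collar coordinates. -/
theorem exists_lift {H : ℝ × ℝ → S2} (hH : Continuous H)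
    (hm : ∀ z, H z ∈ K.part (Ioo (-K.δ) K.δ)) :
    ∃ φ τ : ℝ × ℝ → ℝ, Continuous φ ∧ Continuous τ ∧ ∀ z, |τ z| < K.δ ∧ K.Φ (φ z) (τ z) = H z := by
  classical
  have hm' : ∀ p ∈ K.part (Ioo (-K.δ) K.δ), ∃ w : ℝ × ℝ, |w.2| < K.δ ∧ K.Φ w.1 w.2 = p := by
    rintro _ ⟨w, ⟨-, hw⟩, rfl⟩
    exact ⟨w, abs_lt.2 hw, rfl⟩
  choose! ψ hψδ hψ using hm'
  let E : S2 → ℂ := fun p => Complex.exp ((ψ p).1 * (2 * Real.pi * Complex.I))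
  have hmem : ∀ s t, |t| < K.δ → K.Φ s t ∈ K.part (Ioo (-K.δ) K.δ) := fun s t ht =>
    K.mem_part (abs_lt.1 ht)
  have hinj : ∀ s t, |t| < K.δ → (ψ (K.Φ s t)).2 = t ∧ ∃ k : ℤ, (ψ (K.Φ s t)).1 = s + k := by
    intro s t ht
    have h1 := K.inj _ _ _ _ ht (hψδ _ (hmem s t ht)) (hψ _ (hmem s t ht)).symm
    exact ⟨h1.1.symm, h1.2⟩
  have hE : ∀ s t, |t| < K.δ → E (K.Φ s t) = Complex.exp (s * (2 * Real.pi * Complex.I)) := by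
    intro s t ht
    obtain ⟨-, k, hk⟩ := hinj s t ht
    simp only [E]
    rw [hk]
    push_cast
    rw [add_mul, Complex.exp_add, Complex.exp_int_mul_two_pi_mul_I, mul_one]
  have hev : ∀ s t, |t| < K.δ → ∀ᶠ z : ℝ × ℝ in 𝓝 (s, t), |z.2| < K.δ := fun s t ht =>
    (isOpen_lt continuous_snd.abs continuous_const).mem_nhds ht
  have hEc : ∀ p ∈ K.part (Ioo (-K.δ) K.δ), ContinuousAt E p := by
    intro p hp
    rw [← hψ p hp]
    have hd := hψδ p hp
    set s := (ψ p).1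
    set t := (ψ p).2
    rw [ContinuousAt, ← K.isOpenMap_of_abs_lt hd, Filter.tendsto_map'_iff, hE s t hd]
    have hc : Continuous fun z : ℝ × ℝ => Complex.exp (z.1 * (2 * Real.pi * Complex.I)) := by
      fun_prop
    refine (hc.continuousAt (x := (s, t))).tendsto.congr' ?_
    filter_upwards [hev s t hd] with z hz using (hE _ _ hz).symm
  have hτc : ∀ p ∈ K.part (Ioo (-K.δ) K.δ), ContinuousAt (fun p => (ψ p).2) p := by
    intro p hp
    rw [← hψ p hp]
    have hd := hψδ p hp
    set s := (ψ p).1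
    set t := (ψ p).2
    rw [ContinuousAt, ← K.isOpenMap_of_abs_lt hd, Filter.tendsto_map'_iff, (hinj s t hd).1]
    refine (continuous_snd.continuousAt (x := (s, t))).tendsto.congr' ?_
    filter_upwards [hev s t hd] with z hz using (hinj _ _ hz).1.symm
  have hEH : Continuous fun z => E (H z) := continuous_iff_continuousAt.2 fun z =>
    (hEc _ (hm z)).comp hH.continuousAt
  obtain ⟨L, hL, hLE⟩ := exists_log_of_simplyConnected hEH fun z => Complex.exp_ne_zero _
  refine ⟨fun z => (L z / (2 * Real.pi * Complex.I)).re, fun z => (ψ (H z)).2,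
    Complex.continuous_re.comp (hL.div_const _), continuous_iff_continuousAt.2 fun z =>
      (hτc _ (hm z)).comp hH.continuousAt, fun z => ⟨hψδ _ (hm z), ?_⟩⟩
  obtain ⟨n, hn⟩ := Complex.exp_eq_exp_iff_exists_int.1 (hLE z)
  have h1 : (L z / (2 * Real.pi * Complex.I)).re = (ψ (H z)).1 + n := by
    rw [hn, ← add_mul, mul_div_assoc, div_self Complex.two_pi_I_ne_zero, mul_one]
    simp
  simp only [h1, K.periodic_int]
  exact hψ _ (hm z)

/-- The shift of the first collar coordinate along a periodic family. -/
theorem exists_shift {H : ℝ × ℝ → S2} (hper : ∀ s t, H (s + 1, t) = H (s, t)) {φ τ : ℝ × ℝ → ℝ}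
    (hφ : Continuous φ) (h : ∀ z, |τ z| < K.δ ∧ K.Φ (φ z) (τ z) = H z) :
    ∃ k : ℤ, ∀ s t, φ (s + 1, t) = φ (s, t) + k ∧ τ (s + 1, t) = τ (s, t) := by
  have h1 : ∀ s t, τ (s, t) = τ (s + 1, t) ∧ ∃ k : ℤ, φ (s + 1, t) = φ (s, t) + k := fun s t =>
    K.inj _ _ _ _ (h _).1 (h _).1 (by rw [(h _).2, (h _).2, hper])
  obtain ⟨-, k, hk⟩ := h1 0 0
  refine ⟨k, fun s t => ⟨?_, (h1 s t).1.symm⟩⟩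
  have hc : Continuous fun z : ℝ × ℝ => ((φ (z.1 + 1, z.2) : ℝ) : ℂ) * (2 * Real.pi * Complex.I) :=
    (Complex.continuous_ofReal.comp (hφ.comp (by fun_prop))).mul continuous_const
  have hc' : Continuous fun z : ℝ × ℝ => ((φ z : ℝ) : ℂ) * (2 * Real.pi * Complex.I) :=
    (Complex.continuous_ofReal.comp hφ).mul continuous_const
  have h2 := sub_eq_sub_of_exp_eq hc hc' (fun z => by
    obtain ⟨-, m, hm⟩ := h1 z.1 z.2
    rw [hm]
    push_cast
    rw [add_mul, Complex.exp_add, Complex.exp_int_mul_two_pi_mul_I, mul_one]) (s, t) (0, 0)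
  simp only [hk] at h2
  have h3 : ((φ (s + 1, t) - φ (s, t) : ℝ) : ℂ) = ((k : ℝ) : ℂ) := by
    refine mul_right_cancel₀ Complex.two_pi_I_ne_zero ?_
    push_cast at h2 ⊢
    linear_combination h2
  have h4 : φ (s + 1, t) - φ (s, t) = k := by exact_mod_cast h3
  linarith

end Collar

/-! ### Push-offs in collar coordinates -/

/-- The properties of a push-off of the curve `γ` into the region `R` used below, in terms of the
projection `f` of the surface. The orientation condition says that `f ∘ H` preserves the
orientation. -/
structure IsOrientedPushOff (f : S2 → ℂ) (γ R : Set S2) (H : ℝ → ℝ → S2) : Prop where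
  smooth : IsSmoothStrip H
  periodic : ∀ s t, H (s + 1) t = H s t
  inj : ∀ s s', H s 0 = H s' 0 → ∃ k : ℤ, s' = s + k
  mem_curve : ∀ s, H s 0 ∈ γ
  stripDet_ne_zero : ∀ s, stripDet H s 0 ≠ 0
  mem_region : ∀ s, ∀ t ∈ Ioc (0 : ℝ) 1, H s t ∈ R
  oriented : ∀ s, ∀ t ∈ Ioc (0 : ℝ) 1, 0 < jac f (H s t) * stripDet H s t

theorem det3_ne_zero_of_linearIndependent {p : S2} {v w : E3} (hv : inner ℝ (p : E3) v = 0)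
    (hw : inner ℝ (p : E3) w = 0) (h : LinearIndependent ℝ ![v, w]) : det3 p v w ≠ 0 := by
  intro h0
  have h1 := eq_comb_of_tangent hv hw
  rw [h0, zero_smul, add_zero] at h1
  have h2 := LinearIndependent.pair_iff.1 h (inner ℝ v w) (-‖v‖ ^ 2) (by rw [← h1]; module)
  have h3 : v = 0 := by simpa using h2.2
  exact h.ne_zero 0 (by simpa using h3)

theorem IsPushOff.isOrientedPushOff {ε : S2 → E3} {γ R : Set S2} {H : ℝ → ℝ → S2}
    (h : IsPushOff ε γ R H) (hf : ContMDiff (𝓡 2) 𝓘(ℝ, ℂ) ∞ (proj ∘ ε)) :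
    IsOrientedPushOff (proj ∘ ε) γ R H := by
  have hsm : IsSmoothStrip H := ((contMDiff_coe_sphere (n := 2) (E := E3)).comp h.smooth).contDiff
  have h01 : (0 : ℝ) ∈ Icc (0 : ℝ) 1 := by simp
  refine ⟨hsm, h.periodic, fun s s' hs => (h.injective s s' 0 h01 0 h01 hs).2,
    fun s => h.start.subset ⟨s, rfl⟩, fun s => ?_, h.mem_region, fun s t ht => ?_⟩
  · exact det3_ne_zero_of_linearIndependent (hsm.inner_dFst s 0) (hsm.inner_dSnd s 0)
      (h.immersion s 0 h01)
  · have h1 := h.oriented s t ht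
    have e1 : projVelocity ε (fun s' => H s' t) s = sphereDeriv (proj ∘ ε) (H s t) (dFst H s t) :=
      (hasDerivAt_comp_curve hf (hsm.hasDerivAt_fst s t)).deriv
    have e2 : projVelocity ε (fun t' => H s t') t = sphereDeriv (proj ∘ ε) (H s t) (dSnd H s t) :=
      (hasDerivAt_comp_curve hf (hsm.hasDerivAt_snd s t)).deriv
    rwa [e1, e2, area_sphereDeriv hf] at h1

theorem deriv_periodic {Φ : ℝ → ℝ → S2} (hper : ∀ s t, Φ (s + 1) t = Φ s t) (k : ℤ) (s t : ℝ) :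
    Φ (s + k) t = Φ s t ∧ dFst Φ (s + k) t = dFst Φ s t ∧ dSnd Φ (s + k) t = dSnd Φ s t := by
  have h1 : ∀ s t, Φ (s + k) t = Φ s t := fun s t => by
    simpa using (show Function.Periodic (fun s => Φ s t) 1 from fun s => hper s t).int_mul k s
  refine ⟨h1 s t, ?_, ?_⟩
  · have h2 := deriv_comp_add_const (fun s => (Φ s t : E3)) (k : ℝ) s
    simp only [h1] at h2
    exact h2.symm
  · simp only [dSnd, h1]

/-- The velocity of the image under `f` of a horizontal line of the strip `Φ`. -/
def lineSpeed (f : S2 → ℂ) (Φ : ℝ → ℝ → S2) (s t : ℝ) : ℂ := sphereDeriv f (Φ s t) (dFst Φ s t)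

theorem continuous_lineSpeed {f : S2 → ℂ} (hf : ContMDiff (𝓡 2) 𝓘(ℝ, ℂ) ∞ f) {Φ : ℝ → ℝ → S2}
    (h : IsSmoothStrip Φ) : Continuous fun z : ℝ × ℝ => lineSpeed f Φ z.1 z.2 :=
  ((continuous_sphereDeriv hf).comp h.continuous).clm_apply h.continuous_dFst

/-- The speed does not vanish where `f ∘ Φ` is an immersion. -/
theorem lineSpeed_ne_zero {f : S2 → ℂ} (hf : ContMDiff (𝓡 2) 𝓘(ℝ, ℂ) ∞ f) {Φ : ℝ → ℝ → S2} {s t : ℝ}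
    (h : jac f (Φ s t) * stripDet Φ s t ≠ 0) : lineSpeed f Φ s t ≠ 0 := by
  intro h0
  have h1 := area_sphereDeriv hf (Φ s t) (dFst Φ s t) (dSnd Φ s t)
  rw [show sphereDeriv f (Φ s t) (dFst Φ s t) = 0 from h0] at h1
  exact h (h1.symm.trans (by simp [area]))

theorem lineSpeed_periodic {f : S2 → ℂ} {Φ : ℝ → ℝ → S2} (hper : ∀ s t, Φ (s + 1) t = Φ s t)
    (k : ℤ) (s t : ℝ) : lineSpeed f Φ (s + k) t = lineSpeed f Φ s t := by
  obtain ⟨h1, h2, -⟩ := deriv_periodic hper k s t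
  rw [lineSpeed, h1, h2, lineSpeed]

/-- A continuous change of parameter between a regular curve and a differentiable one is
differentiable. -/
theorem hasDerivAt_of_regular_comp {c b : ℝ → S2} {φ : ℝ → ℝ} (hc : IsRegularCurve c)
    (hφ : Continuous φ) (h : ∀ s, c (φ s) = b s) {s : ℝ} {v : E3}
    (hb : HasDerivAt (fun s => (b s : E3)) v s) :
    ∃ x : ℝ, HasDerivAt φ x s ∧ v = x • velocity c (φ s) := by
  set X := velocity c (φ s)
  -- the coordinate in the direction of the velocity is a local parameter of the curve
  have hm : HasStrictDerivAt (fun r => inner ℝ X (c r : E3)) (inner ℝ X X) (φ s) := by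
    have h1 : ContDiff ℝ ∞ fun r => inner ℝ X (c r : E3) := contDiff_const.inner ℝ hc.contDiff
    have h2 : HasDerivAt (fun r => inner ℝ X (c r : E3)) (inner ℝ X X) (φ s) :=
      (hasDerivAt_const (φ s) X).inner ℝ (hc.hasDerivAt (φ s)) |>.congr_deriv (by simp [X])
    exact h1.contDiffAt.hasStrictDerivAt' h2 (by simp)
  have hn : HasDerivAt (fun s => inner ℝ X (b s : E3)) (inner ℝ X v) s :=
    (hasDerivAt_const s X).inner ℝ hb |>.congr_deriv (by simp)
  have hX : inner ℝ X X ≠ 0 := (real_inner_self_pos.2 (hc.2 _)).ne'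
  have hi := (hm.to_localInverse hX).hasDerivAt
  have hl : ∀ᶠ r in 𝓝 (φ s), hm.localInverse _ _ _ hX (inner ℝ X (c r : E3)) = r :=
    HasStrictFDerivAt.eventually_left_inverse _
  have hφ' : HasDerivAt φ ((inner ℝ X X)⁻¹ * inner ℝ X v) s := by
    have h0 : inner ℝ X (c (φ s) : E3) = inner ℝ X (b s : E3) := by rw [h]
    rw [h0] at hi
    refine (hi.comp s hn).congr_of_eventuallyEq ?_
    filter_upwards [hφ.continuousAt.eventually hl] with r hr
    rw [h r] at hr
    exact hr.symm
  refine ⟨_, hφ', ?_⟩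
  have h1 := (hc.hasDerivAt (φ s)).scomp s hφ'
  have h2 : (fun t => (c t : E3)) ∘ φ = fun s => (b s : E3) := by
    funext r; simp only [Function.comp, h]
  rw [h2] at h1
  exact hb.unique h1

namespace IsOrientedPushOff

open CurvesWithCorners

variable {C : CurvesWithCorners} {γ R : Set S2} {f u : S2 → ℂ} {H : ℝ → ℝ → S2}

/-- Collar coordinates of a push-off near the curve. -/
theorem exists_coordinates {F : Set S2} (h : IsOrientedPushOff f γ R H) (K : Collar γ F) :
    ∃ ρ > 0, ρ ≤ 1 ∧ ∃ (φ τ : ℝ × ℝ → ℝ) (k : ℤ), Continuous φ ∧ Continuous τ ∧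
      (∀ s t, φ (s + 1, t) = φ (s, t) + k ∧ τ (s + 1, t) = τ (s, t)) ∧
      ∀ s t, |t| ≤ ρ → |τ (s, t)| < K.δ ∧ K.Φ (φ (s, t)) (τ (s, t)) = H s t := by
  have hopen : IsOpen (K.part (Ioo (-K.δ) K.δ)) := K.isOpen_part isOpen_Ioo fun t ht => abs_lt.2 ht
  obtain ⟨δ', hδ', hmem⟩ := exists_strip_of_eventually
    (P := fun s t => H s t ∈ K.part (Ioo (-K.δ) K.δ)) (fun t s => by rw [h.periodic]) fun s => by
      refine h.smooth.continuous.continuousAt.eventually_mem (hopen.mem_nhds ?_)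
      obtain ⟨r, hr⟩ := K.core.symm.subset (h.mem_curve s)
      simp only at hr ⊢
      rw [← hr]
      exact K.mem_part ⟨by linarith [K.δ_pos], K.δ_pos⟩
  set ρ := min (δ' / 2) 1
  have hρ : 0 < ρ := lt_min (by linarith) one_pos
  have hρδ : ρ < δ' := (min_le_left _ _).trans_lt (by linarith)
  let cl : ℝ → ℝ := fun t => max (-ρ) (min t ρ)
  have hcl : Continuous cl := by fun_prop
  have hclm : ∀ t, |cl t| < δ' := fun t => by
    refine lt_of_le_of_lt (abs_le.2 ⟨le_max_left _ _, max_le (by linarith) (min_le_right _ _)⟩) hρδ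
  have hcle : ∀ t, |t| ≤ ρ → cl t = t := fun t ht => by
    simp only [cl]
    rw [min_eq_left (abs_le.1 ht).2, max_eq_right (abs_le.1 ht).1]
  obtain ⟨φ, τ, hφ, hτ, hl⟩ := K.exists_lift (H := fun z => H z.1 (cl z.2))
    (h.smooth.continuous.comp (continuous_fst.prodMk (hcl.comp continuous_snd)))
    fun z => hmem _ _ (hclm z.2)
  obtain ⟨k, hk⟩ := K.exists_shift (fun s t => h.periodic s (cl t)) hφ hl
  refine ⟨ρ, hρ, min_le_right _ _, φ, τ, k, hφ, hτ, hk, fun s t ht => ?_⟩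
  have h1 := hl (s, t)
  simp only [hcle t ht] at h1
  exact h1

/-- The velocity of the curve `H · 0` points in the positive or in the negative direction of the
core of the collar, according to the side of the collar on which the Jacobian is positive. -/
theorem velocity_sign (h : IsOrientedPushOff f γ R H) (hF : IsFoldMap C f u) (hγ : γ ∈ C.curves)
    (K : Collar γ (C.others γ)) {η : ℝ}
    (hη : ∀ s t, |t| < K.δ → t ≠ 0 → 0 < η * t * jac f (K.Φ s t)) {s r x : ℝ}
    (hr : K.Φ r 0 = H s 0) (hx : dFst H s 0 = x • dFst K.Φ r 0) : 0 < x * η := by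
  obtain ⟨j, lam, hj, hlam, hlam0, hjac, hj0, htr⟩ := hF.exists_transverse
  have hcore := IsFoldMap.core_mem hγ K
  have hp := hcore r
  have hdΦ : 0 < det3 (K.Φ r 0) (dFst K.Φ r 0) (dSnd K.Φ r 0) :=
    K.det_pos r 0 (by simpa using K.δ_pos)
  set p := K.Φ r 0 with hpdef
  have hjs : sphereDeriv j p (dFst K.Φ r 0) = 0 :=
    sphereDeriv_velocity_eq_zero hj K.regular (fun t => hj0 _ (hcore t)) r
  set a := sphereDeriv j p (dSnd K.Φ r 0) with ha
  have ha0 : a ≠ 0 := by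
    intro h0
    obtain ⟨v, hv⟩ := htr _ hp
    exact hv (map_eq_zero_of_det3_ne_zero (sphereDeriv j p : E3 →ₗ[ℝ] ℝ) hdΦ.ne'
      (sphereDeriv_self hj _) hjs h0 v)
  have hlamc : ∀ {c : ℝ → S2}, Continuous c → c 0 = p →
      ∀ᶠ t in 𝓝 (0 : ℝ), 0 < lam p * lam (c t) := by
    intro c hc h0
    have h1 : Continuous fun t => lam p * lam (c t) := continuous_const.mul (hlam.comp hc)
    refine h1.continuousAt.eventually (lt_mem_nhds ?_)
    simp only
    rw [h0]
    exact mul_self_pos.2 (hlam0 p)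
  -- the sign of `η`
  have hi : 0 < a * lam p * η := by
    have h1 := eventually_mul_pos_of_hasDerivAt
      (hasDerivAt_comp_curve hj (K.smooth.hasDerivAt_snd r 0)) ha0
    have h2 : ∀ᶠ t in 𝓝[≠] (0 : ℝ), |t| < K.δ := nhdsWithin_le_nhds
      ((isOpen_lt continuous_abs continuous_const).mem_nhds (by simp [K.δ_pos]))
    have h3 := hlamc (K.smooth.continuous.comp (Continuous.prodMk_right r)) rfl
    obtain ⟨t, ⟨⟨h4, h5⟩, h6⟩, h7⟩ :=
      (((h1.and h2).and (nhdsWithin_le_nhds h3)).and self_mem_nhdsWithin).exists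
    rw [hj0 _ hp, sub_zero, sub_zero] at h4
    have h8 := hη r t h5 h7
    rw [hjac] at h8
    simp only [Function.comp] at h6
    have h9 := mul_pos (mul_pos h4 h8) h6
    have h10 : a * j (K.Φ r t) * t * (η * t * (lam (K.Φ r t) * j (K.Φ r t))) *
        (lam p * lam (K.Φ r t)) = (j (K.Φ r t) * t * lam (K.Φ r t)) ^ 2 * (a * lam p * η) := by ring
    rw [h10] at h9
    exact pos_of_mul_pos_right h9 (sq_nonneg _)
  set E := det3 p (dFst K.Φ r 0) (dSnd H s 0) with hE
  set D := sphereDeriv j p (dSnd H s 0) with hD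
  have hED : det3 p (dFst K.Φ r 0) (dSnd K.Φ r 0) * D = E * a := by
    have h1 := congrArg (sphereDeriv j p)
      (det3_smul_eq (p : E3) (dFst K.Φ r 0) (dSnd K.Φ r 0) (dSnd H s 0))
    simp only [map_add, map_smul, sphereDeriv_self hj, hjs, smul_eq_mul, mul_zero, zero_add] at h1
    exact h1
  have hsd : stripDet H s 0 = x * E := by
    rw [stripDet, ← hr, hx, hE]
    simp only [det3, PiLp.smul_apply, smul_eq_mul]; ring
  have hxE : x * E ≠ 0 := hsd ▸ h.stripDet_ne_zero s
  have hD0 : D ≠ 0 := by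
    intro h0
    rw [h0, mul_zero] at hED
    exact mul_ne_zero (right_ne_zero_of_mul hxE) ha0 hED.symm
  -- the sign of the derivative of `j` in the direction of the push-off
  have hii : 0 < D * lam p * (x * E) := by
    have h1 := hasDerivAt_comp_curve hj (h.smooth.hasDerivAt_snd s 0)
    rw [← hr] at h1
    have h2 := eventually_mul_pos_of_hasDerivAt h1 hD0
    have h3 := hlamc (c := fun t => H s t)
      (h.smooth.continuous.comp (Continuous.prodMk_right s)) hr.symm
    have h4 : ∀ᶠ t in 𝓝 (0 : ℝ), 0 < stripDet H s 0 * stripDet H s t :=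
      (continuous_const.mul (h.smooth.continuous_stripDet.comp
        (Continuous.prodMk_right s))).continuousAt.eventually
          (lt_mem_nhds (mul_self_pos.2 (h.stripDet_ne_zero s)))
    obtain ⟨⟨t, ht, ⟨h5, h6⟩, h7⟩, -⟩ := exists_mem_Ioo_of_eventually (δ := 1)
      ((h2.and (nhdsWithin_le_nhds h3)).and (nhdsWithin_le_nhds h4)) one_pos
    have h8 := h.oriented s t ⟨ht.1, ht.2.le⟩
    rw [hjac] at h8
    rw [← hr, hj0 _ hp, sub_zero, sub_zero] at h5
    rw [hsd] at h7
    have h9 := mul_pos (mul_pos h5 h6) (mul_pos h7 h8)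
    have h10 : D * j (H s t) * t * (lam p * lam (H s t)) *
        (x * E * stripDet H s t * (lam (H s t) * j (H s t) * stripDet H s t)) =
        (j (H s t) * lam (H s t) * stripDet H s t) ^ 2 * t * (D * lam p * (x * E)) := by ring
    rw [h10] at h9
    exact pos_of_mul_pos_right h9 (mul_nonneg (sq_nonneg _) ht.1.le)
  have h1 : 0 < D * lam p * (x * E) * (det3 p (dFst K.Φ r 0) (dSnd K.Φ r 0)) * (a * lam p * η) :=
    mul_pos (mul_pos hii hdΦ) hi
  have h2 : D * lam p * (x * E) * (det3 p (dFst K.Φ r 0) (dSnd K.Φ r 0)) * (a * lam p * η) =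
      (E * a * lam p) ^ 2 * (x * η) := by
    linear_combination (lam p * (x * E) * (a * lam p * η)) * hED
  rw [h2] at h1
  exact pos_of_mul_pos_right h1 (sq_nonneg _)

/-- The turning number of a push-off is, up to the sign `k`, the degree of the velocities of the
images of the parallels of the curve in a collar. -/
theorem turning_formula (h : IsOrientedPushOff f γ R H) (hF : IsFoldMap C f u) (hγ : γ ∈ C.curves)
    (hR : R ∈ C.regions) (K : Collar γ (C.others γ)) {η : ℝ} (hη0 : η ≠ 0)
    (hη : ∀ s t, |t| < K.δ → t ≠ 0 → 0 < η * t * jac f (K.Φ s t)) {T : ℤ}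
    (hT : HasDegree (fun s => lineSpeed f H s 1) T) :
    ∃ k : ℤ, (k = 1 ∨ k = -1) ∧ 0 < k * η ∧ ∀ t, |t| < K.δ → K.Φ 0 t ∈ R → ∀ n,
      HasDegree (fun s => lineSpeed f K.Φ s t) n → T = k * n := by
  obtain ⟨ρ, hρ, hρ1, φ, τ, k, hφ, hτ, hper, hco⟩ := h.exists_coordinates K
  have hφ0 : Continuous fun s => φ (s, 0) := hφ.comp (Continuous.prodMk_left (0 : ℝ))
  have hτ0 : ∀ s, τ (s, 0) = 0 := by
    intro s
    have h1 := hco s 0 (by simpa using hρ.le)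
    refine (K.mem_core_iff h1.1).1 (h1.2.symm ▸ h.mem_curve s)
  have hΦ0 : ∀ s, K.Φ (φ (s, 0)) 0 = H s 0 := by
    intro s
    have h1 := (hco s 0 (by simpa using hρ.le)).2
    rwa [hτ0] at h1
  have hder : ∀ s, ∃ x : ℝ, HasDerivAt (fun s => φ (s, 0)) x s ∧
      dFst H s 0 = x • dFst K.Φ (φ (s, 0)) 0 := fun s =>
    hasDerivAt_of_regular_comp K.regular hφ0 hΦ0 (h.smooth.hasDerivAt_fst s 0)
  choose x hx hxv using hder
  have hxη : ∀ s, 0 < x s * η := fun s => h.velocity_sign hF hγ K hη (hΦ0 s) (hxv s)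
  have hmono : StrictMono fun s => η * φ (s, 0) := by
    refine strictMono_of_hasDerivAt_pos (f' := fun s => η * x s) (fun s => (hx s).const_mul η)
      fun s => ?_
    rw [mul_comm]; exact hxη s
  have hφ1 : φ (1, 0) = φ (0, 0) + k := by simpa using (hper 0 0).1
  have hkη : 0 < k * η := by
    have h1 := hmono (zero_lt_one : (0 : ℝ) < 1)
    simp only [hφ1] at h1
    linarith
  have hk : k = 1 ∨ k = -1 := by
    have hno : ∀ s ∈ Ioo (0 : ℝ) 1, ∀ m : ℤ, φ (s, 0) ≠ φ (0, 0) + m := by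
      intro s hs m hm
      have h1 : H 0 0 = H s 0 := by
        rw [← hΦ0, ← hΦ0, hm, K.periodic_int]
      obtain ⟨i, hi⟩ := h.inj _ _ h1
      rw [zero_add] at hi
      have h2 : (0 : ℝ) < i := hi ▸ hs.1
      have h3 : (i : ℝ) < 1 := hi ▸ hs.2
      have h4 : 0 < i := by exact_mod_cast h2
      have h5 : i < 1 := by exact_mod_cast h3
      omega
    by_contra hcon
    rcases lt_trichotomy k 0 with h0 | h0 | h0
    · have h1 : k ≤ -2 := by omega
      have h2 : (k : ℝ) ≤ -2 := by exact_mod_cast h1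
      obtain ⟨s, hs, he⟩ := intermediate_value_Ioo' zero_le_one hφ0.continuousOn
        (show φ (0, 0) + ((-1 : ℤ) : ℝ) ∈ Ioo (φ (1, 0)) (φ (0, 0)) by
          rw [hφ1]; push_cast; constructor <;> linarith)
      exact hno s hs _ he
    · rw [h0] at hkη; simp at hkη
    · have h1 : 2 ≤ k := by omega
      have h2 : (2 : ℝ) ≤ k := by exact_mod_cast h1
      obtain ⟨s, hs, he⟩ := intermediate_value_Ioo zero_le_one hφ0.continuousOn
        (show φ (0, 0) + ((1 : ℤ) : ℝ) ∈ Ioo (φ (0, 0)) (φ (1, 0)) by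
          rw [hφ1]; push_cast; constructor <;> linarith)
      exact hno s hs _ he
  refine ⟨k, hk, hkη, fun t ht htR n hn => ?_⟩
  -- the component of the velocity of `H · t` in the direction of the parallels
  let X : ℝ × ℝ → ℝ := fun z => det3 (H z.1 z.2) (dFst H z.1 z.2) (dSnd K.Φ (φ z) (τ z))
  have hcΦ : ∀ {Y : Type} [TopologicalSpace Y] {g : ℝ × ℝ → Y}, Continuous g →
      Continuous fun z => g (φ z, τ z) := fun hg => hg.comp (hφ.prodMk hτ)
  have hXc : Continuous X := continuous_det3 (continuous_subtype_val.comp h.smooth.continuous)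
    h.smooth.continuous_dFst (hcΦ K.smooth.continuous_dSnd)
  have hsh : ∀ s t, K.Φ (φ (s + 1, t)) (τ (s + 1, t)) = K.Φ (φ (s, t)) (τ (s, t)) ∧
      dFst K.Φ (φ (s + 1, t)) (τ (s + 1, t)) = dFst K.Φ (φ (s, t)) (τ (s, t)) ∧
      dSnd K.Φ (φ (s + 1, t)) (τ (s + 1, t)) = dSnd K.Φ (φ (s, t)) (τ (s, t)) := by
    intro s t
    rw [(hper s t).1, (hper s t).2]
    exact deriv_periodic K.periodic k _ _
  have hHp : ∀ s t, H (s + 1) t = H s t ∧ dFst H (s + 1) t = dFst H s t := by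
    intro s t
    have h1 := deriv_periodic h.periodic 1 s t
    simp only [Int.cast_one] at h1
    exact ⟨h1.1, h1.2.1⟩
  obtain ⟨δ', hδ', hXη⟩ := exists_strip_of_eventually (P := fun s t => 0 < η * X (s, t))
    (fun t s => by simp only [X, (hsh s t).2.2, (hHp s t).1, (hHp s t).2]) fun s => by
      refine (continuous_const.mul hXc).continuousAt.eventually (lt_mem_nhds ?_)
      change 0 < η * det3 (H s 0) (dFst H s 0) (dSnd K.Φ (φ (s, 0)) (τ (s, 0)))
      rw [hτ0, hxv, ← hΦ0]
      have h1 := K.det_pos (φ (s, 0)) 0 (by simpa using K.δ_pos)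
      have h2 := mul_pos (hxη s) h1
      rw [stripDet] at h2
      simp only [det3, PiLp.smul_apply, smul_eq_mul] at h2 ⊢
      linarith
  set t₁ := min ρ (δ' / 2)
  have ht₁ : 0 < t₁ := lt_min hρ (by linarith)
  have ht₁ρ : t₁ ≤ ρ := min_le_left _ _
  have ht₁δ : |t₁| < δ' := by
    rw [abs_of_pos ht₁]; exact (min_le_right _ _).trans_lt (by linarith)
  have ht₁I : t₁ ∈ Ioc (0 : ℝ) 1 := ⟨ht₁, ht₁ρ.trans hρ1⟩
  have hlc := continuous_lineSpeed hF.smooth h.smooth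
  have hlcΦ := continuous_lineSpeed hF.smooth K.smooth
  have hcof : ∀ s, |τ (s, t₁)| < K.δ ∧ K.Φ (φ (s, t₁)) (τ (s, t₁)) = H s t₁ := fun s =>
    hco s t₁ (by rwa [abs_of_pos ht₁])
  have hφt : Continuous fun s => φ (s, t₁) := hφ.comp (Continuous.prodMk_left t₁)
  have hτt : Continuous fun s => τ (s, t₁) := hτ.comp (Continuous.prodMk_left t₁)
  have hjR : ∀ p ∈ R, jac f p ≠ 0 := fun p hp => hF.jac_ne_zero p (notMem_of_mem_region hR hp)
  -- deform the push-off towards the curve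
  have hT₁ : HasDegree (fun s => lineSpeed f H s t₁) T := by
    have h1 := HasDegree.homotopy (g := fun s r => lineSpeed f H s ((1 - r) * 1 + r * t₁)) (n := T)
      (hlc.comp (by fun_prop : Continuous fun z : ℝ × ℝ => (z.1, (1 - z.2) * 1 + z.2 * t₁)))
      (fun s r hr => lineSpeed_ne_zero hF.smooth (h.oriented s _ ?_).ne') (fun s r _ => ?_)
      (by simpa using hT)
    · simpa using h1
    · constructor
      · nlinarith [hr.1, hr.2]
      · nlinarith [hr.1, hr.2, ht₁I.2]
    · have := lineSpeed_periodic (f := f) h.periodic 1 s ((1 - r) * 1 + r * t₁)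
      rwa [Int.cast_one] at this
  -- turn the velocity into the direction of the parallels
  have hT₂ : HasDegree (fun s => (η : ℂ) * lineSpeed f K.Φ (φ (s, t₁)) (τ (s, t₁))) T := by
    let D : ℝ → ℝ := fun s => stripDet K.Φ (φ (s, t₁)) (τ (s, t₁))
    let Y : ℝ → ℝ := fun s =>
      det3 (H s t₁) (dFst K.Φ (φ (s, t₁)) (τ (s, t₁))) (dFst H s t₁)
    let B : ℝ → ℂ := fun s =>
      sphereDeriv f (K.Φ (φ (s, t₁)) (τ (s, t₁))) (dSnd K.Φ (φ (s, t₁)) (τ (s, t₁)))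
    let A : ℝ → ℂ := fun s => lineSpeed f K.Φ (φ (s, t₁)) (τ (s, t₁))
    have hpt : Continuous fun s : ℝ => (s, t₁) := Continuous.prodMk_left t₁
    have hpc : Continuous fun s => (φ (s, t₁), τ (s, t₁)) := hφt.prodMk hτt
    have hDc : Continuous D := K.smooth.continuous_stripDet.comp hpc
    have hXt : Continuous fun s => X (s, t₁) := hXc.comp hpt
    have hYc : Continuous Y := continuous_det3
      (continuous_subtype_val.comp (h.smooth.continuous.comp hpt))
      (K.smooth.continuous_dFst.comp hpc) (h.smooth.continuous_dFst.comp hpt)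
    have hAc : Continuous A := hlcΦ.comp hpc
    have hBc : Continuous B := ((continuous_sphereDeriv hF.smooth).comp
      (K.smooth.continuous.comp hpc)).clm_apply (K.smooth.continuous_dSnd.comp hpc)
    have hD0 : ∀ s, 0 < D s := fun s => K.det_pos _ _ (hcof s).1
    have hAB : ∀ s, area (A s) (B s) ≠ 0 := fun s => by
      have h1 := area_sphereDeriv hF.smooth (K.Φ (φ (s, t₁)) (τ (s, t₁)))
        (dFst K.Φ (φ (s, t₁)) (τ (s, t₁))) (dSnd K.Φ (φ (s, t₁)) (τ (s, t₁)))
      rw [show area (A s) (B s) = _ from h1]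
      refine mul_ne_zero (hjR _ ?_) (hD0 s).ne'
      rw [(hcof s).2]; exact h.mem_region s t₁ ht₁I
    have hcr : ∀ s, lineSpeed f H s t₁ =
        ((X (s, t₁) / D s : ℝ) : ℂ) * A s + ((Y s / D s : ℝ) : ℂ) * B s := by
      intro s
      have h1 := congrArg (sphereDeriv f (H s t₁)) (det3_smul_eq (H s t₁ : E3)
        (dFst K.Φ (φ (s, t₁)) (τ (s, t₁))) (dSnd K.Φ (φ (s, t₁)) (τ (s, t₁))) (dFst H s t₁))
      simp only [map_add, map_smul, sphereDeriv_self hF.smooth, smul_zero, zero_add] at h1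
      have hDs : D s = det3 (H s t₁) (dFst K.Φ (φ (s, t₁)) (τ (s, t₁)))
        (dSnd K.Φ (φ (s, t₁)) (τ (s, t₁))) := by rw [← (hcof s).2]; rfl
      rw [← hDs, Complex.real_smul, Complex.real_smul, Complex.real_smul] at h1
      have hA : A s = sphereDeriv f (H s t₁) (dFst K.Φ (φ (s, t₁)) (τ (s, t₁))) := by
        rw [← (hcof s).2]; rfl
      have hB : B s = sphereDeriv f (H s t₁) (dSnd K.Φ (φ (s, t₁)) (τ (s, t₁))) := by
        rw [← (hcof s).2]
      rw [← hA, ← hB] at h1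
      have hDc : (D s : ℂ) ≠ 0 := by exact_mod_cast (hD0 s).ne'
      refine mul_left_cancel₀ hDc ?_
      refine (show (D s : ℂ) * lineSpeed f H s t₁ = _ from h1).trans ?_
      simp only [X, Y]
      push_cast
      field_simp
    have hDp : ∀ s, D (s + 1) = D s := fun s => by
      simp only [D, stripDet, (hsh s t₁).1, (hsh s t₁).2.1, (hsh s t₁).2.2]
    have hXp : ∀ s, X (s + 1, t₁) = X (s, t₁) := fun s => by
      simp only [X, (hsh s t₁).2.2, (hHp s t₁).1, (hHp s t₁).2]
    have hYp : ∀ s, Y (s + 1) = Y s := fun s => by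
      simp only [Y, (hsh s t₁).2.1, (hHp s t₁).1, (hHp s t₁).2]
    have hAp : ∀ s, A (s + 1) = A s := fun s => by
      simp only [A, lineSpeed, (hsh s t₁).1, (hsh s t₁).2.1]
    have hBp : ∀ s, B (s + 1) = B s := fun s => by
      simp only [B, (hsh s t₁).1, (hsh s t₁).2.2]
    have hxc : Continuous fun s => X (s, t₁) / D s := hXt.div hDc fun s => (hD0 s).ne'
    have hyc : Continuous fun s => Y s / D s := hYc.div hDc fun s => (hD0 s).ne'
    have h1 := HasDegree.homotopy (g := fun s r =>
      (((1 - r) * (X (s, t₁) / D s) + r * η : ℝ) : ℂ) * A s +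
        (((1 - r) * (Y s / D s) : ℝ) : ℂ) * B s) (n := T)
      (by
        have e1 := hxc.comp (continuous_fst (X := ℝ) (Y := ℝ))
        have e2 := hyc.comp (continuous_fst (X := ℝ) (Y := ℝ))
        have e3 := hAc.comp (continuous_fst (X := ℝ) (Y := ℝ))
        have e4 := hBc.comp (continuous_fst (X := ℝ) (Y := ℝ))
        simp only [Function.comp_def] at e1 e2 e3 e4
        fun_prop)
      (fun s r hr h0 => ?_) (fun s r _ => by simp only [hDp, hXp, hYp, hAp, hBp]) ?_
    · simpa using h1
    · have h2 : area ((((1 - r) * (X (s, t₁) / D s) + r * η : ℝ) : ℂ) * A s +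
          (((1 - r) * (Y s / D s) : ℝ) : ℂ) * B s) (B s) =
          ((1 - r) * (X (s, t₁) / D s) + r * η) * area (A s) (B s) := by
        simp only [area, Complex.add_re, Complex.add_im, Complex.re_ofReal_mul,
          Complex.im_ofReal_mul]
        ring
      rw [h0] at h2
      have h3 : (1 - r) * (X (s, t₁) / D s) + r * η = 0 :=
        (mul_eq_zero.1 (h2.symm.trans (by simp [area]))).resolve_right (hAB s)
      have h4 : 0 < η * X (s, t₁) / D s := div_pos (hXη s t₁ ht₁δ) (hD0 s)
      have h5 : (1 - r) * (η * X (s, t₁) / D s) + r * η ^ 2 = 0 := by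
        linear_combination η * h3
      have h6 : 0 < η ^ 2 := by positivity
      rcases eq_or_lt_of_le hr.1 with h7 | h7
      · rw [← h7] at h5; linarith
      · have := mul_pos h7 h6
        have := mul_nonneg (sub_nonneg.2 hr.2) h4.le
        linarith
    · refine (congrArg (fun g => HasDegree g T) ?_).mp hT₁
      funext s
      rw [hcr]
      simp
  have hηC : (η : ℂ) ≠ 0 := by exact_mod_cast hη0
  have hT₃ : HasDegree (fun s => lineSpeed f K.Φ (φ (s, t₁)) (τ (s, t₁))) T := by
    have h1 := hT₂.const_mul (inv_ne_zero hηC)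
    simpa only [inv_mul_cancel_left₀ hηC] using h1
  have ht0 : t ≠ 0 := by
    rintro rfl
    exact notMem_of_mem_region hR htR (IsFoldMap.core_mem hγ K 0)
  have hτsign : ∀ s, 0 < τ (s, t₁) * t := by
    intro s
    have hHR := h.mem_region s t₁ ht₁I
    have hτs : τ (s, t₁) ≠ 0 := by
      intro h0
      have h1 := (hcof s).2
      rw [h0] at h1
      exact notMem_of_mem_region hR hHR (h1 ▸ IsFoldMap.core_mem hγ K _)
    have h1 := hη (φ (s, t₁)) _ (hcof s).1 hτs
    rw [(hcof s).2] at h1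
    have h2 := hη 0 t ht ht0
    have h3 := mul_pos_of_isPreconnected (isPreconnected_region hR)
      (continuous_jac hF.smooth).continuousOn hjR hHR htR
    have h4 := mul_pos (mul_pos h1 h2) h3
    have h5 : η * τ (s, t₁) * jac f (H s t₁) * (η * t * jac f (K.Φ 0 t)) *
        (jac f (H s t₁) * jac f (K.Φ 0 t)) =
        (η * jac f (H s t₁) * jac f (K.Φ 0 t)) ^ 2 * (τ (s, t₁) * t) := by ring
    rw [h5] at h4
    exact pos_of_mul_pos_right h4 (sq_nonneg _)
  have hT₄ : HasDegree (fun s => lineSpeed f K.Φ (φ (s, t₁)) t) T := by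
    have h1 := HasDegree.homotopy (g := fun s r =>
      lineSpeed f K.Φ (φ (s, t₁)) ((1 - r) * τ (s, t₁) + r * t)) (n := T)
      (hlcΦ.comp (by
        have e1 := hφt.comp (continuous_fst (X := ℝ) (Y := ℝ))
        have e2 := hτt.comp (continuous_fst (X := ℝ) (Y := ℝ))
        simp only [Function.comp_def] at e1 e2
        fun_prop : Continuous fun z : ℝ × ℝ =>
          (φ (z.1, t₁), (1 - z.2) * τ (z.1, t₁) + z.2 * t)))
      (fun s r hr => lineSpeed_ne_zero hF.smooth ?_)
      (fun s r _ => by rw [(hper s t₁).1, (hper s t₁).2, lineSpeed_periodic K.periodic])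
      (by simpa using hT₃)
    · simpa using h1
    · have hab : |(1 - r) * τ (s, t₁) + r * t| < K.δ := by
        have e1 := abs_lt.1 (hcof s).1
        have e2 := abs_lt.1 ht
        have := convex_Ioo (-K.δ) K.δ e1 e2 (sub_nonneg.2 hr.2) hr.1 (by ring)
        exact abs_lt.2 this
      have hne : (1 - r) * τ (s, t₁) + r * t ≠ 0 := by
        intro h0
        have h2 : (1 - r) * (τ (s, t₁) * t) + r * t ^ 2 = 0 := by linear_combination t * h0
        have h3 : 0 < t ^ 2 := by positivity
        rcases eq_or_lt_of_le hr.1 with h7 | h7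
        · rw [← h7] at h2; linarith [hτsign s]
        · have := mul_pos h7 h3
          have := mul_nonneg (sub_nonneg.2 hr.2) (hτsign s).le
          linarith
      exact mul_ne_zero (right_ne_zero_of_mul (hη _ _ hab hne).ne') (K.det_pos _ _ hab).ne'
  exact hT₄.unique (hn.comp hφt fun s => (hper s t₁).1)

end IsOrientedPushOff

/-! ### Comparison of two embeddings -/

open CurvesWithCorners

variable {C : CurvesWithCorners}

theorem lineSpeed_conj {f : S2 → ℂ} (hf : ContMDiff (𝓡 2) 𝓘(ℝ, ℂ) ∞ f) (Φ : ℝ → ℝ → S2) (s t : ℝ) :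
    lineSpeed (fun q => (starRingEnd ℂ) (f q)) Φ s t = (starRingEnd ℂ) (lineSpeed f Φ s t) :=
  sphereDeriv_conj hf _ _

theorem jac_mul_stripDet_ne_zero {γ : Set S2} {f u : S2 → ℂ} (hF : IsFoldMap C f u)
    (hγ : γ ∈ C.curves) (K : Collar γ (C.others γ)) {s t : ℝ} (ht : |t| < K.δ) (ht0 : t ≠ 0) :
    jac f (K.Φ s t) * stripDet K.Φ s t ≠ 0 :=
  mul_ne_zero (hF.jac_ne_zero _ fun h => ht0 ((collar_mem_iff hγ K ht).1 h)) (K.det_pos s t ht).ne'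

/-- Two fold maps inducing the same orientation off the curves have the same degrees along the
parallels of the curves: the difference is the degree of `dirQuotient`, which has a logarithm. -/
theorem HasDegree.of_jac_mul_pos {γ : Set S2} {f₀ u₀ f₁ u₁ : S2 → ℂ} (h₀ : IsFoldMap C f₀ u₀)
    (h₁ : IsFoldMap C f₁ u₁) (hpos : ∀ p ∉ ⋃₀ C.curves, 0 < jac f₀ p * jac f₁ p)
    (hγ : γ ∈ C.curves) (K : Collar γ (C.others γ)) {t : ℝ} (ht : |t| < K.δ) (ht0 : t ≠ 0) {n : ℤ}
    (hn : HasDegree (fun s => lineSpeed f₀ K.Φ s t) n) :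
    HasDegree (fun s => lineSpeed f₁ K.Φ s t) n := by
  obtain ⟨g, hg, hgq⟩ := h₀.exists_log_dirQuotient h₁ hpos
  have hC : ∀ s, K.Φ s t ∉ ⋃₀ C.curves := fun s h => ht0 ((collar_mem_iff hγ K ht).1 h)
  have hper : ∀ s, lineSpeed f₁ K.Φ (s + 1) t = lineSpeed f₁ K.Φ s t := fun s => by
    simpa using lineSpeed_periodic (f := f₁) K.periodic 1 s t
  have hpt : Continuous fun s : ℝ => (s, t) := Continuous.prodMk_left t
  refine hn.congr_of_re_pos ((continuous_lineSpeed h₁.smooth K.smooth).comp hpt) hper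
    (q := fun s => g (K.Φ s t)) (hg.comp_continuous (K.smooth.continuous.comp hpt) hC)
    (fun s => by simp only [K.periodic]) fun s => ?_
  simp only [hgq _ (hC s)]
  refine IsFoldMap.dirQuotient_re_pos h₀ h₁ (hpos _ (hC s)) (K.smooth.inner_dFst s t) fun h0 => ?_
  have h1 := K.det_pos s t ht
  rw [stripDet, h0] at h1
  simp [det3] at h1

/-- Two embeddings realizing the same collection have the same turning number function. -/
theorem CurvesWithCorners.IsRealizedBy.turningNumber_eq {ε₀ ε₁ : S2 → E3} {T₀ T₁ : C.Side → ℤ}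
    (h₀ : C.IsRealizedBy ε₀) (h₁ : C.IsRealizedBy ε₁) (hT₀ : C.IsTurningNumberFunction ε₀ T₀)
    (hT₁ : C.IsTurningNumberFunction ε₁ T₁) : T₀ = T₁ := by
  obtain ⟨u₀, hF₀⟩ := h₀.isFoldMap
  obtain ⟨u₁, hF₁⟩ := h₁.isFoldMap
  funext ⟨γ, R, hγ, hR, hfr⟩
  obtain ⟨K⟩ := CurvesWithCorners.exists_collar hγ
  have hcoreγ : K.Φ 0 0 ∈ γ := K.core.subset ⟨0, rfl⟩
  obtain ⟨h, hh, hhalf⟩ := exists_half_subset hγ K hR hcoreγ (frontier_subset_closure (hfr hcoreγ))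
  obtain ⟨t, ht0, ht, htR⟩ : ∃ t : ℝ, t ≠ 0 ∧ |t| < K.δ ∧ K.Φ 0 t ∈ R := by
    have hδ := K.δ_pos
    have hab : |h * (K.δ / 2)| < K.δ := by
      rcases hh with rfl | rfl <;> rw [abs_lt] <;> constructor <;> linarith
    have hpos : 0 < h * (h * (K.δ / 2)) := by
      rcases hh with rfl | rfl <;> linarith
    exact ⟨h * (K.δ / 2), right_ne_zero_of_mul hpos.ne', hab, hhalf _ _ hpos hab⟩
  -- the formula for the turning numbers of a single embedding
  have key : ∀ {ε : S2 → E3} {u : S2 → ℂ} {T : C.Side → ℤ}, IsFoldMap C (proj ∘ ε) u →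
      C.IsTurningNumberFunction ε T → ∃ (k n : ℤ) (η : ℝ), (k = 1 ∨ k = -1) ∧ 0 < k * η ∧
        0 < η * t * jac (proj ∘ ε) (K.Φ 0 t) ∧
        HasDegree (fun s => lineSpeed (proj ∘ ε) K.Φ s t) n ∧ T ⟨γ, R, hγ, hR, hfr⟩ = k * n := by
    intro ε u T hF hT
    obtain ⟨H, hH, hHT⟩ := hT ⟨γ, R, hγ, hR, hfr⟩
    have hO := hH.isOrientedPushOff hF.smooth
    obtain ⟨η, hη0, hη⟩ := hF.exists_jac_sign hγ K
    have hdeg : HasDegree (fun s => lineSpeed (proj ∘ ε) H s 1) (T ⟨γ, R, hγ, hR, hfr⟩) :=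
      hHT.hasDegree (fun s => hasDerivAt_comp_curve hF.smooth (hO.smooth.hasDerivAt_fst s 1))
        ((continuous_lineSpeed hF.smooth hO.smooth).comp (Continuous.prodMk_left (1 : ℝ)))
        fun s => by simpa using lineSpeed_periodic (f := proj ∘ ε) hO.periodic 1 s 1
    obtain ⟨k, hk, hkη, hform⟩ := hO.turning_formula hF hγ hR K hη0 hη hdeg
    obtain ⟨n, hn⟩ := exists_hasDegree (g := fun s => lineSpeed (proj ∘ ε) K.Φ s t)
      ((continuous_lineSpeed hF.smooth K.smooth).comp (Continuous.prodMk_left t))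
      (fun s => lineSpeed_ne_zero hF.smooth (jac_mul_stripDet_ne_zero hF hγ K ht ht0))
      fun s => by simpa using lineSpeed_periodic (f := proj ∘ ε) K.periodic 1 s t
    exact ⟨k, n, η, hk, hkη, hη 0 t ht ht0, hn, hform t ht htR n hn⟩
  obtain ⟨k₀, n₀, η₀, hk₀, hkη₀, hη₀, hn₀, e₀⟩ := key hF₀ hT₀
  obtain ⟨k₁, n₁, η₁, hk₁, hkη₁, hη₁, hn₁, e₁⟩ := key hF₁ hT₁
  rw [e₀, e₁]
  obtain ⟨κ, hκ, hκj⟩ := hF₀.exists_jac_mul_sign hF₁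
  have hC : K.Φ 0 t ∉ ⋃₀ C.curves := fun h => ht0 ((collar_mem_iff hγ K ht).1 h)
  -- the signs `k₀` and `k₁` agree if and only if the two orientations do
  have hkk : 0 < κ * (k₀ * k₁) := by
    have h2 := mul_pos (mul_pos (mul_pos hkη₀ hkη₁) (mul_pos hη₀ hη₁)) (hκj _ hC)
    have h3 : k₀ * η₀ * (k₁ * η₁) * (η₀ * t * jac (proj ∘ ε₀) (K.Φ 0 t) *
        (η₁ * t * jac (proj ∘ ε₁) (K.Φ 0 t))) *
        (κ * (jac (proj ∘ ε₀) (K.Φ 0 t) * jac (proj ∘ ε₁) (K.Φ 0 t))) =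
        (η₀ * η₁ * t * jac (proj ∘ ε₀) (K.Φ 0 t) * jac (proj ∘ ε₁) (K.Φ 0 t)) ^ 2 *
          (κ * (k₀ * k₁)) := by ring
    rw [h3] at h2
    exact pos_of_mul_pos_right h2 (sq_nonneg _)
  rcases hκ with rfl | rfl
  · have hnn : n₀ = n₁ := (HasDegree.of_jac_mul_pos hF₀ hF₁ (fun p hp => by simpa using hκj p hp)
      hγ K ht ht0 hn₀).unique hn₁
    rcases hk₀ with rfl | rfl <;> rcases hk₁ with rfl | rfl <;> simp [hnn] at hkk ⊢ <;>
      norm_num at hkk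
  · have h2 := HasDegree.of_jac_mul_pos hF₀ hF₁.conj (fun p hp => by
      rw [jac_conj hF₁.smooth]; linarith [hκj p hp]) hγ K ht ht0 hn₀
    simp only [lineSpeed_conj hF₁.smooth] at h2
    have hnn : n₀ = -n₁ := h2.unique hn₁.conj
    rcases hk₀ with rfl | rfl <;> rcases hk₁ with rfl | rfl <;> simp [hnn] at hkk ⊢ <;>
      norm_num at hkk

end CreaseSurface

end

theorem theorem1p1 (C : CreaseSurface.CurvesWithCorners) :
    (∀ w₀ w₁ : C.Side → ℤ,
      C.IsGaussBonnetWeighting w₀ → C.IsGaussBonnetWeighting w₁ → w₀ = w₁) ∧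
    (∀ (ε₀ ε₁ : CreaseSurface.S2 → CreaseSurface.E3) (T₀ T₁ : C.Side → ℤ),
      C.IsRealizedBy ε₀ → C.IsRealizedBy ε₁ →
      C.IsTurningNumberFunction ε₀ T₀ → C.IsTurningNumberFunction ε₁ T₁ → T₀ = T₁) :=
  ⟨fun _ _ => CreaseSurface.CurvesWithCorners.IsGaussBonnetWeighting.unique,
    fun _ _ _ _ => CreaseSurface.CurvesWithCorners.IsRealizedBy.turningNumber_eq⟩
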